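/- Let $K$ be a field, $n\ge 1$, and let $A=K\langle a_1,\dots,a_n\rangle$ be the free unital associative $K$-algebra of rank $n$. A set $\mathfrak T$ of right ideals of $A$ is a (right) Gabriel topology if it is non-empty, closed under larger right ideals and finite intersections, contains $(R:a)=\{x\in A: ax\in R\}$ for all $R\in\mathfrak T$, $a\in A$, and contains every right ideal $R$ for which some $S\in\mathfrak T$ satisfies $(R:s)\in\mathfrak T$ for all $s\in S$. The fc-topology of $A$ is the linear topology whose open right ideals are the right ideals of finite $K$-codimension. A flat bimorphism is an injective ring homomorphism $\phi:A\to Q$ which is an epimorphism in the category of rings and makes $Q$ a flat left $A$-module; $\phi:A\to Q$ and $\phi':A\to Q'$ are identified if there is a ring isomorphism $e:Q\to Q'$ with $e\phi=\phi'$. The Gabriel topology defined by $\phi$ consists of the right ideals $R$ of $A$ with $\phi(R)Q=Q$. 1. The right ideals of finite codimension form a Gabriel topology, and the fc-topology is Hausdorff; the two-sided ideals of finite codimension form a basis of neighbourhoods of $0$. 2. For a flat bimorphism $\phi:A\to Q$ let $\Phi_\phi$ be the set of all maximal two-sided ideals $I$ of $A$ with $IQ=Q$. Every ideal in $\Phi_\phi$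 has finite codimension, and $\phi\mapsto\Phi_\phi$ is a bijection from flat bimorphisms of $A$ (up to the identification above) onto sets of maximal two-sided ideals of $A$ of finite codimension. 3. Let $\phi:A\to Q$ be a flat bimorphism. The right ideals $R$ with $\phi(R)Q=Q$ form a Gabriel topology, and a right ideal belongs to it if and only if it contains a product $I_1I_2\cdots I_k$ ($k\ge 0$, repetitions allowed, the empty product being $A$) of ideals $I_j\in\Phi_\phi$. Every right ideal of $Q$ is projective (that is, $Q$ is right hereditary), and every projective right $Q$-module is free. 4. If moreover $n\ge 2$ and $\Phi_\phi$ contains an ideal of codimension $1$, then $Q$ is a simple ring of module type $(1,n)$: $Q\cong Q^n$ as right $Q$-modules, and whenever $Q^i\cong Q^j$ with $1\le i<j$ one has $n\le j$. -/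

import Mathlib

open scoped TensorProduct

universe u v w

/-! Rings are unital and associative. A right `A`-module is a `Module Aᵐᵒᵖ M`, and
a right ideal of `A` is a `Submodule Aᵐᵒᵖ A`. -/

section Flatness

/-- The relations `(m · a) ⊗ n - m ⊗ (a · n)` defining `M ⊗_A N` inside `M ⊗_ℤ N`,
for a right `A`-module `M` and a left `A`-module `N`. -/
def balancedRel (A : Type u) [Ring A] (M : Type v) [AddCommGroup M] [Module Aᵐᵒᵖ M]
    (N : Type w) [AddCommGroup N] [Module A N] : AddSubgroup (M ⊗[ℤ] N) :=
  AddSubgroup.closure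
    {t | ∃ (m : M) (a : A) (n : N), t = (MulOpposite.op a • m) ⊗ₜ[ℤ] n - m ⊗ₜ[ℤ] (a • n)}

/-- The tensor product `M ⊗_A N` of a right `A`-module and a left `A`-module over a
not necessarily commutative ring `A`. -/
abbrev BalancedTensor (A : Type u) [Ring A] (M : Type v) [AddCommGroup M] [Module Aᵐᵒᵖ M]
    (N : Type w) [AddCommGroup N] [Module A N] : Type (max v w) :=
  (M ⊗[ℤ] N) ⧸ balancedRel A M N

/-- The additive map `f ⊗ id : M ⊗_A N → M' ⊗_A N` induced by a right `A`-linear map `f`. -/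
def BalancedTensor.map (A : Type u) [Ring A] {M M' : Type v} [AddCommGroup M]
    [Module Aᵐᵒᵖ M] [AddCommGroup M'] [Module Aᵐᵒᵖ M'] (N : Type w) [AddCommGroup N]
    [Module A N] (f : M →ₗ[Aᵐᵒᵖ] M') : BalancedTensor A M N →+ BalancedTensor A M' N :=
  QuotientAddGroup.map (balancedRel A M N) (balancedRel A M' N)
    (TensorProduct.map f.toAddMonoidHom.toIntLinearMap LinearMap.id).toAddMonoidHom (by
      refine (AddSubgroup.closure_le _).2 ?_
      rintro t ⟨m, a, n, rfl⟩
      refine AddSubgroup.subset_closure ⟨f m, a, n, ?_⟩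
      rw [map_sub, ← f.map_smul]
      rfl)

/-- A left `A`-module `N` is flat if `- ⊗_A N` preserves injectivity of maps of right
`A`-modules. -/
def IsFlatLeftModule (A : Type u) [Ring A] (N : Type u) [AddCommGroup N] [Module A N] : Prop :=
  ∀ (M M' : Type u) [AddCommGroup M] [Module Aᵐᵒᵖ M] [AddCommGroup M'] [Module Aᵐᵒᵖ M']
    (f : M →ₗ[Aᵐᵒᵖ] M'), Function.Injective f → Function.Injective (BalancedTensor.map A N f)

end Flatness

section Bimorphisms

/-- `φ` is an epimorphism in the category of rings. -/
def IsRingEpi {A Q : Type u} [Ring A] [Ring Q] (φ : A →+* Q) : Prop :=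
  ∀ (C : Type u) [Ring C] (α β : Q →+* C), α.comp φ = β.comp φ → α = β

/-- `φ : A → Q` makes `Q` into a flat left `A`-module (via `a · q = φ(a) q`). -/
def IsLeftFlatHom {A Q : Type u} [Ring A] [Ring Q] (φ : A →+* Q) : Prop :=
  letI : Module A Q := Module.compHom Q φ
  IsFlatLeftModule A Q

/-- A flat bimorphism `φ : A → Q`: an injective ring epimorphism for which `Q` is flat as a
left `A`-module. -/
structure FlatBimorphism (A : Type u) [Ring A] where
  /-- The target ring. -/
  Q : Type u
  [ring : Ring Q]
  /-- The ring homomorphism. -/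
  φ : A →+* Q
  injective : Function.Injective φ
  epi : IsRingEpi φ
  flat : IsLeftFlatHom φ

attribute [instance] FlatBimorphism.ring

/-- Two flat bimorphisms out of `A` are identified if there is a ring isomorphism of their
targets which is compatible with the maps from `A`. -/
def FlatBimorphism.Iso {A : Type u} [Ring A] (F G : FlatBimorphism A) : Prop :=
  ∃ e : F.Q ≃+* G.Q, ∀ a : A, e (F.φ a) = G.φ a

end Bimorphisms

section Ideals

/-- A two-sided ideal regarded as a right ideal. -/
def TwoSidedIdeal.toRightIdeal {A : Type u} [Ring A] (I : TwoSidedIdeal A) :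
    Submodule Aᵐᵒᵖ A where
  carrier := I
  add_mem' := fun ha hb => I.add_mem ha hb
  zero_mem' := I.zero_mem
  smul_mem' := fun c _ hx => I.mul_mem_right _ c.unop hx

/-- The product `I₁ I₂ ⋯ I_k` of a finite list of two-sided ideals; the empty product is the
unit ideal. -/
def twoSidedProd {A : Type u} [Ring A] : List (TwoSidedIdeal A) → TwoSidedIdeal A
  | [] => ⊤
  | I :: l => TwoSidedIdeal.span {z | ∃ x ∈ I, ∃ y ∈ twoSidedProd l, z = x * y}

/-- The right ideal `φ(R)Q` of `Q`. -/
def extendRight {A Q : Type u} [Ring A] [Ring Q] (φ : A →+* Q) (R : Submodule Aᵐᵒᵖ A) :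
    Submodule Qᵐᵒᵖ Q :=
  Submodule.span Qᵐᵒᵖ (φ '' (R : Set A))

/-- The right ideal `R` has finite codimension over the field `K`. -/
def FiniteCodim (K : Type u) [Field K] {A : Type u} [Ring A] [Algebra K A]
    (R : Submodule Aᵐᵒᵖ A) : Prop :=
  Module.Finite K (A ⧸ R.restrictScalars K)

/-- The `K`-codimension of a right ideal (meaningful when it is finite). -/
noncomputable def codim (K : Type u) [Field K] {A : Type u} [Ring A] [Algebra K A]
    (R : Submodule Aᵐᵒᵖ A) : ℕ :=
  Module.finrank K (A ⧸ R.restrictScalars K)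

end Ideals

section Topologies

/-- A (right) Gabriel topology on a ring `A`, as its set of open right ideals. -/
structure IsGabrielTopology {A : Type u} [Ring A] (T : Set (Submodule Aᵐᵒᵖ A)) : Prop where
  top_mem : ⊤ ∈ T
  mem_of_le : ∀ R ∈ T, ∀ S, R ≤ S → S ∈ T
  inf_mem : ∀ R ∈ T, ∀ S ∈ T, R ⊓ S ∈ T
  /-- `(R : a) = {x | a x ∈ R}` is open for `R` open and `a ∈ A`. -/
  colon_mem : ∀ R ∈ T, ∀ (a : A) (C : Submodule Aᵐᵒᵖ A), (∀ x, x ∈ C ↔ a * x ∈ R) → C ∈ T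
  /-- `R` is open as soon as `(R : s)` is open for all `s` in some open `S`. -/
  mem_of_colon : ∀ (R : Submodule Aᵐᵒᵖ A), ∀ S ∈ T,
    (∀ s ∈ S, ∀ C : Submodule Aᵐᵒᵖ A, (∀ x, x ∈ C ↔ s * x ∈ R) → C ∈ T) → R ∈ T

/-- The fc-topology on a `K`-algebra `A`: the linear topology whose basic neighbourhoods of a
point `x` are the cosets `x + R`, with `R` a right ideal of finite codimension. -/
abbrev fcTopology (K A : Type u) [Field K] [Ring A] [Algebra K A] : TopologicalSpace A where
  IsOpen U := ∀ x ∈ U, ∃ R : Submodule Aᵐᵒᵖ A, FiniteCodim K R ∧ ∀ r ∈ R, x + r ∈ U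
  isOpen_univ := fun _ _ =>
    ⟨⊤, by
      have h : Submodule.CoFG ((⊤ : Submodule Aᵐᵒᵖ A).restrictScalars K) := by
        rw [Submodule.restrictScalars_top]; exact Submodule.CoFG.top
      exact h, fun _ _ => trivial⟩
  isOpen_inter := by
    rintro U V hU hV x ⟨hxU, hxV⟩
    obtain ⟨R, hR, hRU⟩ := hU x hxU
    obtain ⟨S, hS, hSV⟩ := hV x hxV
    exact ⟨R ⊓ S, Submodule.CoFG.inf (S := R.restrictScalars K) (T := S.restrictScalars K) hR hS,
      fun r hr => ⟨hRU r hr.1, hSV r hr.2⟩⟩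
  isOpen_sUnion := by
    rintro s hs x ⟨U, hU, hxU⟩
    obtain ⟨R, hR, hRU⟩ := hs U hU x hxU
    exact ⟨R, hR, fun r hr => ⟨U, hU, hRU r hr⟩⟩

/-- The open right ideals of the Gabriel topology defined by a flat bimorphism `φ : A → Q`:
those `R` with `φ(R)Q = Q`. -/
def FlatBimorphism.opens {A : Type u} [Ring A] (F : FlatBimorphism A) :
    Set (Submodule Aᵐᵒᵖ A) :=
  {R | extendRight F.φ R = ⊤}

/-- The set of maximal two-sided ideals `I` of `A` with `IQ = Q`. -/
def FlatBimorphism.maxIdeals {A : Type u} [Ring A] (F : FlatBimorphism A) :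
    Set (TwoSidedIdeal A) :=
  {I | IsCoatom I ∧ extendRight F.φ I.toRightIdeal = ⊤}

end Topologies

section RingProperties

/-- Every right ideal is a projective right module. -/
def IsRightHereditary (Q : Type u) [Ring Q] : Prop :=
  ∀ J : Submodule Qᵐᵒᵖ Q, Module.Projective Qᵐᵒᵖ J

/-- Every projective right module (finitely generated or not) is free. -/
def IsRightProjectiveFree (Q : Type u) [Ring Q] : Prop :=
  ∀ (P : Type w) [AddCommGroup P] [Module Qᵐᵒᵖ P], Module.Projective Qᵐᵒᵖ P →
    Module.Free Qᵐᵒᵖ P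

/-- The free right `Q`-modules `Q^i` and `Q^j` are isomorphic. -/
def FreeRanksIso (Q : Type u) [Ring Q] (i j : ℕ) : Prop :=
  Nonempty ((Fin i → Q) ≃ₗ[Qᵐᵒᵖ] (Fin j → Q))

/-- `Q` has module type `(m, n)`: `1 ≤ m < n`, the free modules of ranks `m` and `n` are
isomorphic, and `m`, `n` are the smallest integers with this property. -/
def HasModuleType (Q : Type u) [Ring Q] (m n : ℕ) : Prop :=
  1 ≤ m ∧ m < n ∧ FreeRanksIso Q m n ∧
    ∀ i j : ℕ, 1 ≤ i → i < j → FreeRanksIso Q i j → m ≤ i ∧ n ≤ j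

end RingProperties

/-! The free algebra `A` is controlled by leading terms. Words are ordered compatibly with right
multiplication, so the leading monomials of a submodule `U` of `A^m` are stable under appending
words, and elements of `U` realizing the minimal ones form a basis
(`IsMonomialBasis.nonempty_basis`). If `U` has finite codimension `d` and rank `r`, counting
monomials gives the Schreier–Lewin formula `r + d = d n + m`. If a finitely generated right ideal
`R` has infinite codimension, some `(R : s)` is zero (`exists_rightColon_eq_bot`).

A flat bimorphism is recovered from its Gabriel topology. Flatness makes the annihilator of `m` open
when `m ⊗ Q = 0`, and the epimorphism property gives `q ⊗ p = 1 ⊗ q p` in `Q ⊗ Q`; hence every `q`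
satisfies `q D ⊆ A` for some open `D`. Such rings of fractions (`IsPerfectLocalization`) are
determined by the topology. Conversely, linear maps on open right ideals, up to equality on smaller
ones, form such a ring when the open right ideals have finite bases and zero left annihilators.

Zero is not open, so open right ideals have finite codimension. Climbing from `R` to `A` through
simple factors, whose annihilators are maximal by a density argument, shows that an open `R`
contains a product of open maximal ideals. Thus `maxIdeals` determines the topology. Conversely,
products of a prescribed set of maximal ideals generate a Gabriel topology, and primeness prevents
further maximal ideals from being open.

A basis of the contraction to `A` of a right ideal of `Q` is a basis of that ideal; a leading
coefficient argument then frees all projectives. An isomorphism `Q^i ≅ Q^j` restricts to one between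
submodules of finite codimension in `A^i` and `A^j`, and Schreier–Lewin compares `i` and `j` modulo
`n - 1`. An open ideal of codimension one is generated by elements `a_i + c_i` forming an invertible
row; the resulting Leavitt relations give `Q ≅ Q^n` and simplicity. -/

open MulOpposite Module

/-! ### Leading terms with respect to a numbered basis -/

section Leading

variable {σ K M : Type*} [Field K] [AddCommGroup M] [Module K M]

/-- `f` has leading index `s`: the largest index, for the numbering `ord`, at which `f` has a
non-zero coordinate. -/
def IsLead (b : Basis σ K M) (ord : σ → ℕ) (f : M) (s : σ) : Prop :=
  b.repr f s ≠ 0 ∧ ∀ t, ord s < ord t → b.repr f t = 0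

/-- The leading indices of the elements of a subspace. -/
def leadSet (b : Basis σ K M) (ord : σ → ℕ) (U : Submodule K M) : Set σ :=
  {s | ∃ f ∈ U, IsLead b ord f s}

variable {b : Basis σ K M} {ord : σ → ℕ}

theorem exists_isLead {f : M} (hf : f ≠ 0) : ∃ s, IsLead b ord f s := by
  have hne : (b.repr f).support.Nonempty := by simpa using hf
  obtain ⟨s, hs, hmax⟩ := Finset.exists_max_image _ ord hne
  refine ⟨s, by simpa using hs, fun t ht => ?_⟩
  by_contra h
  exact absurd (hmax t (by simpa using h)) (by omega)

theorem isLead_basis (s : σ) : IsLead b ord (b s) s := by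
  classical
  refine ⟨by simp, fun t ht => ?_⟩
  rw [b.repr_self, Finsupp.single_apply, if_neg]
  rintro rfl
  exact lt_irrefl _ ht

/-- In a vanishing combination, the coordinate at the largest leading index with a non-zero
coefficient receives a contribution from one vector only. -/
theorem linearIndependent_of_isLead (ho : Function.Injective ord) {τ : Type*} {v : τ → M}
    {s : τ → σ} (hs : Function.Injective s) (hv : ∀ i, IsLead b ord (v i) (s i)) :
    LinearIndependent K v := by
  classical
  rw [linearIndependent_iff']
  intro S g hg i hi
  by_contra hne
  obtain ⟨j, hj, hmax⟩ := Finset.exists_max_image (S.filter fun i => g i ≠ 0)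
    (fun i => ord (s i)) ⟨i, by simp [hi, hne]⟩
  rw [Finset.mem_filter] at hj
  have h0 : b.repr (∑ i ∈ S, g i • v i) (s j) = 0 := by rw [hg]; simp
  rw [map_sum, Finsupp.finsetSum_apply, Finset.sum_eq_single j] at h0
  · simp only [map_smul, Finsupp.smul_apply, smul_eq_mul, mul_eq_zero] at h0
    exact h0.elim hj.2 (hv j).1
  · intro k hk hkj
    by_cases hgk : g k = 0
    · simp [hgk]
    · have h1 := hmax k (by simp [hk, hgk])
      have h2 : ord (s k) ≠ ord (s j) := fun h => hkj (hs (ho h))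
      rw [map_smul, Finsupp.smul_apply, (hv k).2 _ (lt_of_le_of_ne h1 h2), smul_zero]
  · exact fun h => absurd hj.1 h

/-- Division algorithm: subtracting a multiple of an element of `U ⊓ V` with the same leading index
lowers the number of that index. -/
theorem le_of_isLead (ho : Function.Injective ord) {U V : Submodule K M}
    (h : ∀ s ∈ leadSet b ord U, ∃ v ∈ U, v ∈ V ∧ IsLead b ord v s) : U ≤ V := by
  suffices H : ∀ N : ℕ, ∀ f ∈ U, ∀ s, ord s = N → IsLead b ord f s → f ∈ V by
    intro f hf
    by_cases h0 : f = 0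
    · rw [h0]; exact V.zero_mem
    · obtain ⟨s, hs⟩ := exists_isLead (b := b) (ord := ord) h0
      exact H _ f hf s rfl hs
  intro N
  induction N using Nat.strong_induction_on with
  | _ N ih =>
    intro f hf s hsN hfs
    obtain ⟨v, hvU, hvV, hvs⟩ := h s ⟨f, hf, hfs⟩
    set c : K := b.repr f s / b.repr v s with hc
    set g : M := f - c • v with hg
    have hgU : g ∈ U := U.sub_mem hf (U.smul_mem _ hvU)
    have hgV : g ∈ V := by
      by_cases h0 : g = 0
      · rw [h0]; exact V.zero_mem
      · obtain ⟨t, ht⟩ := exists_isLead (b := b) (ord := ord) h0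
        refine ih (ord t) ?_ g hgU t rfl ht
        rw [← hsN]
        by_contra hlt
        rcases (not_lt.1 hlt).lt_or_eq with hlt | heq
        · refine ht.1 ?_
          simp [hg, hfs.2 t hlt, hvs.2 t hlt]
        · obtain rfl := ho heq
          refine ht.1 ?_
          have := hvs.1
          simp [hg, hc, this]
    have : f = g + c • v := by simp [hg]
    rw [this]
    exact V.add_mem hgV (V.smul_mem _ hvV)

/-- Normal forms: a non-zero combination of non-leading basis vectors has its leading index outside
`leadSet`, so it is not in `U`; and every index leads either an element of `U` or one of these basis
vectors. -/
theorem isCompl_span_leadSet (ho : Function.Injective ord) (U : Submodule K M) :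
    IsCompl U (Submodule.span K (b '' (leadSet b ord U)ᶜ)) := by
  constructor
  · rw [Submodule.disjoint_def]
    intro f hfU hf
    by_contra h0
    obtain ⟨s, hs⟩ := exists_isLead (b := b) (ord := ord) h0
    rw [b.mem_span_image] at hf
    exact hf (by simpa using hs.1) ⟨f, hfU, hs⟩
  · rw [codisjoint_iff, eq_top_iff]
    refine le_of_isLead (b := b) ho fun s _ => ?_
    by_cases hs : s ∈ leadSet b ord U
    · obtain ⟨f, hf, hfs⟩ := hs
      exact ⟨f, trivial, Submodule.mem_sup_left hf, hfs⟩
    · exact ⟨b s, trivial, Submodule.mem_sup_right (Submodule.subset_span ⟨s, hs, rfl⟩),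
        isLead_basis s⟩

/-- The vectors `b s`, for `s` not a leading index, form a basis of the quotient. -/
noncomputable def basisQuotientLeadSet (ho : Function.Injective ord) (U : Submodule K M) :
    Basis ↥(leadSet b ord U)ᶜ K (M ⧸ U) :=
  ((Basis.span (b.linearIndependent.comp ((↑) : ↥(leadSet b ord U)ᶜ → σ)
    Subtype.val_injective)).map (LinearEquiv.ofEq _ _ (by
      rw [Set.range_comp, Subtype.range_coe]))).map
    (Submodule.quotientEquivOfIsCompl U _ (isCompl_span_leadSet (b := b) ho U)).symm

theorem finite_compl_leadSet (ho : Function.Injective ord) {U : Submodule K M}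
    (hU : U.CoFG) : (leadSet b ord U)ᶜ.Finite :=
  have : Module.Finite K (M ⧸ U) := hU
  @Set.toFinite _ _ (Module.Finite.finite_basis (basisQuotientLeadSet (b := b) ho U))

theorem cofg_of_finite_compl_leadSet (ho : Function.Injective ord) {U : Submodule K M}
    (hU : (leadSet b ord U)ᶜ.Finite) : U.CoFG :=
  have := hU.to_subtype
  Module.Finite.of_basis (basisQuotientLeadSet (b := b) ho U)

end Leading

/-- If the products of a basis of an algebra `S` with the vectors `f p` are linearly independent
over `K`, then the `f p` are linearly independent over `S`. -/
theorem LinearIndependent.of_basis_smul {K S M τ P : Type*} [Field K] [Ring S] [Algebra K S]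
    [AddCommGroup M] [Module K M] [Module S M] [IsScalarTower K S M] (c : Basis τ K S)
    {f : P → M} (h : LinearIndependent K fun x : P × τ => c x.2 • f x.1) :
    LinearIndependent S f := by
  classical
  rw [linearIndependent_iff'] at h ⊢
  intro s g hg p hp
  let T := s.biUnion fun p => (c.repr (g p)).support
  have key : ∀ p ∈ s, g p = ∑ t ∈ T, c.repr (g p) t • c t := by
    intro p hp
    conv_lhs => rw [← c.linearCombination_repr (g p), Finsupp.linearCombination_apply,
      Finsupp.sum]
    refine Finset.sum_subset (fun t ht => Finset.mem_biUnion.2 ⟨p, hp, ht⟩) ?_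
    intro t _ ht
    simp [Finsupp.notMem_support_iff.1 ht]
  have h2 := h (s ×ˢ T) (fun x => c.repr (g x.1) x.2) (by
    rw [Finset.sum_product, ← hg]
    refine Finset.sum_congr rfl fun p hp => ?_
    conv_rhs => rw [key p hp, Finset.sum_smul]
    exact Finset.sum_congr rfl fun t _ => by rw [smul_assoc])
  rw [key p hp]
  exact Finset.sum_eq_zero fun t ht => by
    rw [h2 (p, t) (Finset.mk_mem_product hp ht), zero_smul]

/-! ### An order on monomials compatible with right multiplication -/

section Words

/-- The word `u` as an element of the free algebra. -/
def FreeAlgebra.word (K : Type u) [Field K] {n : ℕ} (l : List (Fin n)) :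
    FreeAlgebra K (Fin n) :=
  (l.map (FreeAlgebra.ι K)).prod

theorem FreeAlgebra.word_append (K : Type u) [Field K] {n : ℕ} (l l' : List (Fin n)) :
    FreeAlgebra.word K (l ++ l') = FreeAlgebra.word K l * FreeAlgebra.word K l' := by
  simp [FreeAlgebra.word]

/-- The basis of words of the free algebra. -/
noncomputable def FreeAlgebra.wordBasis (K : Type u) [Field K] (n : ℕ) :
    Basis (List (Fin n)) K (FreeAlgebra K (Fin n)) :=
  (FreeAlgebra.basisFreeMonoid K (Fin n)).reindex FreeMonoid.toList

theorem FreeAlgebra.wordBasis_apply (K : Type u) [Field K] {n : ℕ} (l : List (Fin n)) :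
    FreeAlgebra.wordBasis K n l = FreeAlgebra.word K l := by
  simp [FreeAlgebra.wordBasis, FreeAlgebra.basisFreeMonoid, FreeAlgebra.word,
    FreeAlgebra.equivMonoidAlgebraFreeMonoid, FreeMonoid.lift_apply]

variable {n m : ℕ}

/-- The number of a word, its letters being read as digits in base `n + 1`. -/
def wordCode (l : List (Fin n)) : ℕ :=
  l.foldl (fun a x => a * (n + 1) + (x + 1)) 0

theorem wordCode_concat (l : List (Fin n)) (x : Fin n) :
    wordCode (l ++ [x]) = wordCode l * (n + 1) + (x + 1) := by
  simp [wordCode]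

theorem mul_add_lt_iff {a b N x y : ℕ} (hx : x < N) (hy : y < N) :
    a * N + x < b * N + y ↔ a < b ∨ a = b ∧ x < y := by
  rcases lt_trichotomy a b with h | rfl | h
  · have : (a + 1) * N ≤ b * N := Nat.mul_le_mul_right N h
    rw [add_mul] at this
    exact ⟨fun _ => .inl h, fun _ => by omega⟩
  · simp
  · have : (b + 1) * N ≤ a * N := Nat.mul_le_mul_right N h
    rw [add_mul] at this
    exact ⟨fun _ => by omega, fun h' => by omega⟩

/-- The last letter is the least significant digit, and every digit is below the base. -/
theorem wordCode_concat_lt_iff {l l' : List (Fin n)} {x y : Fin n} :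
    wordCode (l ++ [x]) < wordCode (l' ++ [y]) ↔
      wordCode l < wordCode l' ∨ wordCode l = wordCode l' ∧ x < y := by
  rw [wordCode_concat, wordCode_concat, mul_add_lt_iff (by omega) (by omega)]
  simp

/-- The digits run from 1 to `n`, never 0, so non-empty words have positive code and leading letters
are not lost. -/
theorem wordCode_injective : Function.Injective (wordCode (n := n)) := by
  intro l
  induction l using List.reverseRecOn with
  | nil =>
    intro l' h
    rcases List.eq_nil_or_concat' l' with rfl | ⟨l', y, rfl⟩
    · rfl
    · rw [wordCode_concat] at h
      simp [wordCode] at h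
  | append_singleton l x ih =>
    intro l' h
    rcases List.eq_nil_or_concat' l' with rfl | ⟨l', y, rfl⟩
    · rw [wordCode_concat] at h
      simp [wordCode] at h
    · have h1 := (not_congr wordCode_concat_lt_iff).1 h.not_lt
      have h2 := (not_congr wordCode_concat_lt_iff).1 h.not_gt
      have h3 : wordCode l = wordCode l' := by omega
      have h4 : x = y := by omega
      rw [ih h3, h4]

/-- A numbering of the monomials `(k, l)` of a free module of rank `m`: by the word first. -/
def monoOrd (s : Fin m × List (Fin n)) : ℕ :=
  wordCode s.2 * m + s.1

theorem monoOrd_lt_iff {s t : Fin m × List (Fin n)} : monoOrd s < monoOrd t ↔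
    wordCode s.2 < wordCode t.2 ∨ wordCode s.2 = wordCode t.2 ∧ s.1 < t.1 := by
  rw [monoOrd, monoOrd, mul_add_lt_iff s.1.2 t.1.2]
  simp

theorem monoOrd_injective : Function.Injective (monoOrd (n := n) (m := m)) := by
  rintro ⟨k, l⟩ ⟨k', l'⟩ h
  have h1 := (not_congr monoOrd_lt_iff).1 h.not_lt
  have h2 := (not_congr monoOrd_lt_iff).1 h.not_gt
  simp only at h1 h2
  have h3 : wordCode l = wordCode l' := by omega
  have h4 : k = k' := by omega
  rw [wordCode_injective h3, h4]

/-- Common letters appended at the end are the least significant digits and never decide a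
comparison. -/
theorem monoOrd_append_lt_iff {k k' : Fin m} {l l' : List (Fin n)} (r : List (Fin n)) :
    monoOrd (k, l ++ r) < monoOrd (k', l' ++ r) ↔ monoOrd (k, l) < monoOrd (k', l') := by
  induction r using List.reverseRecOn with
  | nil => simp
  | append_singleton r x ih =>
    rw [← ih, monoOrd_lt_iff, monoOrd_lt_iff, ← List.append_assoc, ← List.append_assoc,
      wordCode_concat_lt_iff]
    simp only [lt_self_iff_false, and_false, or_false]
    rw [wordCode_concat, wordCode_concat]
    simp

end Words

/-! ### Bases of submodules and the Schreier–Lewin formula -/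

section RightSubmodules

variable {K : Type u} [Field K] {n m : ℕ} {M : Type v} [AddCommGroup M] [Module K M]
  [Module (FreeAlgebra K (Fin n))ᵐᵒᵖ M] [IsScalarTower K (FreeAlgebra K (Fin n))ᵐᵒᵖ M]

/-- A basis of a right module over the free algebra indexed by the monomials of a free module of
rank `m`, on which words act by concatenation. -/
def IsMonomialBasis (b : Basis (Fin m × List (Fin n)) K M) : Prop :=
  ∀ k l r, op (FreeAlgebra.word K r) • b (k, l) = b (k, l ++ r)

variable {b : Basis (Fin m × List (Fin n)) K M}

theorem IsMonomialBasis.repr_smul (hb : IsMonomialBasis b) (r : List (Fin n)) (f : M) :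
    b.repr (op (FreeAlgebra.word K r) • f) =
      (b.repr f).mapDomain (fun s => (s.1, s.2 ++ r)) := by
  have : b.repr.toLinearMap ∘ₗ Algebra.lsmul K K M (op (FreeAlgebra.word K r)) =
      Finsupp.lmapDomain K K (fun s : Fin m × List (Fin n) => (s.1, s.2 ++ r)) ∘ₗ
        b.repr.toLinearMap := by
    refine b.ext fun s => ?_
    obtain ⟨k, l⟩ := s
    simp [hb k l r, Finsupp.mapDomain_single]
  exact LinearMap.congr_fun this f

/-- Appending `r` is injective on monomials and preserves their order, so the top term cannot
cancel. -/
theorem IsMonomialBasis.isLead_smul (hb : IsMonomialBasis b) {f : M} {k : Fin m}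
    {l : List (Fin n)} (h : IsLead b monoOrd f (k, l)) (r : List (Fin n)) :
    IsLead b monoOrd (op (FreeAlgebra.word K r) • f) (k, l ++ r) := by
  have hinj : Function.Injective
      (fun s : Fin m × List (Fin n) => (s.1, s.2 ++ r)) := by
    rintro ⟨k, l⟩ ⟨k', l'⟩ h
    simpa using h
  rw [IsLead, hb.repr_smul]
  constructor
  · have := Finsupp.mapDomain_apply hinj (b.repr f) (k, l)
    simp only at this
    rw [this]
    exact h.1
  · intro t ht
    by_cases h' : t ∈ Set.range (fun s : Fin m × List (Fin n) => (s.1, s.2 ++ r))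
    · obtain ⟨⟨k', l'⟩, rfl⟩ := h'
      rw [Finsupp.mapDomain_apply hinj]
      exact h.2 _ ((monoOrd_append_lt_iff r).1 ht)
    · exact Finsupp.mapDomain_of_notMem_range _ _ h'

/-- The leading monomials of a submodule. -/
def leadMono (b : Basis (Fin m × List (Fin n)) K M)
    (U : Submodule (FreeAlgebra K (Fin n))ᵐᵒᵖ M) : Set (Fin m × List (Fin n)) :=
  leadSet b monoOrd (U.restrictScalars K)

/-- The leading monomials of a submodule that are minimal for right divisibility. -/
def minLeadMono (b : Basis (Fin m × List (Fin n)) K M)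
    (U : Submodule (FreeAlgebra K (Fin n))ᵐᵒᵖ M) : Set (Fin m × List (Fin n)) :=
  {s | s ∈ leadMono b U ∧ ∀ l x, s.2 = l ++ [x] → (s.1, l) ∉ leadMono b U}

variable {U : Submodule (FreeAlgebra K (Fin n))ᵐᵒᵖ M}

theorem IsMonomialBasis.append_mem_leadMono (hb : IsMonomialBasis b) {k : Fin m}
    {l : List (Fin n)} (h : (k, l) ∈ leadMono b U) (r : List (Fin n)) :
    (k, l ++ r) ∈ leadMono b U := by
  obtain ⟨f, hf, hl⟩ := h
  exact ⟨_, U.smul_mem _ hf, hb.isLead_smul hl r⟩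

/-- Letters are removed from the right end until the shorter monomial no longer leads. -/
theorem exists_minLeadMono {k : Fin m} {l : List (Fin n)} (h : (k, l) ∈ leadMono b U) :
    ∃ l' r, (k, l') ∈ minLeadMono b U ∧ l = l' ++ r := by
  induction l using List.reverseRecOn with
  | nil => exact ⟨[], [], ⟨h, fun l x hl => by simp at hl⟩, rfl⟩
  | append_singleton l x ih =>
    by_cases h' : (k, l) ∈ leadMono b U
    · obtain ⟨l', r, hl', rfl⟩ := ih h'
      exact ⟨l', r ++ [x], hl', by simp⟩
    · refine ⟨l ++ [x], [], ⟨h, fun l' y hl => ?_⟩, by simp⟩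
      simp only at hl
      obtain ⟨rfl, -⟩ := List.append_inj' hl rfl
      exact h'

/-- The minimal leading monomials form a prefix code: if one were a proper prefix of another, the
latter without its last letter would already lead. -/
theorem IsMonomialBasis.eq_of_append (hb : IsMonomialBasis b) {k : Fin m}
    {l l' r r' : List (Fin n)} (h : (k, l) ∈ minLeadMono b U) (h' : (k, l') ∈ minLeadMono b U)
    (he : l ++ r = l' ++ r') : l = l' ∧ r = r' := by
  rcases List.append_eq_append_iff.1 he with ⟨a, rfl, rfl⟩ | ⟨a, rfl, rfl⟩
  · rcases List.eq_nil_or_concat' a with rfl | ⟨a, y, rfl⟩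
    · simp
    · exact absurd (hb.append_mem_leadMono h.1 a) (h'.2 _ y (by simp))
  · rcases List.eq_nil_or_concat' a with rfl | ⟨a, y, rfl⟩
    · simp
    · exact absurd (hb.append_mem_leadMono h'.1 a) (h.2 _ y (by simp))

/-- Every submodule is free, on elements whose leading monomials are the minimal ones. -/
theorem IsMonomialBasis.nonempty_basis (hb : IsMonomialBasis b)
    (U : Submodule (FreeAlgebra K (Fin n))ᵐᵒᵖ M) :
    Nonempty (Basis (minLeadMono b U) (FreeAlgebra K (Fin n))ᵐᵒᵖ U) := by
  have hex : ∀ p : minLeadMono b U, ∃ f ∈ U, IsLead b monoOrd f p.1 := fun p => p.2.1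
  choose f hfU hf using hex
  have hlead : ∀ x : minLeadMono b U × List (Fin n),
      IsLead b monoOrd (op (FreeAlgebra.word K x.2) • f x.1) (x.1.1.1, x.1.1.2 ++ x.2) :=
    fun x => hb.isLead_smul (hf x.1) x.2
  have hli : LinearIndependent (FreeAlgebra K (Fin n))ᵐᵒᵖ f := by
    -- It suffices to multiply by words and work over `K`; the products have distinct leading
    -- monomials by the prefix code property.
    refine LinearIndependent.of_basis_smul
      ((FreeAlgebra.wordBasis K n).map (opLinearEquiv K)) ?_
    have : LinearIndependent K
        fun x : minLeadMono b U × List (Fin n) => op (FreeAlgebra.word K x.2) • f x.1 := by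
      refine linearIndependent_of_isLead monoOrd_injective ?_ hlead
      rintro ⟨⟨⟨k, l⟩, hp⟩, r⟩ ⟨⟨⟨k', l'⟩, hp'⟩, r'⟩ h
      simp only [Prod.mk.injEq] at h
      obtain ⟨rfl, h⟩ := h
      obtain ⟨rfl, rfl⟩ := hb.eq_of_append hp hp' h
      rfl
    simpa [FreeAlgebra.wordBasis_apply] using this
  have hspan : Submodule.span (FreeAlgebra K (Fin n))ᵐᵒᵖ (Set.range f) = U := by
    refine le_antisymm (Submodule.span_le.2 (by rintro _ ⟨p, rfl⟩; exact hfU p)) ?_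
    have : U.restrictScalars K ≤
        (Submodule.span (FreeAlgebra K (Fin n))ᵐᵒᵖ (Set.range f)).restrictScalars K := by
      refine le_of_isLead (b := b) monoOrd_injective ?_
      rintro ⟨k, l⟩ hs
      obtain ⟨l', r, hp, rfl⟩ := exists_minLeadMono (U := U) hs
      exact ⟨_, U.smul_mem _ (hfU ⟨_, hp⟩),
        Submodule.smul_mem _ _ (Submodule.subset_span (Set.mem_range_self _)),
        hlead (⟨_, hp⟩, r)⟩
    exact this
  exact ⟨(Basis.span hli).map (LinearEquiv.ofEq _ _ hspan)⟩

/-- The counting argument behind the Schreier–Lewin formula. -/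
theorem IsMonomialBasis.range_eq (hb : IsMonomialBasis b)
    (U : Submodule (FreeAlgebra K (Fin n))ᵐᵒᵖ M) :
    Set.range (Sum.elim (fun x : ↥(leadMono b U)ᶜ × Fin n => (x.1.1.1, x.1.1.2 ++ [x.2]))
      (fun k : Fin m => (k, []))) = (leadMono b U)ᶜ ∪ minLeadMono b U := by
  ext ⟨k, l⟩
  rw [Set.Sum.elim_range]
  constructor
  · rintro (⟨⟨⟨⟨k', l'⟩, hs⟩, x⟩, h⟩ | ⟨k', h⟩)
    · simp only [Prod.mk.injEq] at h
      obtain ⟨rfl, rfl⟩ := h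
      by_cases hl : (k', l' ++ [x]) ∈ leadMono b U
      · refine Or.inr ⟨hl, fun l y hly => ?_⟩
        simp only at hly
        obtain ⟨rfl, -⟩ := List.append_inj' hly rfl
        exact hs
      · exact Or.inl hl
    · simp only [Prod.mk.injEq] at h
      obtain ⟨rfl, rfl⟩ := h
      by_cases hl : (k', []) ∈ leadMono b U
      · exact Or.inr ⟨hl, fun l y hly => by simp at hly⟩
      · exact Or.inl hl
  · intro h
    rcases List.eq_nil_or_concat' l with rfl | ⟨l, x, rfl⟩
    · exact Or.inr ⟨k, rfl⟩
    · refine Or.inl ⟨(⟨(k, l), ?_⟩, x), rfl⟩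
      rcases h with h | h
      · exact fun h' => h (hb.append_mem_leadMono h' [x])
      · exact h.2 l x rfl

theorem IsMonomialBasis.finite_minLeadMono (hb : IsMonomialBasis b)
    (hU : (leadMono b U)ᶜ.Finite) : (minLeadMono b U).Finite := by
  have := hU.to_subtype
  have := Set.finite_range
    (Sum.elim (fun x : ↥(leadMono b U)ᶜ × Fin n => (x.1.1.1, x.1.1.2 ++ [x.2]))
      (fun k : Fin m => (k, [])))
  rw [hb.range_eq] at this
  exact this.subset Set.subset_union_right

/-- The Schreier–Lewin formula. -/
theorem IsMonomialBasis.ncard_add_ncard (hb : IsMonomialBasis b)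
    (hU : (leadMono b U)ᶜ.Finite) :
    (minLeadMono b U).ncard + (leadMono b U)ᶜ.ncard = (leadMono b U)ᶜ.ncard * n + m := by
  have := hU.to_subtype
  -- A monomial determines its last letter, so the map of `range_eq` counts without repetition: its
  -- source has `d * n + m` elements, its image consists of the `d` non-leading and the minimal
  -- leading monomials.
  have hinj : Function.Injective
      (Sum.elim (fun x : ↥(leadMono b U)ᶜ × Fin n => (x.1.1.1, x.1.1.2 ++ [x.2]))
        (fun k : Fin m => (k, []))) := by
    rintro (⟨⟨⟨k, l⟩, hs⟩, x⟩ | k) (⟨⟨⟨k', l'⟩, hs'⟩, x'⟩ | k') h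
    · simp only [Sum.elim_inl, Prod.mk.injEq] at h
      obtain ⟨rfl, h⟩ := h
      obtain ⟨rfl, h⟩ := List.append_inj' h rfl
      obtain rfl : x = x' := by simpa using h
      rfl
    · simp at h
    · simp at h
    · simp only [Sum.elim_inr, Prod.mk.injEq, and_true] at h
      rw [h]
  have h1 := Set.ncard_range_of_injective hinj
  rw [hb.range_eq, Set.ncard_union_eq (by
    rw [Set.disjoint_left]; exact fun s hs hs' => hs hs'.1) hU (hb.finite_minLeadMono hU)] at h1
  rw [add_comm, h1, Nat.card_sum, Nat.card_prod, Nat.card_coe_set_eq]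
  simp

end RightSubmodules

/-- Mutually inverse rectangular matrices over `R` map to such matrices over `S`. For the free
algebra, `f` will be the augmentation onto `K`. -/
theorem RingHom.invariantBasisNumber {R S : Type*} [Ring R] [Ring S] [InvariantBasisNumber S]
    (f : R →+* S) : InvariantBasisNumber R := by
  have hS := (invariantBasisNumber_iff_matrix (R := S)).1 inferInstance
  refine invariantBasisNumber_iff_matrix.2 fun n m g h h1 h2 => ?_
  refine hS n m (g.map f) (h.map f) ?_ ?_
  · rw [← Matrix.map_mul, h1, Matrix.map_one _ f.map_zero f.map_one]
  · rw [← Matrix.map_mul, h2, Matrix.map_one _ f.map_zero f.map_one]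

/-! ### Colon ideals, cores and Gabriel topologies -/

section Colon

variable {A : Type u} [Ring A]

/-- The right ideal `(R : a) = {x | a x ∈ R}`. -/
def rightColon (R : Submodule Aᵐᵒᵖ A) (a : A) : Submodule Aᵐᵒᵖ A :=
  R.comap (Module.toModuleEnd Aᵐᵒᵖ A a)

theorem mem_rightColon {R : Submodule Aᵐᵒᵖ A} {a x : A} :
    x ∈ rightColon R a ↔ a * x ∈ R := Iff.rfl

theorem eq_rightColon {R C : Submodule Aᵐᵒᵖ A} {a : A} (h : ∀ x, x ∈ C ↔ a * x ∈ R) :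
    C = rightColon R a :=
  Submodule.ext h

theorem Submodule.mul_mem_of_mem {R : Submodule Aᵐᵒᵖ A} {x : A} (hx : x ∈ R) (a : A) :
    x * a ∈ R :=
  R.smul_mem (op a) hx

/-- The largest two-sided ideal contained in a right ideal. -/
def rightCore (R : Submodule Aᵐᵒᵖ A) : TwoSidedIdeal A :=
  TwoSidedIdeal.mk' {x | ∀ a, a * x ∈ R} (fun a => by simp)
    (fun hx hy a => by rw [mul_add]; exact R.add_mem (hx a) (hy a))
    (fun hx a => by rw [mul_neg]; exact R.neg_mem (hx a))
    (fun hx a => by rw [← mul_assoc]; exact hx _)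
    (fun hx a => by rw [← mul_assoc]; exact R.mul_mem_of_mem (hx a) _)

theorem mem_rightCore {R : Submodule Aᵐᵒᵖ A} {x : A} :
    x ∈ rightCore R ↔ ∀ a, a * x ∈ R := by
  simp [rightCore]

theorem rightCore_le (R : Submodule Aᵐᵒᵖ A) : (rightCore R).toRightIdeal ≤ R := by
  intro x hx
  simpa using mem_rightCore.1 hx 1

/-- Closure under intersections follows from transitivity: for `s ∈ S`, the right ideal `(R ⊓ S :
s)` contains `(R : s)`. -/
theorem IsGabrielTopology.of_rightColon {T : Set (Submodule Aᵐᵒᵖ A)} (top_mem : ⊤ ∈ T)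
    (mem_of_le : ∀ R ∈ T, ∀ S, R ≤ S → S ∈ T)
    (colon_mem : ∀ R ∈ T, ∀ a, rightColon R a ∈ T)
    (mem_of_colon : ∀ R, ∀ S ∈ T, (∀ s ∈ S, rightColon R s ∈ T) → R ∈ T) :
    IsGabrielTopology T where
  top_mem := top_mem
  mem_of_le := mem_of_le
  inf_mem R hR S hS := mem_of_colon _ S hS fun s hs =>
    mem_of_le _ (colon_mem R hR s) _ fun x hx => ⟨hx, S.mul_mem_of_mem hs x⟩
  colon_mem R hR a _ hC := eq_rightColon hC ▸ colon_mem R hR a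
  mem_of_colon R S hS h := mem_of_colon R S hS fun s hs => h s hs _ fun _ => Iff.rfl

namespace IsGabrielTopology

variable {T : Set (Submodule Aᵐᵒᵖ A)} (hT : IsGabrielTopology T)

include hT

theorem rightColon_mem {R : Submodule Aᵐᵒᵖ A} (hR : R ∈ T) (a : A) : rightColon R a ∈ T :=
  hT.colon_mem R hR a _ fun _ => Iff.rfl

theorem mem_of_rightColon {R S : Submodule Aᵐᵒᵖ A} (hS : S ∈ T)
    (h : ∀ s ∈ S, rightColon R s ∈ T) : R ∈ T :=
  hT.mem_of_colon R S hS fun s hs _ hC => eq_rightColon hC ▸ h s hs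

theorem finset_inf_mem {ι : Type*} (s : Finset ι) {f : ι → Submodule Aᵐᵒᵖ A}
    (h : ∀ i ∈ s, f i ∈ T) : s.inf f ∈ T := by
  classical
  induction s using Finset.induction_on with
  | empty => exact hT.top_mem
  | insert i s _ ih =>
    rw [Finset.inf_insert]
    exact hT.inf_mem _ (h i (by simp)) _ (ih fun j hj => h j (by simp [hj]))

theorem iInf_mem {ι : Type*} [Finite ι] {f : ι → Submodule Aᵐᵒᵖ A}
    (h : ∀ i, f i ∈ T) : ⨅ i, f i ∈ T := by
  have := Fintype.ofFinite ι
  rw [← Finset.inf_univ_eq_iInf]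
  exact hT.finset_inf_mem _ fun i _ => h i

end IsGabrielTopology

end Colon

/-! ### Right ideals of finite codimension -/

section FiniteCodim

variable {K : Type u} [Field K]

theorem Submodule.CoFG.exists_fg_sup_eq_top {M : Type*} [AddCommGroup M] [Module K M]
    {U : Submodule K M} (hU : U.CoFG) : ∃ s : Finset M, Submodule.span K (s : Set M) ⊔ U = ⊤ := by
  obtain ⟨V, hV⟩ := U.exists_isCompl
  obtain ⟨s, rfl⟩ := hU.fg_of_isCompl hV
  exact ⟨s, hV.symm.sup_eq_top⟩

theorem Submodule.FG.cofg_of_sup_eq_top {M : Type*} [AddCommGroup M] [Module K M]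
    {U V : Submodule K M} (hV : V.FG) (h : V ⊔ U = ⊤) : U.CoFG := by
  have : V.map U.mkQ = ⊤ := by
    rw [← U.range_mkQ, ← Submodule.map_top, ← h, Submodule.map_sup]
    simp
  exact ⟨this ▸ hV.map _⟩

variable {A : Type u} [Ring A] [Algebra K A]

theorem FiniteCodim.of_le {R S : Submodule Aᵐᵒᵖ A} (hR : FiniteCodim K R) (h : R ≤ S) :
    FiniteCodim K S :=
  Submodule.CoFG.of_le (S := R.restrictScalars K) (T := S.restrictScalars K) h hR

theorem FiniteCodim.top : FiniteCodim K (⊤ : Submodule Aᵐᵒᵖ A) := by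
  have h : Submodule.CoFG ((⊤ : Submodule Aᵐᵒᵖ A).restrictScalars K) := by
    rw [Submodule.restrictScalars_top]
    exact Submodule.CoFG.top
  exact h

theorem FiniteCodim.rightColon {R : Submodule Aᵐᵒᵖ A} (hR : FiniteCodim K R) (a : A) :
    FiniteCodim K (rightColon R a) := by
  have : Module.Finite K (A ⧸ R.restrictScalars K) := hR
  have h := Submodule.CoFG.ker ((R.restrictScalars K).mkQ ∘ₗ LinearMap.mulLeft K a)
  rw [LinearMap.ker_comp, Submodule.ker_mkQ] at h
  exact h

/-- An open right ideal of finite codimension contains an open two-sided ideal. -/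
theorem IsGabrielTopology.rightCore_mem {T : Set (Submodule Aᵐᵒᵖ A)} (hT : IsGabrielTopology T)
    {R : Submodule Aᵐᵒᵖ A} (hR : R ∈ T) (hfc : FiniteCodim K R) :
    (rightCore R).toRightIdeal ∈ T := by
  -- As `R` is a right ideal, the condition `a * x ∈ R` depends only on `a` modulo `R`, so finitely
  -- many `a` suffice to test membership in the core.
  obtain ⟨s, hs⟩ := Submodule.CoFG.exists_fg_sup_eq_top (U := R.restrictScalars K) hfc
  refine hT.mem_of_le _ (hT.inf_mem R hR _
    (hT.finset_inf_mem s fun a _ => hT.rightColon_mem hR a)) _ ?_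
  intro x hx
  rw [Submodule.mem_inf, Submodule.mem_finsetInf] at hx
  refine mem_rightCore.2 fun a => ?_
  obtain ⟨v, hv, r, hr, rfl⟩ := Submodule.mem_sup.1 (hs ▸ Submodule.mem_top : a ∈ _)
  rw [add_mul]
  refine R.add_mem ?_ (R.mul_mem_of_mem hr x)
  have : Submodule.span K (s : Set A) ≤
      (R.restrictScalars K).comap (LinearMap.mulRight K x) :=
    Submodule.span_le.2 fun a ha => hx.2 a ha
  exact this hv

/-- Let `A = V + S` with `V` finite-dimensional and `S` the finite sum of the `s A`. If `A = W_s +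
(R : s)` then `s A ⊆ s W_s + R`, so `A` is `R` plus a finite-dimensional space. Finite generation of
`S` keeps the sum finite. -/
theorem isGabrielTopology_finiteCodim
    (hfg : ∀ R : Submodule Aᵐᵒᵖ A, FiniteCodim K R → R.FG) :
    IsGabrielTopology {R : Submodule Aᵐᵒᵖ A | FiniteCodim K R} := by
  classical
  refine .of_rightColon FiniteCodim.top (fun R hR S h => hR.of_le h)
    (fun R hR a => hR.rightColon a) fun R S hS h => ?_
  obtain ⟨V, hV⟩ := Submodule.CoFG.exists_fg_sup_eq_top (U := S.restrictScalars K) hS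
  obtain ⟨t, ht⟩ := hfg S hS
  have hex : ∀ s : t, ∃ W : Finset A,
      Submodule.span K (W : Set A) ⊔ (rightColon R (s : A)).restrictScalars K = ⊤ :=
    fun s => Submodule.CoFG.exists_fg_sup_eq_top
      (h s (by rw [← ht]; exact Submodule.subset_span s.2))
  choose W hW using hex
  let V' : Submodule K A := Submodule.span K (V : Set A) ⊔
    ⨆ s : t, (Submodule.span K (W s : Set A)).map (LinearMap.mulLeft K (s : A))
  have hV' : V'.FG := Submodule.FG.sup ⟨V, rfl⟩
    (Submodule.fg_iSup _ fun s => Submodule.FG.map _ ⟨W s, rfl⟩)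
  refine Submodule.FG.cofg_of_sup_eq_top (U := R.restrictScalars K) hV' ?_
  have hS' : S.restrictScalars K ≤ V' ⊔ R.restrictScalars K := by
    intro x hx
    have hx' : x ∈ Submodule.span Aᵐᵒᵖ (t : Set A) := ht ▸ hx
    clear hx
    induction hx' using Submodule.closure_induction with
    | zero => exact zero_mem _
    | add x y _ _ h1 h2 => exact add_mem h1 h2
    | smul_mem a x hx =>
      obtain ⟨v, hv, r, hr, hvr⟩ := Submodule.mem_sup.1 (hW ⟨x, hx⟩ ▸ Submodule.mem_top :
        a.unop ∈ _)
      have : a • x = x * v + x * r := by rw [← mul_add, hvr]; rfl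
      rw [this]
      refine add_mem (Submodule.mem_sup_left (Submodule.mem_sup_right ?_))
        (Submodule.mem_sup_right hr)
      exact Submodule.mem_iSup_of_mem ⟨x, hx⟩ ⟨v, hv, rfl⟩
  rw [eq_top_iff, ← hV]
  exact sup_le (le_sup_left.trans le_sup_left) hS'

end FiniteCodim

/-! ### Right ideals of the free algebra -/

section FreeAlgebra

variable {K : Type u} [Field K] {n : ℕ}

instance : InvariantBasisNumber (FreeAlgebra K (Fin n)) :=
  (FreeAlgebra.algebraMapInv (R := K) (X := Fin n)).toRingHom.invariantBasisNumber

namespace FreeAlgebra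

theorem repr_mul_word (f : FreeAlgebra K (Fin n)) (r : List (Fin n)) :
    (wordBasis K n).repr (f * word K r) = ((wordBasis K n).repr f).mapDomain (· ++ r) := by
  have : (wordBasis K n).repr.toLinearMap ∘ₗ LinearMap.mulRight K (word K r) =
      Finsupp.lmapDomain K K (· ++ r) ∘ₗ (wordBasis K n).repr.toLinearMap := by
    refine (wordBasis K n).ext fun l => ?_
    simp only [LinearMap.comp_apply, LinearMap.mulRight_apply, LinearEquiv.coe_coe,
      Basis.repr_self, Finsupp.lmapDomain_apply, Finsupp.mapDomain_single]
    rw [wordBasis_apply, ← word_append, ← wordBasis_apply, Basis.repr_self]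
  exact LinearMap.congr_fun this f

theorem repr_word_mul (f : FreeAlgebra K (Fin n)) (r : List (Fin n)) :
    (wordBasis K n).repr (word K r * f) = ((wordBasis K n).repr f).mapDomain (r ++ ·) := by
  have : (wordBasis K n).repr.toLinearMap ∘ₗ LinearMap.mulLeft K (word K r) =
      Finsupp.lmapDomain K K (r ++ ·) ∘ₗ (wordBasis K n).repr.toLinearMap := by
    refine (wordBasis K n).ext fun l => ?_
    simp only [LinearMap.comp_apply, LinearMap.mulLeft_apply, LinearEquiv.coe_coe,
      Basis.repr_self, Finsupp.lmapDomain_apply, Finsupp.mapDomain_single]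
    rw [wordBasis_apply, ← word_append, ← wordBasis_apply, Basis.repr_self]
  exact LinearMap.congr_fun this f

theorem word_ne_zero (l : List (Fin n)) : word K l ≠ 0 := by
  rw [← wordBasis_apply]
  exact (wordBasis K n).ne_zero l

/-- The monomial basis of the free algebra as a module of rank one over itself. -/
noncomputable def regularBasis (K : Type u) [Field K] (n : ℕ) :
    Basis (Fin 1 × List (Fin n)) K (FreeAlgebra K (Fin n)) :=
  (wordBasis K n).reindex (Equiv.uniqueProd (List (Fin n)) (Fin 1)).symm

theorem isMonomialBasis_regularBasis : IsMonomialBasis (regularBasis K n) := by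
  intro k l r
  simp [regularBasis, wordBasis_apply, word_append]

/-- The monomial basis of the free module of rank `m`. -/
noncomputable def piBasis (K : Type u) [Field K] (n m : ℕ) :
    Basis (Fin m × List (Fin n)) K (Fin m → FreeAlgebra K (Fin n)) :=
  (Pi.basis fun _ : Fin m => wordBasis K n).reindex (Equiv.sigmaEquivProd _ _)

theorem isMonomialBasis_piBasis (m : ℕ) : IsMonomialBasis (piBasis K n m) := by
  intro k l r
  simp only [piBasis, Basis.reindex_apply, Equiv.sigmaEquivProd_symm_apply, Pi.basis_apply,
    wordBasis_apply, word_append]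
  ext j
  rcases eq_or_ne j k with rfl | h
  · simp
  · simp [h]

/-- Every right ideal of a free algebra over a field is free. -/
theorem exists_basis_rightIdeal
    (R : Submodule (FreeAlgebra K (Fin n))ᵐᵒᵖ (FreeAlgebra K (Fin n))) :
    ∃ P : Type, Nonempty (Basis P (FreeAlgebra K (Fin n))ᵐᵒᵖ R) :=
  ⟨_, isMonomialBasis_regularBasis.nonempty_basis R⟩

/-- A right ideal of finite codimension has a finite basis. -/
theorem exists_basis_of_finiteCodim
    {R : Submodule (FreeAlgebra K (Fin n))ᵐᵒᵖ (FreeAlgebra K (Fin n))} (hR : FiniteCodim K R) :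
    ∃ P : Type, Finite P ∧ Nonempty (Basis P (FreeAlgebra K (Fin n))ᵐᵒᵖ R) :=
  ⟨_, (isMonomialBasis_regularBasis.finite_minLeadMono
    (finite_compl_leadSet monoOrd_injective hR)).to_subtype,
    isMonomialBasis_regularBasis.nonempty_basis R⟩

theorem fg_of_finiteCodim
    {R : Submodule (FreeAlgebra K (Fin n))ᵐᵒᵖ (FreeAlgebra K (Fin n))} (hR : FiniteCodim K R) :
    R.FG := by
  obtain ⟨P, _, ⟨e⟩⟩ := exists_basis_of_finiteCodim hR
  rw [← Module.Finite.iff_fg]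
  exact Module.Finite.of_basis e

/-- The Schreier–Lewin formula for submodules of finite codimension of a free module. -/
theorem exists_basis_fin {m : ℕ}
    {U : Submodule (FreeAlgebra K (Fin n))ᵐᵒᵖ (Fin m → FreeAlgebra K (Fin n))}
    (hU : (U.restrictScalars K).CoFG) :
    ∃ r d : ℕ, r + d = d * n + m ∧ Nonempty (Basis (Fin r) (FreeAlgebra K (Fin n))ᵐᵒᵖ U) := by
  have hb := isMonomialBasis_piBasis (K := K) (n := n) m
  have hN := finite_compl_leadSet (b := piBasis K n m) monoOrd_injective hU
  have hP := hb.finite_minLeadMono (U := U) hN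
  obtain ⟨e⟩ := hb.nonempty_basis U
  have := hP.to_subtype
  exact ⟨_, _, hb.ncard_add_ncard hN, ⟨e.reindex (Finite.equivFin _)⟩⟩

/-- A finitely generated right ideal of infinite codimension meets some non-zero principal right
ideal trivially. -/
theorem exists_rightColon_eq_bot
    {R : Submodule (FreeAlgebra K (Fin n))ᵐᵒᵖ (FreeAlgebra K (Fin n))} (hR : R.FG)
    (hfc : ¬ FiniteCodim K R) : ∃ s, rightColon R s = ⊥ := by
  have hb := isMonomialBasis_regularBasis (K := K) (n := n)
  obtain ⟨e⟩ := hb.nonempty_basis R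
  have := Module.Finite.iff_fg.2 hR
  have hP : (minLeadMono (regularBasis K n) R).Finite :=
    @Set.toFinite _ _ (Module.Finite.finite_basis e)
  obtain ⟨L, hL⟩ := (hP.image fun s => s.2.length).bddAbove
  have hN : ¬ (leadMono (regularBasis K n) R)ᶜ.Finite :=
    fun h => hfc (cofg_of_finite_compl_leadSet monoOrd_injective h)
  -- Infinitely many monomials are non-leading, but only finitely many have length at most `L`, a
  -- bound for the lengths of the minimal leading ones.
  have hlong : ∃ s ∈ (leadMono (regularBasis K n) R)ᶜ, L < s.2.length := by
    by_contra! h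
    refine hN (((Set.toFinite Set.univ).prod (List.finite_length_le (Fin n) L)).subset ?_)
    exact fun s hs => ⟨trivial, h s hs⟩
  obtain ⟨⟨k, l⟩, hl, hlL⟩ := hlong
  refine ⟨word K l, (Submodule.eq_bot_iff _).2 fun x hx => ?_⟩
  by_contra h0
  obtain ⟨⟨k', l'⟩, hs⟩ := exists_isLead (b := regularBasis K n) (ord := monoOrd)
    (mul_ne_zero (word_ne_zero l) h0)
  obtain rfl := Subsingleton.elim k k'
  -- Every monomial of `word K l * x` starts with `l`.
  have hl' : l' ∈ Set.range (l ++ ·) := by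
    by_contra h
    refine hs.1 ?_
    have := Finsupp.mapDomain_of_notMem_range ((wordBasis K n).repr x) _ h
    rw [← repr_word_mul] at this
    simpa [regularBasis] using this
  obtain ⟨u, rfl⟩ := hl'
  obtain ⟨p, r, hp, hpr⟩ := exists_minLeadMono (U := R) ⟨_, hx, hs⟩
  have hpl : p.length ≤ L := hL ⟨_, hp, rfl⟩
  -- Both `p` and `l` are prefixes of one word and `p` is shorter, so `p` is a prefix of `l` and `l`
  -- would lead.
  rcases List.append_eq_append_iff.1 hpr with ⟨a, rfl, -⟩ | ⟨a, rfl, -⟩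
  · simp at hpl hlL
    omega
  · exact hl (hb.append_mem_leadMono hp.1 a)

/-- The elements all of whose monomials have length greater than `d`. -/
noncomputable def longWords (K : Type u) [Field K] (n d : ℕ) :
    Submodule (FreeAlgebra K (Fin n))ᵐᵒᵖ (FreeAlgebra K (Fin n)) where
  carrier := {f | ∀ l : List (Fin n), l.length ≤ d → (wordBasis K n).repr f l = 0}
  add_mem' hf hg l hl := by simp [hf l hl, hg l hl]
  zero_mem' l _ := by simp
  smul_mem' a f hf := by
    obtain ⟨a, rfl⟩ := op_surjective a
    simp only [op_smul_eq_mul, Set.mem_ofPred_eq] at hf ⊢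
    induction a using FreeAlgebra.induction generalizing f with
    | grade0 c =>
      intro l hl
      rw [← Algebra.commutes, ← Algebra.smul_def]
      simp [hf l hl]
    | grade1 x =>
      intro l hl
      have : ι K x = word K [x] := by simp [word]
      rw [this, repr_mul_word]
      by_cases h : l ∈ Set.range (· ++ [x])
      · obtain ⟨l, rfl⟩ := h
        rw [Finsupp.mapDomain_apply (List.append_left_injective [x])]
        exact hf l (by simp at hl; omega)
      · exact Finsupp.mapDomain_of_notMem_range _ _ h
    | mul a b ha hb =>
      rw [← mul_assoc]
      exact hb _ (ha _ hf)
    | add a b ha hb =>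
      intro l hl
      rw [mul_add]
      simp [ha _ hf l hl, hb _ hf l hl]

theorem finiteCodim_longWords (d : ℕ) : FiniteCodim K (longWords K n d) := by
  have : Finite {l : List (Fin n) | l.length ≤ d} := (List.finite_length_le (Fin n) d).to_subtype
  have h := Submodule.CoFG.ker (LinearMap.pi fun l : {l : List (Fin n) | l.length ≤ d} =>
    (wordBasis K n).coord l)
  have h2 : LinearMap.ker (LinearMap.pi fun l : {l : List (Fin n) | l.length ≤ d} =>
      (wordBasis K n).coord l) = (longWords K n d).restrictScalars K := by
    ext f
    simp [longWords, LinearMap.mem_ker, funext_iff]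
  rw [h2] at h
  exact h

theorem exists_finiteCodim_notMem {f : FreeAlgebra K (Fin n)} (hf : f ≠ 0) :
    ∃ R : Submodule (FreeAlgebra K (Fin n))ᵐᵒᵖ (FreeAlgebra K (Fin n)),
      FiniteCodim K R ∧ f ∉ R := by
  have hne : (wordBasis K n).repr f ≠ 0 := by simpa using hf
  obtain ⟨l, hl⟩ := Finsupp.ne_iff.1 hne
  exact ⟨_, finiteCodim_longWords l.length, fun h => hl (by simpa using h l le_rfl)⟩

/-- The right ideals of finite codimension form a Gabriel topology. -/
theorem isGabrielTopology_fc : IsGabrielTopology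
    {R : Submodule (FreeAlgebra K (Fin n))ᵐᵒᵖ (FreeAlgebra K (Fin n)) | FiniteCodim K R} :=
  isGabrielTopology_finiteCodim fun _ => fg_of_finiteCodim

theorem not_finiteCodim_bot (hn : 1 ≤ n) :
    ¬ FiniteCodim K (⊥ : Submodule (FreeAlgebra K (Fin n))ᵐᵒᵖ (FreeAlgebra K (Fin n))) := by
  intro h
  have h' : Submodule.CoFG (⊥ : Submodule K (FreeAlgebra K (Fin n))) := by
    rw [← Submodule.restrictScalars_bot K (FreeAlgebra K (Fin n))ᵐᵒᵖ]
    exact h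
  have := (Module.Finite.iff_cofg_bot _ _).1 h'
  have : Nonempty (Fin n) := ⟨⟨0, hn⟩⟩
  exact Infinite.not_finite (Module.Finite.finite_basis (wordBasis K n))

end FreeAlgebra

end FreeAlgebra

/-! ### The fc-topology is Hausdorff with a basis of two-sided ideals -/

section Topology

variable {K : Type u} [Field K] {A : Type u} [Ring A] [Algebra K A]

theorem t2Space_fcTopology (h : ∀ a : A, a ≠ 0 → ∃ R : Submodule Aᵐᵒᵖ A, FiniteCodim K R ∧ a ∉ R) :
    @T2Space A (fcTopology K A) := by
  let _ := fcTopology K A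
  have hopen : ∀ (x : A) (R : Submodule Aᵐᵒᵖ A), FiniteCodim K R → IsOpen {z | z - x ∈ R} := by
    intro x R hR z hz
    refine ⟨R, hR, fun r hr => ?_⟩
    have : z + r - x = (z - x) + r := by abel
    simp only [Set.mem_ofPred_eq, this]
    exact R.add_mem hz hr
  refine ⟨fun x y hxy => ?_⟩
  obtain ⟨R, hR, hxyR⟩ := h (x - y) (sub_ne_zero.2 hxy)
  refine ⟨_, _, hopen x R hR, hopen y R hR, by simp, by simp, ?_⟩
  rw [Set.disjoint_left]
  intro z hzx hzy
  refine hxyR ?_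
  have : x - y = (z - y) - (z - x) := by abel
  rw [this]
  exact R.sub_mem hzy hzx

theorem nhds_zero_fcTopology_hasBasis
    (hT : IsGabrielTopology {R : Submodule Aᵐᵒᵖ A | FiniteCodim K R}) :
    (@nhds A (fcTopology K A) 0).HasBasis
      (fun I : TwoSidedIdeal A => FiniteCodim K I.toRightIdeal) (fun I => (I : Set A)) := by
  let _ := fcTopology K A
  refine ⟨fun t => ?_⟩
  rw [mem_nhds_iff]
  constructor
  · rintro ⟨U, hUt, hU, h0⟩
    obtain ⟨R, hR, hRU⟩ := hU 0 h0
    refine ⟨rightCore R, hT.rightCore_mem hR hR, fun x hx => hUt ?_⟩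
    simpa using hRU x (rightCore_le R hx)
  · rintro ⟨I, hI, hIt⟩
    exact ⟨I, hIt, fun x hx => ⟨_, hI, fun r hr => I.add_mem hx hr⟩, I.zero_mem⟩

end Topology

/-- A ring homomorphism followed by conjugation by an invertible element. -/
def RingHom.conjugate {R S : Type*} [Ring R] [Ring S] (f : R →+* S) {x y : S}
    (hxy : x * y = 1) (hyx : y * x = 1) : R →+* S where
  toFun r := x * f r * y
  map_one' := by rw [f.map_one, mul_one, hxy]
  map_mul' r r' := by
    rw [f.map_mul, mul_assoc (x * f r), ← mul_assoc y, ← mul_assoc y, hyx, one_mul,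
      ← mul_assoc, ← mul_assoc, mul_assoc _ _ y]
  map_zero' := by rw [f.map_zero, mul_zero, zero_mul]
  map_add' r r' := by rw [f.map_add, mul_add, add_mul]

/-! ### Calculus of the balanced tensor product -/

section BalancedTensor

variable {A : Type u} [Ring A] {M : Type v} [AddCommGroup M] [Module Aᵐᵒᵖ M]
  {N : Type w} [AddCommGroup N] [Module A N]

/-- The class of `m ⊗ n` in `M ⊗_A N`. -/
def BalancedTensor.tmul (A : Type u) [Ring A] {M : Type v} [AddCommGroup M] [Module Aᵐᵒᵖ M]
    {N : Type w} [AddCommGroup N] [Module A N] (m : M) (n : N) : BalancedTensor A M N :=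
  QuotientAddGroup.mk (m ⊗ₜ[ℤ] n)

namespace BalancedTensor

theorem tmul_add (m : M) (n n' : N) : tmul A m (n + n') = tmul A m n + tmul A m n' := by
  simp [tmul, TensorProduct.tmul_add]

theorem add_tmul (m m' : M) (n : N) : tmul A (m + m') n = tmul A m n + tmul A m' n := by
  simp [tmul, TensorProduct.add_tmul]

theorem zero_tmul (n : N) : tmul A (0 : M) n = 0 := by
  simp [tmul]

theorem tmul_zero (m : M) : tmul A m (0 : N) = 0 := by
  simp [tmul]

theorem smul_tmul (m : M) (a : A) (n : N) : tmul A (op a • m) n = tmul A m (a • n) :=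
  (QuotientAddGroup.eq_iff_sub_mem).2 (AddSubgroup.subset_closure ⟨m, a, n, rfl⟩)

theorem map_tmul {M' : Type v} [AddCommGroup M'] [Module Aᵐᵒᵖ M'] (f : M →ₗ[Aᵐᵒᵖ] M')
    (m : M) (n : N) : map A N f (tmul A m n) = tmul A (f m) n := rfl

/-- `m ⊗ n` as an additive function of `n`. -/
def tmulHom (A : Type u) [Ring A] {M : Type v} [AddCommGroup M] [Module Aᵐᵒᵖ M]
    (N : Type w) [AddCommGroup N] [Module A N] (m : M) : N →+ BalancedTensor A M N :=
  AddMonoidHom.mk' (tmul A m) (tmul_add m)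

theorem induction_on {p : BalancedTensor A M N → Prop} (t : BalancedTensor A M N) (zero : p 0)
    (tmul : ∀ m n, p (tmul A m n)) (add : ∀ x y, p x → p y → p (x + y)) : p t := by
  obtain ⟨t, rfl⟩ := QuotientAddGroup.mk_surjective t
  induction t with
  | zero => exact zero
  | tmul m n => exact tmul m n
  | add x y hx hy => exact add _ _ hx hy

theorem hom_ext {P : Type*} [AddCommGroup P] {f g : BalancedTensor A M N →+ P}
    (h : ∀ m n, f (tmul A m n) = g (tmul A m n)) : f = g :=
  AddMonoidHom.ext fun t => induction_on (p := fun t => f t = g t) t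
    (by rw [map_zero, map_zero]) h fun x y hx hy => by rw [map_add, map_add, hx, hy]

/-- The additive map on `M ⊗_A N` defined by a balanced biadditive map. -/
def lift {P : Type*} [AddCommGroup P] (f : M →+ N →+ P)
    (hf : ∀ m (a : A) n, f (op a • m) n = f m (a • n)) : BalancedTensor A M N →+ P :=
  QuotientAddGroup.lift (balancedRel A M N)
    (TensorProduct.liftAddHom f fun r m n => by simp) (by
      refine (AddSubgroup.closure_le _).2 ?_
      rintro t ⟨m, a, n, rfl⟩
      simp [hf])

theorem lift_tmul {P : Type*} [AddCommGroup P] (f : M →+ N →+ P)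
    (hf : ∀ m (a : A) n, f (op a • m) n = f m (a • n)) (m : M) (n : N) :
    lift f hf (tmul A m n) = f m n := rfl

end BalancedTensor

end BalancedTensor

/-! ### What flatness and the epimorphism property say about tensors -/

section Annihilators

variable {A Q : Type u} [Ring A] [Ring Q] (φ : A →+* Q)

theorem mem_extendRight_of_mem {R : Submodule Aᵐᵒᵖ A} {r : A} (hr : r ∈ R) (q : Q) :
    φ r * q ∈ extendRight φ R :=
  (extendRight φ R).mul_mem_of_mem (Submodule.subset_span ⟨r, hr, rfl⟩) q

theorem extendRight_eq_top_iff {R : Submodule Aᵐᵒᵖ A} :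
    extendRight φ R = ⊤ ↔ (1 : Q) ∈ extendRight φ R := by
  refine ⟨fun h => h ▸ trivial, fun h => eq_top_iff.2 fun q _ => ?_⟩
  simpa using (extendRight φ R).mul_mem_of_mem h q

theorem exists_sum_of_mem_extendRight {R : Submodule Aᵐᵒᵖ A} {q : Q}
    (hq : q ∈ extendRight φ R) : ∃ (k : ℕ) (r : Fin k → A) (p : Fin k → Q),
      (∀ i, r i ∈ R) ∧ q = ∑ i, φ (r i) * p i := by
  induction hq using Submodule.closure_induction with
  | zero => exact ⟨0, Fin.elim0, Fin.elim0, fun i => i.elim0, by simp⟩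
  | add x y _ _ hx hy =>
    obtain ⟨k, r, p, hr, rfl⟩ := hx
    obtain ⟨k', r', p', hr', rfl⟩ := hy
    refine ⟨k + k', Fin.append r r', Fin.append p p', fun i => ?_, by
      simp [Fin.sum_univ_add]⟩
    induction i using Fin.addCases with
    | left i => simpa using hr i
    | right i => simpa using hr' i
  | smul_mem q x hx =>
    obtain ⟨r, hr, rfl⟩ := hx
    exact ⟨1, fun _ => r, fun _ => q.unop, fun _ => hr, by simp⟩

/-- If `Q` is flat and `m ⊗ p = 0` in `M ⊗_A Q` for all `p`, then the annihilator of `m` extends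
to the unit ideal. -/
theorem IsLeftFlatHom.extendRight_eq_top (hφ : IsLeftFlatHom φ) {M : Type u} [AddCommGroup M]
    [Module Aᵐᵒᵖ M] (m : M) {R : Submodule Aᵐᵒᵖ A} (hR : ∀ a, a ∈ R ↔ op a • m = 0)
    (hm : letI : Module A Q := Module.compHom Q φ
      ∀ p : Q, BalancedTensor.tmul A m p = 0) : extendRight φ R = ⊤ := by
  let _ : Module A Q := Module.compHom Q φ
  let f : A →ₗ[Aᵐᵒᵖ] M :=
    { toFun := fun a => op a • m
      map_add' := fun a b => by simp [add_smul]
      map_smul' := fun a b => by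
        obtain ⟨a, rfl⟩ := op_surjective a
        simp [mul_smul] }
  have hf : R = LinearMap.ker f := Submodule.ext hR
  let g : (A ⧸ R) →ₗ[Aᵐᵒᵖ] M := R.liftQ f hf.le
  have hg : Function.Injective g := by
    rw [← LinearMap.ker_eq_bot]
    exact Submodule.ker_liftQ_eq_bot _ _ _ hf.ge
  -- Since `a ↦ m a` embeds `A ⧸ R` in `M`, flatness makes `1 ⊗ 1` vanish already in `(A ⧸ R) ⊗ Q`.
  have h1 : BalancedTensor.tmul A (R.mkQ 1) (1 : Q) = 0 := by
    refine hφ _ _ g hg ?_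
    rw [BalancedTensor.map_tmul, map_zero]
    have : g (R.mkQ 1) = m := by simp [g, f]
    rw [this]
    exact hm 1
  -- The natural map `(A ⧸ R) ⊗ Q → Q ⧸ RQ` sends that vanishing tensor to the class of `1`.
  let E := extendRight φ R
  let F : (A ⧸ R) →+ Q →+ (Q ⧸ E) :=
    QuotientAddGroup.lift R.toAddSubgroup
      (AddMonoidHom.mk' (fun a => (E.mkQ.toAddMonoidHom).comp (AddMonoidHom.mulLeft (φ a)))
        fun a b => by ext q; simp [add_mul])
      (by
        intro a ha
        ext q
        simp only [AddMonoidHom.mk'_apply, AddMonoidHom.comp_apply, AddMonoidHom.coe_mulLeft,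
          LinearMap.toAddMonoidHom_coe, AddMonoidHom.zero_apply]
        exact (Submodule.Quotient.mk_eq_zero _).2 (mem_extendRight_of_mem φ ha q))
  have hF : ∀ (x : A ⧸ R) (a : A) (q : Q), F (op a • x) q = F x (a • q) := by
    intro x a q
    obtain ⟨x, rfl⟩ := R.mkQ_surjective x
    change E.mkQ (φ (x * a) * q) = E.mkQ (φ x * (φ a * q))
    rw [φ.map_mul, mul_assoc]
  have h2 := congrArg (BalancedTensor.lift F hF) h1
  rw [BalancedTensor.lift_tmul, map_zero] at h2
  have h3 : E.mkQ (φ 1 * 1) = 0 := h2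
  rw [map_one, mul_one, Submodule.mkQ_apply, Submodule.Quotient.mk_eq_zero] at h3
  exact (extendRight_eq_top_iff φ).2 h3

/-- For a ring epimorphism `A → Q` one has `q ⊗ p = 1 ⊗ q p` in `Q ⊗_A Q`. -/
theorem IsRingEpi.tmul_eq (hφ : IsRingEpi φ) (q p : Q) :
    letI : Module A Q := Module.compHom Q φ
    letI : Module Aᵐᵒᵖ Q := Module.compHom Q φ.op
    BalancedTensor.tmul A q p = BalancedTensor.tmul A (1 : Q) (q * p) := by
  let _ : Module A Q := Module.compHom Q φ
  let _ : Module Aᵐᵒᵖ Q := Module.compHom Q φ.op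
  let mulL : Q → (Q →ₗ[Aᵐᵒᵖ] Q) := fun q =>
    { toFun := fun x => q * x
      map_add' := mul_add q
      map_smul' := fun a x => (mul_assoc q x (φ a.unop)).symm }
  let L : Q →+* AddMonoid.End (BalancedTensor A Q Q) :=
    { toFun := fun q => BalancedTensor.map A Q (mulL q)
      map_one' := by
        refine BalancedTensor.hom_ext fun x y => ?_
        exact congrArg (fun z => BalancedTensor.tmul A z y) (one_mul x)
      map_mul' := fun q q' => by
        refine BalancedTensor.hom_ext fun x y => ?_
        exact congrArg (fun z => BalancedTensor.tmul A z y) (mul_assoc q q' x)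
      map_zero' := by
        refine BalancedTensor.hom_ext fun x y => ?_
        exact (congrArg (fun z => BalancedTensor.tmul A z y) (zero_mul x)).trans
          (BalancedTensor.zero_tmul y)
      map_add' := fun q q' => by
        refine BalancedTensor.hom_ext fun x y => ?_
        exact (congrArg (fun z => BalancedTensor.tmul A z y) (add_mul q q' x)).trans
          (BalancedTensor.add_tmul _ _ y) }
  have hL : ∀ q x y, L q (BalancedTensor.tmul A x y) = BalancedTensor.tmul A (q * x) y :=
    fun q x y => rfl
  -- The diagonal action `α` is conjugated by `1 + D`, where `D (q, t) = (0, 1 ⊗ q)` has square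
  -- zero. Since `1 ⊗ φ(a) x = φ(a) ⊗ x`, `D` commutes with `α (φ a)`, so `α` and its conjugate `β`
  -- agree on `A`, hence on `Q`. The off-diagonal entry of `β q` is `x ↦ q ⊗ x - 1 ⊗ q x`.
  let α : Q →+* AddMonoid.End (Q × BalancedTensor A Q Q) :=
    { toFun := fun q => AddMonoidHom.prodMap (AddMonoidHom.mulLeft q) (L q)
      map_one' := AddMonoidHom.ext fun x => Prod.ext (one_mul _) (by rw [L.map_one]; rfl)
      map_mul' := fun q q' => AddMonoidHom.ext fun x =>
        Prod.ext (mul_assoc _ _ _) (by rw [L.map_mul]; rfl)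
      map_zero' := AddMonoidHom.ext fun x => Prod.ext (zero_mul _) (by rw [L.map_zero]; rfl)
      map_add' := fun q q' => AddMonoidHom.ext fun x =>
        Prod.ext (add_mul _ _ _) (by rw [L.map_add]; rfl) }
  let D : AddMonoid.End (Q × BalancedTensor A Q Q) :=
    (AddMonoidHom.inr Q (BalancedTensor A Q Q)).comp
      ((BalancedTensor.tmulHom A Q (1 : Q)).comp (AddMonoidHom.fst Q (BalancedTensor A Q Q)))
  have hDD : D * D = 0 := AddMonoidHom.ext fun x =>
    Prod.ext rfl (BalancedTensor.tmul_zero (1 : Q))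
  have h1 : (1 - D) * (1 + D) = 1 := by
    rw [mul_add, sub_mul, sub_mul, one_mul, mul_one, one_mul, hDD]; abel
  have h2 : (1 + D) * (1 - D) = 1 := by
    rw [mul_sub, add_mul, add_mul, one_mul, mul_one, one_mul, hDD]; abel
  let β := α.conjugate h1 h2
  have hβ : ∀ q x, (β q (x, 0)).2 = BalancedTensor.tmul A q x - BalancedTensor.tmul A 1 (q * x) := by
    intro q x
    change (L q (0 + BalancedTensor.tmul A (1 : Q) x)) - BalancedTensor.tmul A 1 (q * (x + 0)) = _
    rw [zero_add, add_zero, hL, mul_one]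
  have hD : ∀ a : A, D * α (φ a) = α (φ a) * D := by
    intro a
    refine AddMonoidHom.ext fun x => Prod.ext ?_ ?_
    · exact (mul_zero _).symm
    · change BalancedTensor.tmul A (1 : Q) (φ a * x.1) =
        BalancedTensor.tmul A (φ a * 1) x.1
      rw [mul_one]
      have := BalancedTensor.smul_tmul (1 : Q) a x.1
      have h3 : op a • (1 : Q) = φ a := one_mul _
      rw [h3] at this
      exact this.symm
  have hαβ : α = β := by
    refine hφ _ α β (RingHom.ext fun a => ?_)
    change α (φ a) = (1 - D) * α (φ a) * (1 + D)
    have : (1 - D) * α (φ a) = α (φ a) * (1 - D) := by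
      rw [sub_mul, mul_sub, one_mul, mul_one, hD]
    rw [this, mul_assoc, h1, mul_one]
  have h3 := hβ q p
  rw [← hαβ] at h3
  have h4 : (α q (p, 0)).2 = 0 := (L q).map_zero
  rw [h4] at h3
  exact (sub_eq_zero.1 h3.symm)

end Annihilators

/-! ### Perfect localizations and their uniqueness -/

section Localization

variable {A Q Q' : Type u} [Ring A] [Ring Q] [Ring Q']

/-- `φ : A → Q` exhibits `Q` as the (perfect) right localization of `A` at the Gabriel
topology `T`. -/
structure IsPerfectLocalization (φ : A →+* Q) (T : Set (Submodule Aᵐᵒᵖ A)) : Prop where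
  injective : Function.Injective φ
  gabriel : IsGabrielTopology T
  exists_denom : ∀ q : Q, ∃ D ∈ T, ∀ d ∈ D, ∃ a, q * φ d = φ a
  extend : ∀ R ∈ T, extendRight φ R = ⊤

namespace IsPerfectLocalization

variable {φ : A →+* Q} {φ' : A →+* Q'} {T : Set (Submodule Aᵐᵒᵖ A)}

theorem exists_sum_eq_one (h : IsPerfectLocalization φ T) {R : Submodule Aᵐᵒᵖ A} (hR : R ∈ T) :
    ∃ (k : ℕ) (r : Fin k → A) (p : Fin k → Q), (∀ i, r i ∈ R) ∧ 1 = ∑ i, φ (r i) * p i :=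
  exists_sum_of_mem_extendRight φ (h.extend R hR ▸ trivial)

theorem exists_common_denom (h : IsPerfectLocalization φ T) {ι : Type*} [Finite ι] (q : ι → Q) :
    ∃ D ∈ T, ∀ i, ∀ d ∈ D, ∃ a, q i * φ d = φ a := by
  choose D hD hDq using fun i => h.exists_denom (q i)
  exact ⟨⨅ i, D i, h.gabriel.iInf_mem hD,
    fun i d hd => hDq i d ((Submodule.mem_iInf _).1 hd i)⟩

theorem eq_zero_of_mul (h : IsPerfectLocalization φ T) {D : Submodule Aᵐᵒᵖ A} (hD : D ∈ T)
    {x : Q} (hx : ∀ d ∈ D, x * φ d = 0) : x = 0 := by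
  obtain ⟨k, r, p, hr, h1⟩ := h.exists_sum_eq_one hD
  rw [← mul_one x, h1, Finset.mul_sum]
  exact Finset.sum_eq_zero fun i _ => by rw [← mul_assoc, hx _ (hr i), zero_mul]

theorem eq_of_mul (h : IsPerfectLocalization φ T) {D : Submodule Aᵐᵒᵖ A} (hD : D ∈ T)
    {x y : Q} (hx : ∀ d ∈ D, x * φ d = y * φ d) : x = y :=
  sub_eq_zero.1 (h.eq_zero_of_mul hD fun d hd => by rw [sub_mul, hx d hd, sub_self])

/-- If `1 = ∑ φ (r i) * p i` with `r i ∈ R`, every common denominator `d` of the `p i` equals `∑ r i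
(p i d)`, so `R` contains an open right ideal. -/
theorem extendRight_eq_top_iff (h : IsPerfectLocalization φ T) {R : Submodule Aᵐᵒᵖ A} :
    extendRight φ R = ⊤ ↔ R ∈ T := by
  refine ⟨fun hR => ?_, h.extend R⟩
  obtain ⟨k, r, p, hr, h1⟩ := exists_sum_of_mem_extendRight φ (q := 1)
    (show _ ∈ extendRight φ R from hR.symm ▸ trivial)
  obtain ⟨D, hD, hDp⟩ := h.exists_common_denom p
  refine h.gabriel.mem_of_le D hD R fun d hd => ?_
  choose a ha using fun i => hDp i d hd
  have : φ d = φ (∑ i, r i * a i) := by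
    rw [← one_mul (φ d), h1, Finset.sum_mul, map_sum]
    exact Finset.sum_congr rfl fun i _ => by rw [mul_assoc, ha, map_mul]
  rw [h.injective this]
  exact R.sum_mem fun i _ => R.mul_mem_of_mem (hr i) _

/-- The difference `α q - β q` annihilates `α (φ d)` for every denominator `d` of `q`, and the `φ d`
generate the unit right ideal. -/
theorem isRingEpi (h : IsPerfectLocalization φ T) : IsRingEpi φ := by
  intro C _ α β hαβ
  ext q
  obtain ⟨D, hD, hDq⟩ := h.exists_denom q
  obtain ⟨k, r, p, hr, h1⟩ := h.exists_sum_eq_one hD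
  have hφ : ∀ a, α (φ a) = β (φ a) := fun a => RingHom.congr_fun hαβ a
  have hz : ∀ d ∈ D, (α q - β q) * α (φ d) = 0 := by
    intro d hd
    obtain ⟨a, ha⟩ := hDq d hd
    rw [sub_mul, ← map_mul, ha, hφ d, ← map_mul, ha, hφ, sub_self]
  have h2 : (α q - β q) * α 1 = 0 := by
    rw [h1, map_sum, Finset.mul_sum]
    exact Finset.sum_eq_zero fun i _ => by rw [map_mul, ← mul_assoc, hz _ (hr i), zero_mul]
  rw [map_one, mul_one] at h2
  exact sub_eq_zero.1 h2

/-- Every right linear map from an open right ideal to `A` is a left multiplication in `Q`. -/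
theorem exists_mul_eq (h : IsPerfectLocalization φ T) {R : Submodule Aᵐᵒᵖ A} (hR : R ∈ T)
    (f : R →ₗ[Aᵐᵒᵖ] A) : ∃ q, ∀ r : R, q * φ r = φ (f r) := by
  obtain ⟨k, r, p, hr, h1⟩ := h.exists_sum_eq_one hR
  -- The expansion `x = ∑ r i (p i x)` suggests `f x = ∑ f (r i) (p i x)`, which dictates this `q`.
  -- The elements `p i x` need not lie in `A`, but they do after multiplication by a denominator.
  refine ⟨∑ i, φ (f ⟨r i, hr i⟩) * p i, fun x => ?_⟩
  obtain ⟨D, hD, hDp⟩ := h.exists_common_denom fun i => p i * φ x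
  refine h.eq_of_mul hD fun d hd => ?_
  choose a ha using fun i => hDp i d hd
  have hxd : op d • x = ∑ i, op (a i) • (⟨r i, hr i⟩ : R) := by
    refine Subtype.ext (h.injective ?_)
    rw [Submodule.coe_sum, map_sum]
    change φ (x * d) = ∑ i, φ (r i * a i)
    rw [map_mul, ← one_mul (φ x), h1, Finset.sum_mul, Finset.sum_mul]
    exact Finset.sum_congr rfl fun i _ => by rw [map_mul, ← ha, mul_assoc, mul_assoc, mul_assoc]
  have h2 := congrArg (fun y => φ (f y)) hxd
  simp only [map_smul, map_sum, op_smul_eq_mul, map_mul] at h2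
  rw [h2, Finset.sum_mul, Finset.sum_mul]
  exact Finset.sum_congr rfl fun i _ => by rw [← ha, mul_assoc, mul_assoc, mul_assoc]

/-- If `s` is a denominator of `q` with `q * φ s = φ a`, left multiplication by `s` carries `(R :
a)` into the required ideal, so transitivity applies. This yields denominators for products. -/
theorem exists_denom_mem (h : IsPerfectLocalization φ T) (q : Q) {R : Submodule Aᵐᵒᵖ A}
    (hR : R ∈ T) : ∃ D ∈ T, ∀ d ∈ D, ∃ a ∈ R, q * φ d = φ a := by
  obtain ⟨D, hD, hDq⟩ := h.exists_denom q
  let D' : Submodule Aᵐᵒᵖ A :=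
    { carrier := {d | ∃ a ∈ R, q * φ d = φ a}
      add_mem' := by
        rintro d d' ⟨a, ha, hda⟩ ⟨a', ha', hda'⟩
        exact ⟨a + a', R.add_mem ha ha', by rw [map_add, mul_add, hda, hda', map_add]⟩
      zero_mem' := ⟨0, R.zero_mem, by simp⟩
      smul_mem' := by
        rintro c d ⟨a, ha, hda⟩
        exact ⟨a * c.unop, R.mul_mem_of_mem ha _, by
          rw [map_mul, ← hda, mul_assoc, ← map_mul]; rfl⟩ }
  refine ⟨D', h.gabriel.mem_of_rightColon hD fun s hs => ?_, fun d hd => hd⟩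
  obtain ⟨a, ha⟩ := hDq s hs
  refine h.gabriel.mem_of_le _ (h.gabriel.rightColon_mem hR a) _ fun x hx => ?_
  exact ⟨a * x, hx, by
    change q * φ (s * x) = _
    rw [map_mul, ← mul_assoc, ha, map_mul]⟩

/-- The map `d ↦ q d` from an open right ideal to `A` is right linear, hence also a left
multiplication in `Q'`. -/
theorem exists_extension (h : IsPerfectLocalization φ T) (h' : IsPerfectLocalization φ' T)
    (q : Q) : ∃ q' : Q', ∃ D ∈ T, ∀ d ∈ D, ∃ a, q * φ d = φ a ∧ q' * φ' d = φ' a := by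
  obtain ⟨D, hD, hDq⟩ := h.exists_denom q
  choose f hf using hDq
  have hinj : ∀ d hd, ∀ a, q * φ d = φ a → f d hd = a :=
    fun d hd a ha => h.injective (by rw [← hf, ha])
  let g : D →ₗ[Aᵐᵒᵖ] A :=
    { toFun := fun d => f d d.2
      map_add' := fun d d' => hinj _ _ _ (by
        rw [map_add, ← hf, ← hf, ← mul_add, ← map_add]; rfl)
      map_smul' := fun c d => hinj _ _ _ (by
        obtain ⟨c, rfl⟩ := op_surjective c
        change q * φ (d * c) = φ (f d d.2 * c)
        rw [map_mul, map_mul, ← hf, mul_assoc]) }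
  obtain ⟨q', hq'⟩ := h'.exists_mul_eq hD g
  exact ⟨q', D, hD, fun d hd => ⟨f d hd, hf d hd, hq' ⟨d, hd⟩⟩⟩

/-- Two perfect localizations at the same Gabriel topology are isomorphic. -/
theorem exists_ringEquiv (h : IsPerfectLocalization φ T) (h' : IsPerfectLocalization φ' T) :
    ∃ e : Q ≃+* Q', ∀ a, e (φ a) = φ' a := by
  -- Related elements act alike on some open right ideal. Such an action determines the element, so
  -- the relation is the graph of a bijection.
  let rel : Q → Q' → Prop := fun q q' =>
    ∃ D ∈ T, ∀ d ∈ D, ∃ a, q * φ d = φ a ∧ q' * φ' d = φ' a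
  have hex : ∀ q, ∃ q', rel q q' := fun q => h.exists_extension h' q
  have hex' : ∀ q', ∃ q, rel q q' := fun q' => by
    obtain ⟨q, D, hD, hq⟩ := h'.exists_extension h q'
    exact ⟨q, D, hD, fun d hd => (hq d hd).imp fun a ha => ha.symm⟩
  have huniq : ∀ q q' q'', rel q q' → rel q q'' → q' = q'' := by
    rintro q q' q'' ⟨D, hD, hq⟩ ⟨D', hD', hq'⟩
    refine h'.eq_of_mul (h.gabriel.inf_mem D hD D' hD') fun d hd => ?_
    obtain ⟨a, ha, ha'⟩ := hq d hd.1
    obtain ⟨b, hb, hb'⟩ := hq' d hd.2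
    rw [ha', hb', h.injective (ha.symm.trans hb)]
  have huniq' : ∀ q q' p, rel q q' → rel p q' → q = p := by
    rintro q q' p ⟨D, hD, hq⟩ ⟨D', hD', hq'⟩
    refine h.eq_of_mul (h.gabriel.inf_mem D hD D' hD') fun d hd => ?_
    obtain ⟨a, ha, ha'⟩ := hq d hd.1
    obtain ⟨b, hb, hb'⟩ := hq' d hd.2
    rw [ha, hb, h'.injective (ha'.symm.trans hb')]
  have hadd : ∀ q q' p p', rel q q' → rel p p' → rel (q + p) (q' + p') := by
    rintro q q' p p' ⟨D, hD, hq⟩ ⟨D', hD', hp⟩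
    refine ⟨_, h.gabriel.inf_mem D hD D' hD', fun d hd => ?_⟩
    obtain ⟨a, ha, ha'⟩ := hq d hd.1
    obtain ⟨b, hb, hb'⟩ := hp d hd.2
    exact ⟨a + b, by rw [add_mul, ha, hb, map_add], by rw [add_mul, ha', hb', map_add]⟩
  have hmul : ∀ q q' p p', rel q q' → rel p p' → rel (q * p) (q' * p') := by
    rintro q q' p p' ⟨D, hD, hq⟩ ⟨D', hD', hp⟩
    obtain ⟨E, hE, hEp⟩ := h.exists_denom_mem p hD
    refine ⟨_, h.gabriel.inf_mem E hE D' hD', fun d hd => ?_⟩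
    obtain ⟨a, haD, ha⟩ := hEp d hd.1
    obtain ⟨b, hb, hb'⟩ := hp d hd.2
    obtain rfl : a = b := h.injective (ha.symm.trans hb)
    obtain ⟨c, hc, hc'⟩ := hq a haD
    exact ⟨c, by rw [mul_assoc, ha, hc], by rw [mul_assoc, hb', hc']⟩
  have hφ : ∀ a, rel (φ a) (φ' a) := fun a =>
    ⟨⊤, h.gabriel.top_mem, fun d _ => ⟨a * d, by rw [map_mul], by rw [map_mul]⟩⟩
  choose e he using hex
  choose e' he' using hex'
  exact ⟨{ toFun := e
           invFun := e'
           left_inv := fun q => huniq' _ _ _ (he' _) (he q)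
           right_inv := fun q => huniq _ _ _ (he _) (he' q)
           map_add' := fun q p => huniq _ _ _ (he _) (hadd _ _ _ _ (he q) (he p))
           map_mul' := fun q p => huniq _ _ _ (he _) (hmul _ _ _ _ (he q) (he p)) },
    fun a => huniq _ _ _ (he _) (hφ a)⟩

/-- A right ideal of a perfect localization is free if its contraction is free. -/
theorem free_of_basis (h : IsPerfectLocalization φ T) (J : Submodule Qᵐᵒᵖ Q)
    {R : Submodule Aᵐᵒᵖ A} (hR : ∀ a, a ∈ R ↔ φ a ∈ J) {P : Type*} (e : Basis P Aᵐᵒᵖ R) :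
    Nonempty (Basis P Qᵐᵒᵖ J) := by
  have hli : LinearIndependent Qᵐᵒᵖ fun p => φ (e p : A) := by
    classical
    rw [linearIndependent_iff']
    intro s g hg p hp
    -- Right multiplication by a common denominator turns the relation over `Q` into one over `A`.
    obtain ⟨D, hD, hDg⟩ := h.exists_common_denom fun p : s => (g p).unop
    refine unop_injective (h.eq_zero_of_mul hD fun d hd => ?_)
    choose a ha using fun p => hDg p d hd
    have h1 : ∑ p : s, op (a p) • e p = 0 := by
      refine Subtype.ext (h.injective ?_)
      have h2 := congrArg (· * φ d) hg
      simp only [zero_mul, Finset.sum_mul] at h2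
      rw [← Finset.sum_coe_sort] at h2
      rw [Submodule.coe_sum, map_sum, Submodule.coe_zero, map_zero, ← h2]
      refine Finset.sum_congr rfl fun p _ => ?_
      change φ (e p * a p) = φ (e p) * (g p).unop * φ d
      rw [map_mul, mul_assoc, ha]
    have h2 := linearIndependent_iff'.1 (e.linearIndependent.comp ((↑) : s → P)
      Subtype.val_injective) Finset.univ (fun p => op (a p)) h1 ⟨p, hp⟩ (Finset.mem_univ _)
    have h3 := ha ⟨p, hp⟩
    rw [(op_eq_zero_iff _).1 h2, map_zero] at h3
    exact h3
  have hspan : Submodule.span Qᵐᵒᵖ (Set.range fun p => φ (e p : A)) = J := by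
    refine le_antisymm (Submodule.span_le.2 ?_) fun q hq => ?_
    · rintro _ ⟨p, rfl⟩
      exact (hR _).1 (e p).2
    · have hφR : ∀ r : R, φ (r : A) ∈ Submodule.span Qᵐᵒᵖ (Set.range fun p => φ (e p : A)) := by
        intro r
        rw [← e.linearCombination_repr r, Finsupp.linearCombination_apply, Finsupp.sum,
          Submodule.coe_sum, map_sum]
        refine Submodule.sum_mem _ fun p _ => ?_
        change φ (e p * (e.repr r p).unop) ∈ _
        rw [map_mul]
        exact Submodule.mul_mem_of_mem (Submodule.subset_span (Set.mem_range_self p)) _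
      obtain ⟨D, hD, hDq⟩ := h.exists_denom q
      obtain ⟨k, r, p, hr, h1⟩ := h.exists_sum_eq_one hD
      -- In `q = ∑ (q φ(r i)) p i`, each `q φ(r i)` lies both in `J` and in `φ(A)`, so it comes from
      -- the contraction.
      rw [← mul_one q, h1, Finset.mul_sum]
      refine Submodule.sum_mem _ fun i _ => ?_
      obtain ⟨a, ha⟩ := hDq _ (hr i)
      rw [← mul_assoc, ha]
      refine Submodule.mul_mem_of_mem (hφR ⟨a, (hR a).2 ?_⟩) _
      rw [← ha]
      exact J.mul_mem_of_mem hq _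
  exact ⟨(Basis.span hli).map (LinearEquiv.ofEq _ _ hspan)⟩

end IsPerfectLocalization

theorem extendRight_mono (φ : A →+* Q) {R S : Submodule Aᵐᵒᵖ A} (h : R ≤ S) :
    extendRight φ R ≤ extendRight φ S :=
  Submodule.span_mono (Set.image_mono h)

/-- A flat bimorphism is the perfect localization at the Gabriel topology it defines. -/
theorem FlatBimorphism.isPerfectLocalization (F : FlatBimorphism A) :
    IsPerfectLocalization F.φ F.opens where
  injective := F.injective
  gabriel := by
    refine .of_rightColon ?_ ?_ ?_ ?_
    · exact (_root_.extendRight_eq_top_iff F.φ).2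
        (Submodule.subset_span ⟨1, trivial, F.φ.map_one⟩)
    · intro R hR S hRS
      exact top_le_iff.1 (hR.ge.trans (extendRight_mono F.φ hRS))
    · intro R hR a
      -- `(R : a)` annihilates exactly the class of `a` in `A ⧸ R`, and `a ⊗ p = 1 ⊗ φ(a) p`
      -- vanishes because `φ(a) p ∈ Q = RQ`.
      refine F.flat.extendRight_eq_top F.φ (R.mkQ a) (fun x => ?_) fun p => ?_
      · rw [mem_rightColon, ← map_smul, Submodule.mkQ_apply, Submodule.Quotient.mk_eq_zero]
        rfl
      · let _ : Module A F.Q := Module.compHom F.Q F.φ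
        have hone : ∀ (x : A) (q : F.Q), BalancedTensor.tmul A (R.mkQ x) q =
            BalancedTensor.tmul A (R.mkQ 1) (F.φ x * q) := by
          intro x q
          have h1 : R.mkQ x = op x • R.mkQ 1 := by rw [← map_smul]; simp
          rw [h1]
          exact BalancedTensor.smul_tmul _ _ _
        obtain ⟨k, r, t, hr, h1⟩ := exists_sum_of_mem_extendRight F.φ (q := F.φ a * p)
          (show _ ∈ extendRight F.φ R from hR.symm ▸ trivial)
        rw [hone, h1]
        change BalancedTensor.tmulHom A F.Q (R.mkQ 1) _ = 0
        rw [map_sum]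
        refine Finset.sum_eq_zero fun i _ => ?_
        change BalancedTensor.tmul A (R.mkQ 1) (F.φ (r i) * t i) = 0
        have h2 : R.mkQ (r i) = 0 := (Submodule.Quotient.mk_eq_zero R).2 (hr i)
        rw [← hone, h2]
        exact BalancedTensor.zero_tmul _
    · intro R S hS h
      refine (_root_.extendRight_eq_top_iff F.φ).2 ?_
      obtain ⟨k, s, p, hs, h1⟩ := exists_sum_of_mem_extendRight F.φ (q := 1)
        (show _ ∈ extendRight F.φ S from hS.symm ▸ trivial)
      rw [h1]
      refine Submodule.sum_mem _ fun i _ => Submodule.mul_mem_of_mem ?_ _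
      obtain ⟨k, c, t, hc, h2⟩ := exists_sum_of_mem_extendRight F.φ (q := 1)
        (show _ ∈ extendRight F.φ (rightColon R (s i)) from (h _ (hs i)).symm ▸ trivial)
      rw [← mul_one (F.φ (s i)), h2, Finset.mul_sum]
      refine Submodule.sum_mem _ fun j _ => ?_
      rw [← mul_assoc, ← map_mul]
      exact mem_extendRight_of_mem F.φ (mem_rightColon.1 (hc j)) _
  exists_denom q := by
    let _ : Module A F.Q := Module.compHom F.Q F.φ
    let _ : Module Aᵐᵒᵖ F.Q := Module.compHom F.Q F.φ.op
    have hsmul : ∀ (a : A) (q : F.Q), op a • q = q * F.φ a := fun a q => rfl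
    let N : Submodule Aᵐᵒᵖ F.Q :=
      { carrier := Set.range F.φ
        add_mem' := by rintro _ _ ⟨a, rfl⟩ ⟨b, rfl⟩; exact ⟨a + b, map_add _ _ _⟩
        zero_mem' := ⟨0, map_zero _⟩
        smul_mem' := by rintro c _ ⟨a, rfl⟩; exact ⟨a * c.unop, map_mul _ _ _⟩ }
    let D : Submodule Aᵐᵒᵖ A :=
      { carrier := {d | q * F.φ d ∈ N}
        add_mem' := fun {a b} ha hb => by
          rw [Set.mem_ofPred_eq, map_add, mul_add]; exact N.add_mem ha hb
        zero_mem' := by rw [Set.mem_ofPred_eq, map_zero, mul_zero]; exact N.zero_mem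
        smul_mem' := fun c a ha => by
          have : q * F.φ (c • a) = c • (q * F.φ a) := by
            obtain ⟨c, rfl⟩ := op_surjective c
            rw [hsmul, op_smul_eq_mul, map_mul, mul_assoc]
          rw [Set.mem_ofPred_eq, this]
          exact N.smul_mem c ha }
    refine ⟨D, ?_, fun d ⟨a, ha⟩ => ⟨a, ha.symm⟩⟩
    -- `D` is the annihilator of the class of `q` in `Q ⧸ φ(A)`, and `q ⊗ p = 1 ⊗ q p` vanishes in
    -- `(Q ⧸ φ(A)) ⊗ Q`.
    refine F.flat.extendRight_eq_top F.φ (N.mkQ q) (fun x => ?_) fun p => ?_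
    · rw [← map_smul, Submodule.mkQ_apply, Submodule.Quotient.mk_eq_zero]
      rfl
    · have h1 := congrArg (BalancedTensor.map A F.Q N.mkQ) (F.epi.tmul_eq F.φ q p)
      have h2 : N.mkQ 1 = 0 := (Submodule.Quotient.mk_eq_zero N).2 ⟨1, map_one _⟩
      rw [BalancedTensor.map_tmul, BalancedTensor.map_tmul, h2,
        BalancedTensor.zero_tmul] at h1
      exact h1
  extend R hR := hR

end Localization

/-! ### Perfect localizations are flat -/

section Flat

variable {A Q : Type u} [Ring A] [Ring Q] {φ : A →+* Q} {T : Set (Submodule Aᵐᵒᵖ A)}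

/-- Right multiplication by `p` on `M ⊗_A Q`. -/
def BalancedTensor.mulRight (φ : A →+* Q) (M : Type v) [AddCommGroup M] [Module Aᵐᵒᵖ M] (p : Q) :
    letI : Module A Q := Module.compHom Q φ
    BalancedTensor A M Q →+ BalancedTensor A M Q :=
  letI : Module A Q := Module.compHom Q φ
  BalancedTensor.lift
    (AddMonoidHom.mk' (fun m => (BalancedTensor.tmulHom A Q m).comp (AddMonoidHom.mulRight p))
      fun m m' => by
        ext q
        exact BalancedTensor.add_tmul m m' (q * p))
    (fun m a q => (BalancedTensor.smul_tmul m a (q * p)).trans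
      (congrArg (BalancedTensor.tmul A m) (mul_assoc (φ a) q p).symm))

open Classical in
/-- The element `a` with `q φ(x) = φ(a)`, if there is one, and `0` otherwise. -/
noncomputable def numerator (φ : A →+* Q) (q : Q) (x : A) : A :=
  if h : ∃ a, q * φ x = φ a then h.choose else 0

theorem numerator_eq (hφ : Function.Injective φ) {q : Q} {x a : A} (h : q * φ x = φ a) :
    numerator φ q x = a := by
  have h' : ∃ a, q * φ x = φ a := ⟨a, h⟩
  rw [numerator, dif_pos h']
  exact hφ (h'.choose_spec.symm.trans h)

/-- The functions that vanish on some open right ideal. -/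
def IsGabrielTopology.vanishing (hT : IsGabrielTopology T) (M : Type v) [AddCommGroup M] :
    AddSubgroup (A → M) where
  carrier := {f | ∃ R ∈ T, ∀ x ∈ R, f x = 0}
  add_mem' := by
    rintro f g ⟨R, hR, hf⟩ ⟨S, hS, hg⟩
    exact ⟨_, hT.inf_mem R hR S hS, fun x hx => by simp [hf x hx.1, hg x hx.2]⟩
  zero_mem' := ⟨⊤, hT.top_mem, fun _ _ => rfl⟩
  neg_mem' := by
    rintro f ⟨R, hR, hf⟩
    exact ⟨R, hR, fun x hx => by simp [hf x hx]⟩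

/-- The torsion of `m` is detected by sending `m ⊗ q` to the germ of `x ↦ m (q x)`, defined where `q
x ∈ A`; for `q = 1` this is the germ of `x ↦ m x`. The default value of `numerator` does not affect
germs. -/
theorem IsPerfectLocalization.exists_smul_eq_zero (h : IsPerfectLocalization φ T) {M : Type v}
    [AddCommGroup M] [Module Aᵐᵒᵖ M] {m : M}
    (hm : letI : Module A Q := Module.compHom Q φ
      BalancedTensor.tmul A m (1 : Q) = 0) : ∃ D ∈ T, ∀ d ∈ D, op d • m = 0 := by
  let _ : Module A Q := Module.compHom Q φ
  let F : M →+ Q →+ (A → M) ⧸ h.gabriel.vanishing M :=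
    AddMonoidHom.mk' (fun m => AddMonoidHom.mk'
      (fun q => QuotientAddGroup.mk fun x => op (numerator φ q x) • m) (by
        intro q q'
        rw [← QuotientAddGroup.mk_add]
        refine QuotientAddGroup.eq_iff_sub_mem.2 ?_
        obtain ⟨D, hD, hDq⟩ := h.exists_common_denom ![q, q']
        refine ⟨D, hD, fun d hd => ?_⟩
        obtain ⟨a, ha⟩ := hDq 0 d hd
        obtain ⟨b, hb⟩ := hDq 1 d hd
        simp only [Matrix.cons_val_zero, Matrix.cons_val_one] at ha hb
        have hab : (q + q') * φ d = φ (a + b) := by rw [add_mul, ha, hb, map_add]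
        simp only [Pi.sub_apply, Pi.add_apply, numerator_eq h.injective ha,
          numerator_eq h.injective hb, numerator_eq h.injective hab, op_add, add_smul, sub_self]))
      (by
        intro m m'
        ext q
        simp only [AddMonoidHom.mk'_apply, AddMonoidHom.add_apply, ← QuotientAddGroup.mk_add]
        congr 1
        ext x
        simp)
  have hF : ∀ m (a : A) (q : Q), F (op a • m) q = F m (a • q) := by
    intro m a q
    refine QuotientAddGroup.eq_iff_sub_mem.2 ?_
    obtain ⟨D, hD, hDq⟩ := h.exists_denom q
    refine ⟨D, hD, fun d hd => ?_⟩
    obtain ⟨b, hb⟩ := hDq d hd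
    have hab : (a • q) * φ d = φ (a * b) := by
      rw [map_mul, ← hb]
      exact mul_assoc _ _ _
    simp only [Pi.sub_apply, numerator_eq h.injective hb, numerator_eq h.injective hab,
      op_mul, mul_smul, sub_self]
  have h1 := congrArg (BalancedTensor.lift F hF) hm
  rw [BalancedTensor.lift_tmul, map_zero] at h1
  obtain ⟨D, hD, hDm⟩ := (QuotientAddGroup.eq_zero_iff _).1 h1
  refine ⟨D, hD, fun d hd => ?_⟩
  have := hDm d hd
  simpa only [numerator_eq h.injective (one_mul (φ d))] using this

/-- Perfect localizations are flat. -/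
theorem IsPerfectLocalization.isLeftFlatHom (h : IsPerfectLocalization φ T) :
    IsLeftFlatHom φ := by
  let _ : Module A Q := Module.compHom Q φ
  intro M M' _ _ _ _ f hf
  have smul_eq : ∀ (a : A) (q : Q), a • q = φ a * q := fun _ _ => rfl
  have hden : ∀ t : BalancedTensor A M Q, ∃ D ∈ T, ∀ d ∈ D, ∃ m,
      BalancedTensor.mulRight φ M (φ d) t = BalancedTensor.tmul A m (1 : Q) := by
    intro t
    refine t.induction_on (p := fun t => ∃ D ∈ T, ∀ d ∈ D, ∃ m,
      BalancedTensor.mulRight φ M (φ d) t = BalancedTensor.tmul A m (1 : Q)) ?_ ?_ ?_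
    · exact ⟨⊤, h.gabriel.top_mem, fun d _ => ⟨0, by
        rw [map_zero, BalancedTensor.zero_tmul]⟩⟩
    · intro m q
      obtain ⟨D, hD, hDq⟩ := h.exists_denom q
      refine ⟨D, hD, fun d hd => ?_⟩
      obtain ⟨a, ha⟩ := hDq d hd
      refine ⟨op a • m, ?_⟩
      rw [BalancedTensor.smul_tmul, smul_eq, mul_one, ← ha]
      rfl
    · rintro x y ⟨D, hD, hx⟩ ⟨D', hD', hy⟩
      refine ⟨_, h.gabriel.inf_mem D hD D' hD', fun d hd => ?_⟩
      obtain ⟨m, hm⟩ := hx d hd.1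
      obtain ⟨m', hm'⟩ := hy d hd.2
      exact ⟨m + m', by rw [map_add, hm, hm', BalancedTensor.add_tmul]⟩
  have hone : ∀ t : BalancedTensor A M Q, BalancedTensor.mulRight φ M 1 t = t := by
    intro t
    refine t.induction_on (p := fun t => BalancedTensor.mulRight φ M 1 t = t) (map_zero _)
      (fun m q => congrArg (BalancedTensor.tmul A m) (mul_one q)) ?_
    intro x y hx hy
    rw [map_add, hx, hy]
  have hmul : ∀ (a p : Q) (t : BalancedTensor A M Q), BalancedTensor.mulRight φ M (a * p) t =
      BalancedTensor.mulRight φ M p (BalancedTensor.mulRight φ M a t) := by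
    intro a p t
    refine t.induction_on (p := fun t => BalancedTensor.mulRight φ M (a * p) t =
      BalancedTensor.mulRight φ M p (BalancedTensor.mulRight φ M a t))
      (by rw [map_zero, map_zero, map_zero])
      (fun m q => congrArg (BalancedTensor.tmul A m) (mul_assoc q a p).symm) ?_
    intro x y hx hy
    rw [map_add, hx, hy, map_add, map_add]
  have hsum : ∀ (k : ℕ) (p : Fin k → Q) (t : BalancedTensor A M Q),
      BalancedTensor.mulRight φ M (∑ i, p i) t = ∑ i, BalancedTensor.mulRight φ M (p i) t := by
    intro k p t
    refine t.induction_on (p := fun t => BalancedTensor.mulRight φ M (∑ i, p i) t =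
      ∑ i, BalancedTensor.mulRight φ M (p i) t) (by simp) (fun m q => ?_) ?_
    · change BalancedTensor.tmulHom A Q m (q * ∑ i, p i) =
        ∑ i, BalancedTensor.tmulHom A Q m (q * p i)
      rw [Finset.mul_sum, map_sum]
    · intro x y hx hy
      simp only [map_add, Finset.sum_add_distrib, hx, hy]
  have hmap : ∀ (p : Q) (t : BalancedTensor A M Q),
      BalancedTensor.map A Q f (BalancedTensor.mulRight φ M p t) =
        BalancedTensor.mulRight φ M' p (BalancedTensor.map A Q f t) := by
    intro p t
    refine t.induction_on (p := fun t =>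
      BalancedTensor.map A Q f (BalancedTensor.mulRight φ M p t) =
        BalancedTensor.mulRight φ M' p (BalancedTensor.map A Q f t))
      (by rw [map_zero, map_zero, map_zero]) (fun m q => rfl) ?_
    intro x y hx hy
    rw [map_add, map_add, hx, hy, map_add, map_add]
  refine (injective_iff_map_eq_zero _).2 fun t ht => ?_
  obtain ⟨D, hD, hDt⟩ := hden t
  -- Since `t` maps to zero, `f m ⊗ 1 = 0`; so an open right ideal kills `f m`, hence `m` by
  -- injectivity, and `m ⊗ 1 = 0`.
  have hzero : ∀ d ∈ D, BalancedTensor.mulRight φ M (φ d) t = 0 := by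
    intro d hd
    obtain ⟨m, hm⟩ := hDt d hd
    have h1 := congrArg (BalancedTensor.map A Q f) hm
    rw [hmap, ht, map_zero, BalancedTensor.map_tmul] at h1
    obtain ⟨E, hE, hEm⟩ := h.exists_smul_eq_zero h1.symm
    obtain ⟨k, r, p, hr, h2⟩ := h.exists_sum_eq_one hE
    rw [hm, h2]
    change BalancedTensor.tmulHom A Q m _ = 0
    rw [map_sum]
    refine Finset.sum_eq_zero fun i _ => ?_
    change BalancedTensor.tmul A m (r i • p i) = 0
    rw [← BalancedTensor.smul_tmul, hf (a₁ := op (r i) • m) (a₂ := 0)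
      (by rw [map_smul, hEm _ (hr i), map_zero]), BalancedTensor.zero_tmul]
  obtain ⟨k, r, p, hr, h2⟩ := h.exists_sum_eq_one hD
  rw [← hone t, h2, hsum]
  exact Finset.sum_eq_zero fun i _ => by rw [hmul, hzero _ (hr i), map_zero]

end Flat

/-! ### The ring of quotients of a Gabriel topology -/

section Construction

variable {A : Type u} [Ring A] {T : Set (Submodule Aᵐᵒᵖ A)} {hT : IsGabrielTopology T}

/-- The functions `A → A` that are right `A`-linear on some open right ideal. -/
structure LocalHom (_hT : IsGabrielTopology T) : Type u where
  /-- The underlying function. -/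
  toFun : A → A
  exists_linear : ∃ R ∈ T, (∀ x ∈ R, ∀ y ∈ R, toFun (x + y) = toFun x + toFun y) ∧
    ∀ x ∈ R, ∀ a, toFun (x * a) = toFun x * a

namespace LocalHom

theorem map_zero (f : LocalHom hT) : f.1 0 = 0 := by
  obtain ⟨R, hR, -, h⟩ := f.2
  have := h 0 R.zero_mem 0
  rwa [mul_zero, mul_zero] at this

/-- For `s` in the domain of linearity, the colon ideal at `s` of the preimage contains `(S : f s)`.
This makes composition of germs well defined. -/
theorem exists_preimage (f : LocalHom hT) {S : Submodule Aᵐᵒᵖ A} (hS : S ∈ T) :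
    ∃ D ∈ T, ∀ d ∈ D, f.1 d ∈ S := by
  obtain ⟨R, hR, hadd, hmul⟩ := f.2
  let D : Submodule Aᵐᵒᵖ A :=
    { carrier := {d | d ∈ R ∧ f.1 d ∈ S}
      add_mem' := fun hx hy => ⟨R.add_mem hx.1 hy.1, by
        rw [hadd _ hx.1 _ hy.1]; exact S.add_mem hx.2 hy.2⟩
      zero_mem' := ⟨R.zero_mem, by rw [f.map_zero]; exact S.zero_mem⟩
      smul_mem' := fun c x hx => ⟨R.smul_mem c hx.1, by
        obtain ⟨c, rfl⟩ := op_surjective c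
        rw [op_smul_eq_mul, hmul _ hx.1]; exact S.mul_mem_of_mem hx.2 c⟩ }
  refine ⟨D, hT.mem_of_rightColon hR fun s hs => ?_, fun d hd => hd.2⟩
  refine hT.mem_of_le _ (hT.rightColon_mem hS (f.1 s)) _ fun x hx => ?_
  exact ⟨R.mul_mem_of_mem hs x, by
    change f.1 (s * x) ∈ S
    rw [hmul s hs]; exact hx⟩

variable (hT) in
/-- Equality on some open right ideal. -/
def eventuallyEq : Setoid (LocalHom hT) where
  r f g := ∃ R ∈ T, ∀ x ∈ R, f.1 x = g.1 x
  iseqv :=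
    { refl := fun _ => ⟨⊤, hT.top_mem, fun _ _ => rfl⟩
      symm := fun ⟨R, hR, h⟩ => ⟨R, hR, fun x hx => (h x hx).symm⟩
      trans := fun ⟨R, hR, h⟩ ⟨S, hS, h'⟩ => ⟨_, hT.inf_mem R hR S hS,
        fun x hx => (h x hx.1).trans (h' x hx.2)⟩ }

/-- Left multiplication by an element. -/
def mulLeft (a : A) : LocalHom hT :=
  ⟨fun x => a * x, ⊤, hT.top_mem, fun x _ y _ => mul_add a x y, fun x _ b => (mul_assoc a x b).symm⟩

instance : Add (LocalHom hT) where
  add f g := ⟨fun x => f.1 x + g.1 x, by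
    obtain ⟨R, hR, h1, h2⟩ := f.2
    obtain ⟨S, hS, h3, h4⟩ := g.2
    refine ⟨_, hT.inf_mem R hR S hS, fun x hx y hy => ?_, fun x hx a => ?_⟩
    · rw [h1 x hx.1 y hy.1, h3 x hx.2 y hy.2, add_add_add_comm]
    · rw [h2 x hx.1, h4 x hx.2, add_mul]⟩

instance : Neg (LocalHom hT) where
  neg f := ⟨fun x => -f.1 x, by
    obtain ⟨R, hR, h1, h2⟩ := f.2
    refine ⟨R, hR, fun x hx y hy => ?_, fun x hx a => ?_⟩
    · rw [h1 x hx y hy, neg_add]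
    · rw [h2 x hx, neg_mul]⟩

instance : Mul (LocalHom hT) where
  mul f g := ⟨fun x => f.1 (g.1 x), by
    obtain ⟨R, hR, h1, h2⟩ := f.2
    obtain ⟨S, hS, h3, h4⟩ := g.2
    obtain ⟨D, hD, h5⟩ := g.exists_preimage hR
    refine ⟨_, hT.inf_mem D hD S hS, fun x hx y hy => ?_, fun x hx a => ?_⟩
    · rw [h3 x hx.2 y hy.2, h1 _ (h5 x hx.1) _ (h5 y hy.1)]
    · rw [h4 x hx.2, h2 _ (h5 x hx.1)]⟩

end LocalHom

/-- The ring of quotients of `A` with respect to a Gabriel topology (for which `A` is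
torsion-free). -/
def GabrielLocalization (hT : IsGabrielTopology T) : Type u :=
  Quotient (LocalHom.eventuallyEq hT)

namespace GabrielLocalization

/-- The class of a local homomorphism. -/
def mk (f : LocalHom hT) : GabrielLocalization hT := Quotient.mk _ f

theorem mk_surjective : Function.Surjective (mk (hT := hT)) := Quotient.mk_surjective

theorem mk_eq {f g : LocalHom hT} : mk f = mk g ↔ ∃ R ∈ T, ∀ x ∈ R, f.1 x = g.1 x :=
  Quotient.eq (r := LocalHom.eventuallyEq hT)

theorem mk_congr {f g : LocalHom hT} (h : ∀ x, f.1 x = g.1 x) : mk f = mk g :=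
  mk_eq.2 ⟨⊤, hT.top_mem, fun x _ => h x⟩

instance : Zero (GabrielLocalization hT) := ⟨mk (LocalHom.mulLeft 0)⟩

instance : One (GabrielLocalization hT) := ⟨mk (LocalHom.mulLeft 1)⟩

instance : Add (GabrielLocalization hT) where
  add := Quotient.map₂ (· + ·) (by
    rintro f f' ⟨R, hR, h⟩ g g' ⟨S, hS, h'⟩
    refine ⟨_, hT.inf_mem R hR S hS, fun x hx => ?_⟩
    change f.1 x + g.1 x = f'.1 x + g'.1 x
    rw [h x hx.1, h' x hx.2])

instance : Neg (GabrielLocalization hT) where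
  neg := Quotient.map (- ·) (by
    rintro f f' ⟨R, hR, h⟩
    exact ⟨R, hR, fun x hx => congrArg (- ·) (h x hx)⟩)

instance : Mul (GabrielLocalization hT) where
  mul := Quotient.map₂ (· * ·) (by
    rintro f f' ⟨R, hR, h⟩ g g' ⟨S, hS, h'⟩
    obtain ⟨D, hD, hDR⟩ := g.exists_preimage hR
    refine ⟨_, hT.inf_mem D hD S hS, fun x hx => ?_⟩
    change f.1 (g.1 x) = f'.1 (g'.1 x)
    rw [h _ (hDR x hx.1), h' x hx.2])

instance : Ring (GabrielLocalization hT) where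
  add_assoc := by
    rintro ⟨f⟩ ⟨g⟩ ⟨k⟩
    exact mk_congr fun x => add_assoc (f.1 x) (g.1 x) (k.1 x)
  zero_add := by
    rintro ⟨f⟩
    exact mk_congr fun x => by
      change 0 * x + f.1 x = f.1 x
      rw [zero_mul, zero_add]
  add_zero := by
    rintro ⟨f⟩
    exact mk_congr fun x => by
      change f.1 x + 0 * x = f.1 x
      rw [zero_mul, add_zero]
  add_comm := by
    rintro ⟨f⟩ ⟨g⟩
    exact mk_congr fun x => add_comm (f.1 x) (g.1 x)
  neg_add_cancel := by
    rintro ⟨f⟩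
    exact mk_congr fun x => by
      change -f.1 x + f.1 x = 0 * x
      rw [zero_mul, neg_add_cancel]
  zero_mul := by
    rintro ⟨f⟩
    exact mk_congr fun x => by
      change 0 * f.1 x = 0 * x
      rw [zero_mul, zero_mul]
  mul_zero := by
    rintro ⟨f⟩
    exact mk_congr fun x => by
      change f.1 (0 * x) = 0 * x
      rw [zero_mul, f.map_zero]
  one_mul := by
    rintro ⟨f⟩
    exact mk_congr fun x => one_mul (f.1 x)
  mul_one := by
    rintro ⟨f⟩
    exact mk_congr fun x => congrArg f.1 (one_mul x)
  mul_assoc := by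
    rintro ⟨f⟩ ⟨g⟩ ⟨k⟩
    exact mk_congr fun x => rfl
  -- `f` is additive only on an open right ideal, so the argument must first be restricted to where
  -- `g` and `k` take values in it.
  left_distrib := by
    rintro ⟨f⟩ ⟨g⟩ ⟨k⟩
    obtain ⟨R, hR, hadd, -⟩ := f.2
    obtain ⟨D, hD, hg⟩ := LocalHom.exists_preimage g hR
    obtain ⟨E, hE, hk⟩ := LocalHom.exists_preimage k hR
    exact mk_eq.2 ⟨_, hT.inf_mem D hD E hE,
      fun x hx => hadd _ (hg x hx.1) _ (hk x hx.2)⟩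
  right_distrib := by
    rintro ⟨f⟩ ⟨g⟩ ⟨k⟩
    exact mk_congr fun x => rfl
  nsmul := nsmulRec
  zsmul := zsmulRec

variable (hT) in
/-- The canonical map from `A` to its ring of quotients. -/
def of : A →+* GabrielLocalization hT where
  toFun a := mk (LocalHom.mulLeft a)
  map_one' := rfl
  map_zero' := rfl
  map_mul' a b := mk_congr fun x => mul_assoc a b x
  map_add' a b := mk_congr fun x => add_mul a b x

theorem of_injective (htf : ∀ R ∈ T, ∀ a : A, (∀ r ∈ R, a * r = 0) → a = 0) :
    Function.Injective (of hT) := by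
  refine (injective_iff_map_eq_zero _).2 fun a ha => ?_
  obtain ⟨R, hR, h⟩ := mk_eq.1 ha
  refine htf R hR a fun r hr => ?_
  have h1 : a * r = 0 * r := h r hr
  rwa [zero_mul] at h1

theorem exists_mk_mul_of (f : LocalHom hT) :
    ∃ D ∈ T, ∀ d ∈ D, mk f * of hT d = of hT (f.1 d) := by
  obtain ⟨R, hR, -, h⟩ := f.2
  exact ⟨R, hR, fun d hd => mk_congr fun x => h d hd x⟩

theorem eq_zero_of_forall (htf : ∀ R ∈ T, ∀ a : A, (∀ r ∈ R, a * r = 0) → a = 0)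
    {D : Submodule Aᵐᵒᵖ A} (hD : D ∈ T) {q : GabrielLocalization hT}
    (hq : ∀ d ∈ D, q * of hT d = 0) : q = 0 := by
  obtain ⟨f, rfl⟩ := mk_surjective q
  obtain ⟨E, hE, hf⟩ := exists_mk_mul_of f
  refine mk_eq.2 ⟨_, hT.inf_mem D hD E hE, fun x hx => ?_⟩
  have h1 := hq x hx.1
  rw [hf x hx.2, ← _root_.map_zero (of hT)] at h1
  exact (of_injective htf h1).trans (zero_mul x).symm

/-- If the open right ideals are finitely generated projective and have no left annihilators, then
the ring of quotients is a perfect localization. -/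
theorem isPerfectLocalization (htf : ∀ R ∈ T, ∀ a : A, (∀ r ∈ R, a * r = 0) → a = 0)
    (hproj : ∀ R ∈ T, ∃ P : Type, Finite P ∧ Nonempty (Basis P Aᵐᵒᵖ R)) :
    IsPerfectLocalization (of hT) T where
  injective := of_injective htf
  gabriel := hT
  exists_denom q := by
    obtain ⟨f, rfl⟩ := mk_surjective q
    obtain ⟨D, hD, hf⟩ := exists_mk_mul_of f
    exact ⟨D, hD, fun d hd => ⟨_, hf d hd⟩⟩
  extend R hR := by
    classical
    obtain ⟨P, _, ⟨e⟩⟩ := hproj R hR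
    have := Fintype.ofFinite P
    -- The coordinate functionals of a basis of `R`, extended by zero, define germs `e_p*`; the dual
    -- basis identity `∑ e_p e_p* = 1` on `R` puts `1` in the extension of `R`.
    let f : P → LocalHom hT := fun p =>
      ⟨fun x => if h : x ∈ R then (e.repr ⟨x, h⟩ p).unop else 0, R, hR, by
        intro x hx y hy
        rw [dif_pos hx, dif_pos hy, dif_pos (R.add_mem hx hy)]
        have : (⟨x + y, R.add_mem hx hy⟩ : R) = ⟨x, hx⟩ + ⟨y, hy⟩ := rfl
        rw [this, map_add, Finsupp.add_apply, unop_add], by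
        intro x hx a
        rw [dif_pos hx, dif_pos (R.mul_mem_of_mem hx a)]
        have : (⟨x * a, R.mul_mem_of_mem hx a⟩ : R) = op a • ⟨x, hx⟩ := rfl
        rw [this, map_smul, Finsupp.smul_apply, smul_eq_mul, unop_mul, unop_op]⟩
    have hmem : (∑ p, of hT (e p) * mk (f p)) ∈ extendRight (of hT) R :=
      Submodule.sum_mem _ fun p _ => mem_extendRight_of_mem (of hT) (e p).2 _
    have hone : (∑ p, of hT (e p) * mk (f p)) = 1 := by
      refine sub_eq_zero.1 (eq_zero_of_forall htf hR fun d hd => ?_)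
      have hfp : ∀ p, mk (f p) * of hT d = of hT (e.repr ⟨d, hd⟩ p).unop := by
        intro p
        refine mk_congr fun x => ?_
        change (if h : d * x ∈ R then (e.repr ⟨d * x, h⟩ p).unop else 0) =
          (e.repr ⟨d, hd⟩ p).unop * x
        rw [dif_pos (R.mul_mem_of_mem hd x)]
        have : (⟨d * x, R.mul_mem_of_mem hd x⟩ : R) = op x • ⟨d, hd⟩ := rfl
        rw [this, map_smul, Finsupp.smul_apply, smul_eq_mul, unop_mul, unop_op]
      have hd' : d = ∑ p, (e p : A) * (e.repr ⟨d, hd⟩ p).unop := by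
        have := congrArg Subtype.val (e.sum_repr ⟨d, hd⟩)
        rw [Submodule.coe_sum] at this
        exact this.symm
      have hof := congrArg (of hT) hd'
      rw [map_sum] at hof
      rw [sub_mul, one_mul, Finset.sum_mul, sub_eq_zero]
      refine Eq.trans ?_ hof.symm
      exact Finset.sum_congr rfl fun p _ => by rw [mul_assoc, hfp, map_mul]
    rw [hone] at hmem
    exact (extendRight_eq_top_iff _).2 hmem

end GabrielLocalization

/-- Existence of flat bimorphisms with prescribed Gabriel topology. -/
theorem IsGabrielTopology.exists_flatBimorphism (hT : IsGabrielTopology T)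
    (htf : ∀ R ∈ T, ∀ a : A, (∀ r ∈ R, a * r = 0) → a = 0)
    (hproj : ∀ R ∈ T, ∃ P : Type, Finite P ∧ Nonempty (Basis P Aᵐᵒᵖ R)) :
    ∃ F : FlatBimorphism A, F.opens = T := by
  have h := GabrielLocalization.isPerfectLocalization (hT := hT) htf hproj
  exact ⟨⟨GabrielLocalization hT, GabrielLocalization.of hT, h.injective, h.isRingEpi,
    h.isLeftFlatHom⟩, Set.ext fun R => h.extendRight_eq_top_iff⟩

theorem FlatBimorphism.iso_of_opens_eq {F G : FlatBimorphism A} (h : F.opens = G.opens) :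
    F.Iso G :=
  F.isPerfectLocalization.exists_ringEquiv (h ▸ G.isPerfectLocalization)

theorem FlatBimorphism.Iso.opens_eq {F G : FlatBimorphism A} (h : F.Iso G) :
    F.opens = G.opens := by
  obtain ⟨e, he⟩ := h
  ext R
  change extendRight F.φ R = ⊤ ↔ extendRight G.φ R = ⊤
  rw [extendRight_eq_top_iff, extendRight_eq_top_iff]
  constructor
  · intro h1
    obtain ⟨k, r, p, hr, h2⟩ := exists_sum_of_mem_extendRight _ h1
    rw [← map_one e, h2, map_sum]
    refine Submodule.sum_mem _ fun i _ => ?_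
    rw [map_mul, he]
    exact mem_extendRight_of_mem _ (hr i) _
  · intro h1
    obtain ⟨k, r, p, hr, h2⟩ := exists_sum_of_mem_extendRight _ h1
    rw [← map_one e.symm, h2, map_sum]
    refine Submodule.sum_mem _ fun i _ => ?_
    rw [map_mul, ← he, e.symm_apply_apply]
    exact mem_extendRight_of_mem _ (hr i) _

end Construction

/-! ### Topologies generated by products of two-sided ideals -/

section Products

variable {A : Type u} [Ring A]

/-- Testing the generators `x * y` suffices although `R` is only a right ideal: `a (x y) = (a x) y`
has the same form, so they lie in the core of `R`. -/
theorem twoSidedProd_cons_le {I : TwoSidedIdeal A} {l : List (TwoSidedIdeal A)}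
    {R : Submodule Aᵐᵒᵖ A} (h : ∀ x ∈ I, ∀ y ∈ twoSidedProd l, x * y ∈ R) :
    (twoSidedProd (I :: l)).toRightIdeal ≤ R := by
  have : twoSidedProd (I :: l) ≤ rightCore R := by
    refine TwoSidedIdeal.span_le.2 ?_
    rintro _ ⟨x, hx, y, hy, rfl⟩
    refine mem_rightCore.2 fun a => ?_
    rw [← mul_assoc]
    exact h _ (I.mul_mem_left a x hx) y hy
  exact fun z hz => rightCore_le R (this hz)

theorem mul_mem_twoSidedProd_cons {I : TwoSidedIdeal A} {l : List (TwoSidedIdeal A)} {x y : A}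
    (hx : x ∈ I) (hy : y ∈ twoSidedProd l) : x * y ∈ twoSidedProd (I :: l) :=
  TwoSidedIdeal.subset_span ⟨x, hx, y, hy, rfl⟩

theorem twoSidedProd_append_le {l l' : List (TwoSidedIdeal A)} {R : Submodule Aᵐᵒᵖ A}
    (h : ∀ x ∈ twoSidedProd l, ∀ y ∈ twoSidedProd l', x * y ∈ R) :
    (twoSidedProd (l ++ l')).toRightIdeal ≤ R := by
  induction l generalizing R with
  | nil => exact fun y hy => by simpa using h 1 trivial y hy
  | cons I l ih =>
    refine twoSidedProd_cons_le fun x hx => ?_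
    refine ih (R := rightColon R x) fun x' hx' y hy => ?_
    rw [mem_rightColon, ← mul_assoc]
    exact h _ (mul_mem_twoSidedProd_cons hx hx') y hy

theorem IsGabrielTopology.twoSidedProd_mem {T : Set (Submodule Aᵐᵒᵖ A)} (hT : IsGabrielTopology T)
    {l : List (TwoSidedIdeal A)} (hl : ∀ I ∈ l, I.toRightIdeal ∈ T) :
    (twoSidedProd l).toRightIdeal ∈ T := by
  induction l with
  | nil => exact hT.top_mem
  | cons I l ih =>
    refine hT.mem_of_rightColon (hl I (by simp)) fun s hs => ?_
    exact hT.mem_of_le _ (ih fun J hJ => hl J (by simp [hJ])) _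
      fun x hx => mul_mem_twoSidedProd_cons hs hx

/-- Maximal two-sided ideals are prime: if neither factor lies in `M`, write `1 = x + m = y + m'`;
then `1 = x y + m y + m'` lies in `M`. -/
theorem exists_le_of_twoSidedProd_le {M : TwoSidedIdeal A} (hM : IsCoatom M)
    {l : List (TwoSidedIdeal A)} (h : twoSidedProd l ≤ M) : ∃ I ∈ l, I ≤ M := by
  induction l with
  | nil => exact absurd (top_le_iff.1 h) hM.1
  | cons I l ih =>
    by_contra! hl
    have h1 : I ⊔ M = ⊤ := hM.2 _ (right_lt_sup.2 (hl I (by simp)))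
    have h2 : twoSidedProd l ⊔ M = ⊤ := by
      refine hM.2 _ (right_lt_sup.2 fun h' => ?_)
      obtain ⟨J, hJ, hJM⟩ := ih h'
      exact hl J (by simp [hJ]) hJM
    obtain ⟨x, hx, m, hm, hxm⟩ := TwoSidedIdeal.mem_sup.1 (h1 ▸ trivial : (1 : A) ∈ I ⊔ M)
    obtain ⟨y, hy, m', hm', hym⟩ := TwoSidedIdeal.mem_sup.1
      (h2 ▸ trivial : (1 : A) ∈ twoSidedProd l ⊔ M)
    refine hM.1 ((TwoSidedIdeal.one_mem_iff M).1 ?_)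
    have h3 : (1 : A) = x * y + m * y + m' := by
      rw [← add_mul, hxm, one_mul, hym]
    rw [h3]
    exact M.add_mem (M.add_mem (h (mul_mem_twoSidedProd_cons hx hy)) (M.mul_mem_right _ _ hm)) hm'

/-- The right ideals containing a product of members of `Φ`. -/
def productTopology (Φ : Set (TwoSidedIdeal A)) : Set (Submodule Aᵐᵒᵖ A) :=
  {R | ∃ l : List (TwoSidedIdeal A), (∀ I ∈ l, I ∈ Φ) ∧ (twoSidedProd l).toRightIdeal ≤ R}

/-- Transitivity needs finite generation: each generator `s` of a product has its own product inside
`(R : s)`, and the concatenation of finitely many of these serves all generators at once. -/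
theorem isGabrielTopology_productTopology {Φ : Set (TwoSidedIdeal A)}
    (hfg : ∀ l : List (TwoSidedIdeal A), (∀ I ∈ l, I ∈ Φ) → (twoSidedProd l).toRightIdeal.FG) :
    IsGabrielTopology (productTopology Φ) := by
  classical
  refine .of_rightColon ⟨[], by simp, le_top⟩ ?_ ?_ ?_
  · rintro R ⟨l, hl, hlR⟩ S hRS
    exact ⟨l, hl, hlR.trans hRS⟩
  · rintro R ⟨l, hl, hlR⟩ a
    exact ⟨l, hl, fun x hx => hlR (TwoSidedIdeal.mul_mem_left _ a x hx)⟩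
  · rintro R S ⟨l, hl, hlS⟩ h
    obtain ⟨t, ht⟩ := hfg l hl
    have hex : ∀ t : Finset A, (∀ s ∈ t, s ∈ S) → ∃ l : List (TwoSidedIdeal A),
        (∀ I ∈ l, I ∈ Φ) ∧ ∀ s ∈ t, (twoSidedProd l).toRightIdeal ≤ rightColon R s := by
      intro t
      induction t using Finset.induction_on with
      | empty => exact fun _ => ⟨[], by simp, by simp⟩
      | insert s t _ ih =>
        intro hs
        obtain ⟨l₁, hl₁, h₁⟩ := ih fun r hr => hs r (by simp [hr])
        obtain ⟨l₂, hl₂, h₂⟩ := h s (hs s (by simp))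
        refine ⟨l₁ ++ l₂, fun I hI => ?_, fun r hr => ?_⟩
        · exact (List.mem_append.1 hI).elim (hl₁ I) (hl₂ I)
        · refine twoSidedProd_append_le fun x hx y hy => ?_
          rcases Finset.mem_insert.1 hr with rfl | hr
          · exact h₂ (TwoSidedIdeal.mul_mem_left _ x y hy)
          · exact h₁ r hr (TwoSidedIdeal.mul_mem_right _ x y hx)
    obtain ⟨l', hl', h'⟩ := hex t fun s hs => hlS (ht ▸ Submodule.subset_span hs)
    refine ⟨l ++ l', fun I hI => (List.mem_append.1 hI).elim (hl I) (hl' I), ?_⟩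
    refine twoSidedProd_append_le fun x hx y hy => ?_
    have hx' : x ∈ Submodule.span Aᵐᵒᵖ (t : Set A) := ht ▸ hx
    clear hx
    induction hx' using Submodule.closure_induction with
    | zero => rw [zero_mul]; exact R.zero_mem
    | add x x' _ _ h1 h2 => rw [add_mul]; exact R.add_mem h1 h2
    | smul_mem a x hx =>
      obtain ⟨a, rfl⟩ := op_surjective a
      rw [op_smul_eq_mul, mul_assoc]
      exact h' x hx (TwoSidedIdeal.mul_mem_left _ a y hy)

end Products

/-! ### Annihilators of simple factors -/

section Maximal

variable {K : Type u} [Field K] {A : Type u} [Ring A] [Algebra K A]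

theorem codim_lt_codim {R S : Submodule Aᵐᵒᵖ A} (hR : FiniteCodim K R) (h : R < S) :
    codim K S < codim K R := by
  have : Module.Finite K (A ⧸ R.restrictScalars K) := hR
  have hle : R.restrictScalars K ≤ S.restrictScalars K := h.le
  let f := Submodule.factor hle
  have h1 := LinearMap.finrank_range_add_finrank_ker f
  rw [LinearMap.range_eq_top.2 (Submodule.factor_surjective hle), finrank_top] at h1
  obtain ⟨x, hxS, hxR⟩ := SetLike.exists_of_lt h
  have hpos : 0 < finrank K (LinearMap.ker f) := by
    rw [finrank_pos_iff_exists_ne_zero]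
    refine ⟨⟨(R.restrictScalars K).mkQ x, ?_⟩, fun h0 => hxR ?_⟩
    · change Submodule.factor hle _ = 0
      rw [Submodule.factor_mk]
      exact (Submodule.Quotient.mk_eq_zero _).2 hxS
    · exact (Submodule.Quotient.mk_eq_zero (R.restrictScalars K)).1 (congrArg Subtype.val h0)
  change finrank K (A ⧸ S.restrictScalars K) < finrank K (A ⧸ R.restrictScalars K)
  omega

/-- The annihilator of the right module `S / R`. -/
def rightResidual (R S : Submodule Aᵐᵒᵖ A) : TwoSidedIdeal A :=
  TwoSidedIdeal.mk' {c | ∀ x ∈ S, x * c ∈ R} (fun x _ => by simp)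
    (fun ha hb x hx => by rw [mul_add]; exact R.add_mem (ha x hx) (hb x hx))
    (fun ha x hx => by rw [mul_neg]; exact R.neg_mem (ha x hx))
    (fun hb x hx => by rw [← mul_assoc]; exact hb _ (S.mul_mem_of_mem hx _))
    (fun ha x hx => by rw [← mul_assoc]; exact R.mul_mem_of_mem (ha x hx) _)

theorem mem_rightResidual {R S : Submodule Aᵐᵒᵖ A} {c : A} :
    c ∈ rightResidual R S ↔ ∀ x ∈ S, x * c ∈ R := by
  simp [rightResidual]

/-- The annihilator of a simple finite-dimensional module is a maximal two-sided ideal. -/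
theorem isCoatom_rightResidual {R S : Submodule Aᵐᵒᵖ A} (hR : FiniteCodim K R)
    (hRS : R ⋖ S) : IsCoatom (rightResidual R S) := by
  classical
  refine ⟨fun h => ?_, fun B hB => ?_⟩
  · have h1 : (1 : A) ∈ rightResidual R S := h ▸ trivial
    exact hRS.1.not_ge fun x hx => by simpa using mem_rightResidual.1 h1 x hx
  · have hsimple : ∀ (v : A) (N : Submodule Aᵐᵒᵖ A), v ∈ S →
        (∀ x ∈ N, v * x ∈ R) ∨ ∀ y ∈ S, ∃ x ∈ N, y - v * x ∈ R := by
      intro v N hv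
      let W := N.map (Module.toModuleEnd Aᵐᵒᵖ A v) ⊔ R
      have hWS : W ≤ S := by
        refine sup_le ?_ hRS.1.le
        rintro _ ⟨x, -, rfl⟩
        exact S.mul_mem_of_mem hv x
      rcases (le_sup_right : R ≤ W).eq_or_lt with h | h
      · refine Or.inl fun x hx => ?_
        rw [h]
        exact Submodule.mem_sup_left ⟨x, hx, rfl⟩
      · refine Or.inr fun y hy => ?_
        have hWS' : W = S := hWS.lt_or_eq.resolve_left (hRS.2 h)
        rw [← hWS'] at hy
        obtain ⟨_, ⟨x, hx, rfl⟩, r, hr, rfl⟩ := Submodule.mem_sup.1 hy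
        refine ⟨x, hx, ?_⟩
        have : Module.toModuleEnd Aᵐᵒᵖ A v x + r - v * x = r := add_sub_cancel_left (v * x) r
        rw [this]
        exact hr
    -- Density argument: some `b ∈ B` fixes finitely many vectors modulo `R`. Let `L` annihilate the
    -- earlier ones. If `L ∩ B` moves `v`, it corrects `b` at `v` without disturbing them. If not,
    -- `L` kills `v`, as otherwise `v L` would fill `S ⧸ R` and `B` would kill it; then `1 - b ∈ L`
    -- gives `v (1 - b) ∈ R`.
    have hfin : ∀ s : Finset A, (∀ v ∈ s, v ∈ S) → ∃ b ∈ B, ∀ v ∈ s, v - v * b ∈ R := by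
      intro s
      induction s using Finset.induction_on with
      | empty => exact fun _ => ⟨0, B.zero_mem, by simp⟩
      | insert v s _ ih =>
        intro hs
        obtain ⟨b, hb, hbs⟩ := ih fun w hw => hs w (by simp [hw])
        have hv := hs v (by simp)
        let L : Submodule Aᵐᵒᵖ A := s.inf fun w => rightColon R w
        have hL : ∀ x, x ∈ L ↔ ∀ w ∈ s, w * x ∈ R := fun x => Submodule.mem_finsetInf
        rcases hsimple v (L ⊓ B.toRightIdeal) hv with h | h
        · refine ⟨b, hb, fun w hw => ?_⟩
          rcases Finset.mem_insert.1 hw with rfl | hw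
          · have hwL : ∀ x ∈ L, w * x ∈ R := by
              refine (hsimple w L hv).resolve_right fun h' => hB.not_ge fun c hc => ?_
              refine mem_rightResidual.2 fun y hy => ?_
              obtain ⟨x, hx, hyx⟩ := h' y hy
              have h1 : y * c = (y - w * x) * c + w * (x * c) := by
                rw [sub_mul, mul_assoc, sub_add_cancel]
              rw [h1]
              exact R.add_mem (R.mul_mem_of_mem hyx c)
                (h _ ⟨L.mul_mem_of_mem hx c, B.mul_mem_left x c hc⟩)
            have h1 := hwL (1 - b) ((hL _).2 fun z hz => by
              rw [mul_sub, mul_one]; exact hbs z hz)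
            rwa [mul_sub, mul_one] at h1
          · exact hbs w hw
        · obtain ⟨x, ⟨hxL, hxB⟩, hx⟩ := h (v - v * b)
            (S.sub_mem hv (S.mul_mem_of_mem hv b))
          refine ⟨b + x, B.add_mem hb hxB, fun w hw => ?_⟩
          have h1 : w - w * (b + x) = w - w * b - w * x := by rw [mul_add, sub_add_eq_sub_sub]
          rw [h1]
          rcases Finset.mem_insert.1 hw with rfl | hw
          · exact hx
          · exact R.sub_mem (hbs w hw) ((hL x).1 hxL w hw)
    -- Finitely many vectors span `S` modulo `R`, so some `b ∈ B` acts as the identity on `S ⧸ R`;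
    -- then `1 - b` is in the annihilator, hence in `B`.
    obtain ⟨W, hW⟩ := (R.restrictScalars K).exists_isCompl
    have hWfg : W.FG := Submodule.CoFG.fg_of_isCompl hW hR
    have := isNoetherian_of_fg_of_noetherian W hWfg
    obtain ⟨s, hs⟩ := isNoetherian_submodule.1 this (W ⊓ S.restrictScalars K) inf_le_left
    have hsS : ∀ v ∈ s, v ∈ S := fun v hv =>
      (hs ▸ Submodule.subset_span hv : v ∈ W ⊓ S.restrictScalars K).2
    obtain ⟨b, hb, hbs⟩ := hfin s hsS
    have h1 : 1 - b ∈ rightResidual R S := by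
      refine mem_rightResidual.2 fun x hx => ?_
      have hx' : x ∈ R.restrictScalars K ⊔ W ⊓ S.restrictScalars K := by
        rw [← sup_inf_assoc_of_le W (show R.restrictScalars K ≤ S.restrictScalars K from hRS.1.le),
          hW.sup_eq_top, top_inf_eq]
        exact hx
      obtain ⟨r, hr, y, hy, rfl⟩ := Submodule.mem_sup.1 hx'
      rw [add_mul]
      refine R.add_mem (R.mul_mem_of_mem hr _) ?_
      rw [← hs] at hy
      have : Submodule.span K (s : Set A) ≤
          (R.restrictScalars K).comap (LinearMap.mulRight K (1 - b)) :=
        Submodule.span_le.2 fun v hv => by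
          change v * (1 - b) ∈ R
          rw [mul_sub, mul_one]
          exact hbs v hv
      exact this hy
    refine (TwoSidedIdeal.one_mem_iff B).1 ?_
    have h2 : (1 : A) = (1 - b) + b := by abel
    rw [h2]
    exact B.add_mem (hB.le h1) hb

theorem exists_covBy_of_finiteCodim {R : Submodule Aᵐᵒᵖ A} (hR : FiniteCodim K R) (h : R ≠ ⊤) :
    ∃ S, R ⋖ S := by
  obtain ⟨S, hS, hmin⟩ := (measure fun S : Submodule Aᵐᵒᵖ A => codim K R - codim K S).wf.has_min
    {S | R < S} ⟨⊤, lt_top_iff_ne_top.2 h⟩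
  refine ⟨S, hS, fun S' h1 h2 => hmin S' h1 ?_⟩
  have h3 := codim_lt_codim hR h1
  have h4 := codim_lt_codim (hR.of_le h1.le) h2
  change codim K R - codim K S' < codim K R - codim K S
  omega

/-- In a Gabriel topology, an open right ideal of finite codimension contains a product of open
maximal two-sided ideals. -/
theorem IsGabrielTopology.exists_twoSidedProd_le {T : Set (Submodule Aᵐᵒᵖ A)}
    (hT : IsGabrielTopology T) {R : Submodule Aᵐᵒᵖ A} (hR : R ∈ T) (hfc : FiniteCodim K R) :
    ∃ l : List (TwoSidedIdeal A), (∀ I ∈ l, IsCoatom I ∧ I.toRightIdeal ∈ T) ∧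
      (twoSidedProd l).toRightIdeal ≤ R := by
  induction hN : codim K R using Nat.strong_induction_on generalizing R with
  | _ N ih =>
    by_cases h : R = ⊤
    · exact ⟨[], by simp, by rw [h]; exact le_top⟩
    · obtain ⟨S, hS⟩ := exists_covBy_of_finiteCodim hfc h
      obtain ⟨l, hl, hlS⟩ := ih _ (hN ▸ codim_lt_codim hfc hS.1) (hT.mem_of_le R hR S hS.1.le)
        (hfc.of_le hS.1.le) rfl
      -- The annihilator of `S ⧸ R` is open because it contains the core of `R`. Since it carries
      -- `S` into `R`, it becomes the last factor of the product.
      have hC : (rightResidual R S).toRightIdeal ∈ T :=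
        hT.mem_of_le _ (hT.rightCore_mem hR hfc) _ fun x hx =>
          mem_rightResidual.2 fun y _ => mem_rightCore.1 hx y
      refine ⟨l ++ [rightResidual R S], fun I hI => ?_, ?_⟩
      · rcases List.mem_append.1 hI with hI | hI
        · exact hl I hI
        · obtain rfl := List.mem_singleton.1 hI
          exact ⟨isCoatom_rightResidual hfc hS, hC⟩
      · refine twoSidedProd_append_le fun x hx y hy => ?_
        have hy' : y ∈ (rightResidual R S).toRightIdeal :=
          twoSidedProd_cons_le (fun a ha b _ => TwoSidedIdeal.mul_mem_right _ a b ha) hy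
        exact mem_rightResidual.1 hy' x (hlS hx)

end Maximal

/-! ### Classification of flat bimorphisms by maximal ideals -/

section FlatBimorphisms

variable {K : Type u} [Field K] {n : ℕ}

theorem FlatBimorphism.nontrivial {A : Type u} [Ring A] [Nontrivial A] (F : FlatBimorphism A) :
    Nontrivial F.Q :=
  F.injective.nontrivial

/-- The open right ideals of a flat bimorphism of a free algebra have finite codimension. -/
theorem FlatBimorphism.finiteCodim_of_mem_opens (F : FlatBimorphism (FreeAlgebra K (Fin n)))
    {R : Submodule (FreeAlgebra K (Fin n))ᵐᵒᵖ (FreeAlgebra K (Fin n))} (hR : R ∈ F.opens) :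
    FiniteCodim K R := by
  have hF := F.isPerfectLocalization
  obtain ⟨k, r, p, hr, h1⟩ := hF.exists_sum_eq_one hR
  let S := Submodule.span (FreeAlgebra K (Fin n))ᵐᵒᵖ (Set.range r)
  have hSR : S ≤ R := Submodule.span_le.2 (by rintro _ ⟨i, rfl⟩; exact hr i)
  have hS : S ∈ F.opens := by
    refine (extendRight_eq_top_iff F.φ).2 ?_
    rw [h1]
    exact Submodule.sum_mem _ fun i _ =>
      mem_extendRight_of_mem F.φ (Submodule.subset_span (Set.mem_range_self i)) _
  refine FiniteCodim.of_le ?_ hSR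
  by_contra hfc
  obtain ⟨s, hs⟩ := FreeAlgebra.exists_rightColon_eq_bot
    (Submodule.fg_span (Set.finite_range r)) hfc
  -- If the codimension were infinite, the zero right ideal would be open, forcing `1 = 0` in `Q`.
  have hbot := hF.gabriel.rightColon_mem hS s
  rw [hs] at hbot
  have := F.nontrivial
  refine one_ne_zero (hF.eq_zero_of_mul hbot (x := 1) fun d hd => ?_)
  rw [(Submodule.mem_bot _).1 hd, map_zero, mul_zero]

theorem FlatBimorphism.opens_eq_productTopology (F : FlatBimorphism (FreeAlgebra K (Fin n))) :
    F.opens = productTopology F.maxIdeals := by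
  have hF := F.isPerfectLocalization
  ext R
  constructor
  · exact fun hR => hF.gabriel.exists_twoSidedProd_le hR (F.finiteCodim_of_mem_opens hR)
  · rintro ⟨l, hl, hlR⟩
    exact hF.gabriel.mem_of_le _ (hF.gabriel.twoSidedProd_mem fun I hI => (hl I hI).2) _ hlR

/-- Localize at `productTopology Φ`. Open right ideals have finite codimension, hence finite bases,
and are non-zero as `n ≥ 1`, so they have no left annihilator in a domain. No other maximal ideal is
open: it would contain a member of `Φ` by primeness, and equal it by maximality. -/
theorem exists_flatBimorphism_maxIdeals_eq (hn : 1 ≤ n)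
    {Φ : Set (TwoSidedIdeal (FreeAlgebra K (Fin n)))}
    (hΦ : ∀ I ∈ Φ, IsCoatom I ∧ FiniteCodim K I.toRightIdeal) :
    ∃ F : FlatBimorphism (FreeAlgebra K (Fin n)), F.maxIdeals = Φ := by
  have hfc : ∀ l : List (TwoSidedIdeal (FreeAlgebra K (Fin n))), (∀ I ∈ l, I ∈ Φ) →
      FiniteCodim K (twoSidedProd l).toRightIdeal := fun l hl =>
    FreeAlgebra.isGabrielTopology_fc.twoSidedProd_mem fun I hI => (hΦ I (hl I hI)).2
  have hT := isGabrielTopology_productTopology (Φ := Φ)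
    fun l hl => FreeAlgebra.fg_of_finiteCodim (hfc l hl)
  have hTfc : ∀ R ∈ productTopology Φ, FiniteCodim K R := fun R ⟨l, hl, hlR⟩ =>
    (hfc l hl).of_le hlR
  obtain ⟨F, hF⟩ := hT.exists_flatBimorphism (fun R hR a ha => by
      have hne : R ≠ ⊥ := by
        rintro rfl
        exact FreeAlgebra.not_finiteCodim_bot hn (hTfc _ hR)
      obtain ⟨r, hr, hr0⟩ := R.ne_bot_iff.1 hne
      exact (mul_eq_zero.1 (ha r hr)).resolve_right hr0)
    (fun R hR => FreeAlgebra.exists_basis_of_finiteCodim (hTfc R hR))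
  refine ⟨F, Set.ext fun M => ⟨?_, fun hM => ⟨(hΦ M hM).1, ?_⟩⟩⟩
  · rintro ⟨hM, hMF⟩
    have : M.toRightIdeal ∈ F.opens := hMF
    rw [hF] at this
    obtain ⟨l, hl, hlM⟩ := this
    obtain ⟨I, hI, hIM⟩ := exists_le_of_twoSidedProd_le hM (l := l) hlM
    have : I = M := hIM.eq_of_not_lt fun hlt => hM.1 ((hΦ I (hl I hI)).1.2 _ hlt)
    exact this ▸ hl I hI
  · change M.toRightIdeal ∈ F.opens
    rw [hF]
    exact ⟨[M], by simpa using hM,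
      twoSidedProd_cons_le fun x hx y _ => TwoSidedIdeal.mul_mem_right _ x y hx⟩

end FlatBimorphisms

/-! ### Projective modules over rings with free right ideals -/

section Hereditary

variable {S D ι : Type*} [Ring S] [AddCommGroup D] [Module S D] [LinearOrder ι]

/-- The elements of a submodule of `ι →₀ D` supported at indices `≤ i`. -/
noncomputable def Submodule.truncate (U : Submodule S (ι →₀ D)) (i : ι) : Submodule S (ι →₀ D) where
  carrier := {f | f ∈ U ∧ ∀ j, i < j → f j = 0}
  add_mem' hf hg := ⟨U.add_mem hf.1 hg.1, fun j hj => by simp [hf.2 j hj, hg.2 j hj]⟩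
  zero_mem' := ⟨U.zero_mem, fun _ _ => rfl⟩
  smul_mem' c f hf := ⟨U.smul_mem c hf.1, fun j hj => by simp [hf.2 j hj]⟩

/-- The leading coefficients at `i` of the elements of a submodule of `ι →₀ D`. -/
noncomputable def Submodule.leadingCoeffs (U : Submodule S (ι →₀ D)) (i : ι) : Submodule S D :=
  (U.truncate i).map (Finsupp.lapply i)

/-- If all submodules of `D` are free, then so are all submodules of `ι →₀ D`. -/
theorem Submodule.nonempty_basis_of_leadingCoeffs [WellFoundedLT ι] (U : Submodule S (ι →₀ D))
    {P : ι → Type*} (e : ∀ i, Basis (P i) S (U.leadingCoeffs i)) :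
    Nonempty (Basis (Σ i, P i) S U) := by
  have hex : ∀ y : Σ i, P i, ∃ f ∈ U.truncate y.1, f y.1 = (e y.1 y.2 : D) :=
    fun y => (e y.1 y.2).2
  choose v hvU hv using hex
  have hli : LinearIndependent S v := by
    rw [linearIndependent_iff]
    intro l hl
    by_contra hne
    -- At the largest first index of the relation only the vectors with that index contribute, and
    -- their coefficients there are basis elements.
    obtain ⟨y, hy, hmax⟩ := Finset.exists_max_image l.support (fun y => y.1)
      (Finsupp.support_nonempty_iff.2 hne)
    have h1 := DFunLike.congr_fun hl y.1
    rw [Finsupp.linearCombination_apply, Finsupp.sum, Finsupp.finsetSum_apply] at h1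
    have h2 : l.sum (fun z c => c • v z y.1) = 0 := h1
    rw [Finsupp.sigma_sum, Finset.sum_eq_single y.1] at h2
    · have h3 : Finsupp.linearCombination S (e y.1) (l.split y.1) = 0 := by
        refine Subtype.ext ?_
        rw [Finsupp.linearCombination_apply, Finsupp.sum, Submodule.coe_sum]
        rw [Submodule.coe_zero, ← h2, Finsupp.sum]
        exact Finset.sum_congr rfl fun p _ => by rw [hv]; rfl
      have h4 := linearIndependent_iff.1 (e y.1).linearIndependent _ h3
      have h5 := DFunLike.congr_fun h4 y.2
      rw [Finsupp.split_apply] at h5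
      exact Finsupp.mem_support_iff.1 hy h5
    · intro i hi hiy
      refine Finset.sum_eq_zero fun p hp => ?_
      have hip : (⟨i, p⟩ : Σ i, P i) ∈ l.support := by
        rw [Finsupp.mem_support_iff, ← Finsupp.split_apply]
        exact Finsupp.mem_support_iff.1 hp
      beta_reduce
      rw [(hvU ⟨i, p⟩).2 y.1 (lt_of_le_of_ne (hmax _ hip) hiy), smul_zero]
    · intro hy'
      have h3 : l.split y.1 = 0 := by
        by_contra h
        exact hy' ((Finsupp.mem_splitSupport_iff_nonzero l y.1).2 h)
      rw [h3, Finsupp.sum_zero_index]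
  have hspan : Submodule.span S (Set.range v) = U := by
    refine le_antisymm (Submodule.span_le.2 (by rintro _ ⟨y, rfl⟩; exact (hvU y).1)) ?_
    -- Well-founded induction on a bound for the support: subtracting `g` cancels the coefficient at
    -- `i`, leaving only indices below `i`.
    have key : ∀ i, ∀ f ∈ U, (∀ j, i < j → f j = 0) → f ∈ Submodule.span S (Set.range v) := by
      intro i
      induction i using WellFoundedLT.induction with
      | _ i ih =>
        intro f hf hfi
        let c := (e i).repr ⟨f i, ⟨f, ⟨hf, hfi⟩, rfl⟩⟩
        let g := Finsupp.linearCombination S (fun p => v ⟨i, p⟩) c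
        have hg : ∀ N : Submodule S (ι →₀ D), (∀ p, v ⟨i, p⟩ ∈ N) → g ∈ N := fun N hN => by
          rw [show g = _ from Finsupp.linearCombination_apply S c]
          exact N.sum_mem fun p _ => N.smul_mem _ (hN p)
        have hgs : g ∈ Submodule.span S (Set.range v) :=
          hg _ fun p => Submodule.subset_span ⟨⟨i, p⟩, rfl⟩
        have hgU : g ∈ U.truncate i := hg _ fun p => hvU ⟨i, p⟩
        have hgi : g i = f i := by
          have h1 := congrArg Subtype.val ((e i).linearCombination_repr ⟨f i, ⟨f, ⟨hf, hfi⟩, rfl⟩⟩)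
          rw [Finsupp.linearCombination_apply, Finsupp.sum, Submodule.coe_sum] at h1
          change Finsupp.lapply (R := S) i g = f i
          rw [Finsupp.apply_linearCombination, Finsupp.linearCombination_apply, Finsupp.sum]
          refine Eq.trans (Finset.sum_congr rfl fun p _ => ?_) h1
          change _ • v ⟨i, p⟩ i = _
          rw [hv]
          rfl
        have hfg : f = (f - g) + g := by abel
        rw [hfg]
        refine Submodule.add_mem _ ?_ hgs
        by_cases h0 : f - g = 0
        · rw [h0]; exact zero_mem _
        · obtain ⟨m, hm, hmax⟩ := Finset.exists_max_image (f - g).support id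
            (Finsupp.support_nonempty_iff.2 h0)
          have hmi : m < i := by
            by_contra! hle
            refine Finsupp.mem_support_iff.1 hm ?_
            rcases hle.eq_or_lt with rfl | hlt
            · simp [hgi]
            · simp [hfi m hlt, hgU.2 m hlt]
          refine ih m hmi _ (U.sub_mem hf hgU.1) fun j hj => ?_
          by_contra h
          exact (hmax j (Finsupp.mem_support_iff.2 h)).not_gt hj
    intro f hf
    by_cases h0 : f = 0
    · rw [h0]; exact zero_mem _
    · obtain ⟨m, -, hmax⟩ := Finset.exists_max_image f.support id
        (Finsupp.support_nonempty_iff.2 h0)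
      refine key m f hf fun j hj => ?_
      by_contra h
      exact (hmax j (Finsupp.mem_support_iff.2 h)).not_gt hj
  exact ⟨(Basis.span hli).map (LinearEquiv.ofEq _ _ hspan)⟩

/-- If every right ideal is free, then every projective right module is free. -/
theorem isRightProjectiveFree_of_basis {Q : Type u} [Ring Q]
    (h : ∀ J : Submodule Qᵐᵒᵖ Q, ∃ P : Type, Nonempty (Basis P Qᵐᵒᵖ J)) :
    IsRightProjectiveFree.{u, w} Q := by
  intro M _ _ hM
  -- The section `s` embeds `M` in a free module indexed by `M`, which is then well-ordered; leading
  -- coefficients form right ideals of `Q`.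
  obtain ⟨s, hs⟩ := Module.projective_def'.1 hM
  obtain ⟨_, _⟩ := exists_wellFoundedLT M
  let E : Qᵐᵒᵖ ≃ₗ[Qᵐᵒᵖ] Q :=
    { (opAddEquiv (α := Q)).symm with
      map_smul' := fun a b => rfl }
  let f : M →ₗ[Qᵐᵒᵖ] (M →₀ Q) := (Finsupp.mapRange.linearEquiv E).toLinearMap ∘ₗ s
  have hf : Function.Injective f :=
    (Finsupp.mapRange.linearEquiv E).injective.comp
      (Function.LeftInverse.injective (g := Finsupp.linearCombination Qᵐᵒᵖ id)
        (LinearMap.congr_fun hs))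
  choose P hP using fun i => h ((LinearMap.range f).leadingCoeffs i)
  obtain ⟨b⟩ := (LinearMap.range f).nonempty_basis_of_leadingCoeffs fun i => (hP i).some
  exact Module.Free.of_basis (b.map (LinearEquiv.ofInjective f hf).symm)

end Hereditary

theorem FlatBimorphism.exists_basis_rightIdeal {K : Type u} [Field K] {n : ℕ}
    (F : FlatBimorphism (FreeAlgebra K (Fin n))) (J : Submodule F.Qᵐᵒᵖ F.Q) :
    ∃ P : Type, Nonempty (Basis P F.Qᵐᵒᵖ J) := by
  let R : Submodule (FreeAlgebra K (Fin n))ᵐᵒᵖ (FreeAlgebra K (Fin n)) :=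
    { carrier := {a | F.φ a ∈ J}
      add_mem' := fun ha hb => by
        rw [Set.mem_ofPred_eq, map_add]; exact J.add_mem ha hb
      zero_mem' := by rw [Set.mem_ofPred_eq, map_zero]; exact J.zero_mem
      smul_mem' := fun c x hx => by
        obtain ⟨c, rfl⟩ := op_surjective c
        rw [Set.mem_ofPred_eq, op_smul_eq_mul, map_mul]
        exact J.mul_mem_of_mem hx _ }
  obtain ⟨P, ⟨e⟩⟩ := FreeAlgebra.exists_basis_rightIdeal R
  exact ⟨P, F.isPerfectLocalization.free_of_basis J (R := R) (fun _ => Iff.rfl) e⟩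

theorem FlatBimorphism.isRightHereditary {K : Type u} [Field K] {n : ℕ}
    (F : FlatBimorphism (FreeAlgebra K (Fin n))) : IsRightHereditary F.Q := fun J => by
  obtain ⟨P, ⟨e⟩⟩ := F.exists_basis_rightIdeal J
  exact Module.Projective.of_basis e

/-! ### Ranks of isomorphic free modules -/

section ModuleType

variable {K : Type u} [Field K] {n : ℕ}

theorem Submodule.CoFG.pi {A : Type u} [Ring A] [Algebra K A] {D : Submodule Aᵐᵒᵖ A}
    (hD : FiniteCodim K D) {i : ℕ} {U : Submodule Aᵐᵒᵖ (Fin i → A)}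
    (h : ∀ a : Fin i → A, (∀ k, a k ∈ D) → a ∈ U) : (U.restrictScalars K).CoFG := by
  have : Module.Finite K (A ⧸ D.restrictScalars K) := hD
  refine Submodule.CoFG.of_le ?_ (Submodule.CoFG.ker
    (LinearMap.pi fun k : Fin i => (D.restrictScalars K).mkQ ∘ₗ LinearMap.proj k))
  intro a ha
  refine h a fun k => ?_
  have h1 := congrFun (LinearMap.mem_ker.1 ha) k
  exact (Submodule.Quotient.mk_eq_zero (D.restrictScalars K)).1 h1

/-- The vectors over `A` whose images under a linear map over `Q` have entries in `A`. -/
def integralVectors {A Q : Type u} [Ring A] [Ring Q] (φ : A →+* Q) {i j : ℕ}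
    (e : (Fin i → Q) →ₗ[Qᵐᵒᵖ] (Fin j → Q)) : Submodule Aᵐᵒᵖ (Fin i → A) where
  carrier := {a | ∃ b : Fin j → A, e (φ ∘ a) = φ ∘ b}
  add_mem' := by
    rintro a a' ⟨b, hb⟩ ⟨b', hb'⟩
    refine ⟨b + b', ?_⟩
    have h1 : φ ∘ (a + a') = φ ∘ a + φ ∘ a' := by ext; simp
    rw [h1, map_add, hb, hb']
    ext; simp
  zero_mem' := by
    refine ⟨0, ?_⟩
    have h1 : φ ∘ (0 : Fin i → A) = 0 := by ext; simp
    rw [h1, map_zero]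
    ext; simp
  smul_mem' := by
    rintro c a ⟨b, hb⟩
    obtain ⟨c, rfl⟩ := op_surjective c
    refine ⟨op c • b, ?_⟩
    have h1 : φ ∘ (op c • a) = op (φ c) • (φ ∘ a) := by ext; simp
    rw [h1, map_smul, hb]
    ext; simp

/-- The matrix entries of `e` have a common denominator ideal `D`, of finite codimension, and `e`
takes vectors with entries in `D` to integral ones. -/
theorem FlatBimorphism.cofg_integralVectors (F : FlatBimorphism (FreeAlgebra K (Fin n))) {i j : ℕ}
    (e : (Fin i → F.Q) →ₗ[F.Qᵐᵒᵖ] (Fin j → F.Q)) :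
    ((integralVectors F.φ e).restrictScalars K).CoFG := by
  have hF := F.isPerfectLocalization
  obtain ⟨D, hD, hDe⟩ := hF.exists_common_denom
    fun x : Fin i × Fin j => e (Pi.single x.1 1) x.2
  refine Submodule.CoFG.pi (F.finiteCodim_of_mem_opens hD) fun a ha => ?_
  choose b hb using fun (k : Fin i) (l : Fin j) => hDe (k, l) (a k) (ha k)
  refine ⟨fun l => ∑ k, b k l, ?_⟩
  have h1 : F.φ ∘ a = ∑ k, op (F.φ (a k)) • (Pi.single k 1 : Fin i → F.Q) := by
    ext l
    simp [Finset.sum_apply, Pi.single_apply]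
  rw [h1, map_sum]
  ext l
  rw [Finset.sum_apply, Function.comp_apply, map_sum]
  refine Finset.sum_congr rfl fun k _ => ?_
  rw [map_smul, Pi.smul_apply, op_smul_eq_mul]
  exact hb k l

/-- `e` maps `A^i ∩ e⁻¹(A^j)` onto `e(A^i) ∩ A^j`. -/
theorem nonempty_integralVectors_equiv {A Q : Type u} [Ring A] [Ring Q] {φ : A →+* Q}
    (hφ : Function.Injective φ) {i j : ℕ} (e : (Fin i → Q) ≃ₗ[Qᵐᵒᵖ] (Fin j → Q)) :
    Nonempty (integralVectors φ e.toLinearMap ≃ₗ[Aᵐᵒᵖ] integralVectors φ e.symm.toLinearMap) := by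
  have hinj : ∀ {k : ℕ} {a b : Fin k → A}, φ ∘ a = φ ∘ b → a = b := fun h =>
    funext fun l => hφ (congrFun h l)
  choose f hf using fun a : integralVectors φ e.toLinearMap => a.2
  choose g hg using fun a : integralVectors φ e.symm.toLinearMap => a.2
  simp only [LinearEquiv.coe_coe] at hf hg
  have hf' : ∀ a, e.symm (φ ∘ f a) = φ ∘ a.1 := fun a => by
    rw [← hf, e.symm_apply_apply]
  have hg' : ∀ a, e (φ ∘ g a) = φ ∘ a.1 := fun a => by
    rw [← hg, e.apply_symm_apply]
  exact ⟨{
    toFun := fun a => ⟨f a, ⟨a, hf' a⟩⟩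
    invFun := fun a => ⟨g a, ⟨a, hg' a⟩⟩
    left_inv := fun a => Subtype.ext (hinj (by rw [← hg]; exact hf' a))
    right_inv := fun a => Subtype.ext (hinj (by rw [← hf]; exact hg' a))
    map_add' := fun a b => Subtype.ext (hinj (by
      have h1 : φ ∘ (a + b).1 = φ ∘ a.1 + φ ∘ b.1 := by ext; simp
      have h2 : φ ∘ (f a + f b) = φ ∘ f a + φ ∘ f b := by ext; simp
      change φ ∘ f (a + b) = φ ∘ (f a + f b)
      rw [← hf, h1, map_add, hf, hf, h2]))
    map_smul' := fun c a => Subtype.ext (hinj (by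
      obtain ⟨c, rfl⟩ := op_surjective c
      have h1 : φ ∘ (op c • a).1 = op (φ c) • φ ∘ a.1 := by ext; simp
      have h2 : φ ∘ (op c • f a) = op (φ c) • φ ∘ f a := by ext; simp
      change φ ∘ f (op c • a) = φ ∘ (op c • f a)
      rw [← hf, h1, map_smul, hf, h2])) }⟩

/-- Isomorphic free modules over a flat epimorphic image of the free algebra of rank `n` have ranks
congruent modulo `n - 1`. -/
theorem FlatBimorphism.le_of_freeRanksIso (hn : 2 ≤ n)
    (F : FlatBimorphism (FreeAlgebra K (Fin n))) {i j : ℕ} (hi : 1 ≤ i) (hij : i < j)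
    (h : FreeRanksIso F.Q i j) : n ≤ j := by
  obtain ⟨e⟩ := h
  obtain ⟨r, d, hrd, ⟨b⟩⟩ := FreeAlgebra.exists_basis_fin (F.cofg_integralVectors e.toLinearMap)
  obtain ⟨r', d', hrd', ⟨b'⟩⟩ :=
    FreeAlgebra.exists_basis_fin (F.cofg_integralVectors e.symm.toLinearMap)
  obtain ⟨E⟩ := nonempty_integralVectors_equiv F.injective e
  have hr : r = r' := Fin.equiv_iff_eq.1 ⟨(b.map E).indexEquiv b'⟩
  obtain ⟨m, rfl⟩ : ∃ m, n = m + 1 := ⟨n - 1, by omega⟩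
  -- With `m = n - 1` both ranks agree: `d m + i = d' m + j`. As `i < j`, this forces `d' < d`, so
  -- `j ≥ i + m ≥ n`.
  rw [mul_add, mul_one] at hrd hrd'
  have h1 : d * m + i = d' * m + j := by omega
  have h2 : d' < d := by
    by_contra! hle
    have := Nat.mul_le_mul_right m hle
    omega
  have h3 := Nat.mul_le_mul_right m (Nat.succ_le_of_lt h2)
  rw [Nat.succ_mul] at h3
  omega

end ModuleType

/-! ### Ideals in the presence of Leavitt relations -/

section Leavitt

variable {Q : Type u} [Ring Q] {n : ℕ} {x y : Fin n → Q}

/-- The product `x_{i₁} ⋯ x_{i_k}` indexed by a word. -/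
def evalWord (x : Fin n → Q) (l : List (Fin n)) : Q := (l.map x).prod

/-- The product `y_{i_k} ⋯ y_{i₁}` indexed by a word `i₁ ⋯ i_k`. -/
def evalWordRev (y : Fin n → Q) (l : List (Fin n)) : Q := (l.reverse.map y).prod

theorem evalWord_cons (i : Fin n) (l : List (Fin n)) :
    evalWord x (i :: l) = x i * evalWord x l := by
  simp [evalWord]

theorem evalWordRev_cons (i : Fin n) (l : List (Fin n)) :
    evalWordRev y (i :: l) = evalWordRev y l * y i := by
  simp [evalWordRev]

variable (hyx : ∀ i j, y i * x j = if i = j then 1 else 0)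

include hyx

theorem evalWordRev_cons_mul_cons (i j : Fin n) (l l' : List (Fin n)) :
    evalWordRev y (i :: l) * evalWord x (j :: l') =
      if i = j then evalWordRev y l * evalWord x l' else 0 := by
  rw [evalWordRev_cons, evalWord_cons, mul_assoc, ← mul_assoc (y i), hyx]
  split_ifs <;> simp

theorem evalWordRev_mul_self (l : List (Fin n)) : evalWordRev y l * evalWord x l = 1 := by
  induction l with
  | nil => simp [evalWordRev, evalWord]
  | cons i l ih => rw [evalWordRev_cons_mul_cons hyx, if_pos rfl, ih]

/-- The letters of `l` cancel against `j`'s or give zero; since `k` exceeds the length of `l`, a `j`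
survives for `y i` to kill. -/
theorem mul_evalWordRev_mul_replicate {i j : Fin n} (hij : i ≠ j) (l : List (Fin n)) {k : ℕ}
    (h : l.length < k) :
    y i * (evalWordRev y l * evalWord x (List.replicate k j)) = 0 := by
  obtain ⟨k, rfl⟩ : ∃ k', k = k' + 1 := ⟨k - 1, by omega⟩
  induction l generalizing k with
  | nil =>
    rw [List.replicate_succ, evalWord_cons]
    simp only [evalWordRev, List.reverse_nil, List.map_nil, List.prod_nil, one_mul]
    rw [← mul_assoc, hyx, if_neg hij, zero_mul]
  | cons a l ih =>
    rw [List.replicate_succ, evalWordRev_cons_mul_cons hyx]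
    split_ifs
    · obtain ⟨k, rfl⟩ : ∃ k', k = k' + 1 := ⟨k - 1, by simp at h; omega⟩
      exact ih k (by simp at h; omega)
    · rw [mul_zero]

/-- If `l'` is not a prefix of `l`, the product already vanishes. Otherwise the next letter of `l`
meets `i`: it gives zero or leaves a shorter word against the `j`'s. -/
theorem mul_evalWordRev_mul_eq_zero {i j : Fin n} (hij : i ≠ j) {k : ℕ} {l l' : List (Fin n)}
    (hl : l'.length ≤ l.length) (hne : l' ≠ l) (hk : l.length < k) :
    y i * (evalWordRev y l * (evalWord x l' * evalWord x (i :: List.replicate k j))) = 0 := by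
  induction l' generalizing l with
  | nil =>
    cases l with
    | nil => exact absurd rfl hne
    | cons a l =>
      simp only [evalWord, List.map_nil, List.prod_nil, one_mul]
      change y i * (evalWordRev y (a :: l) * evalWord x (i :: List.replicate k j)) = 0
      rw [evalWordRev_cons_mul_cons hyx]
      split_ifs
      · exact mul_evalWordRev_mul_replicate hyx hij l (by simp at hk; omega)
      · rw [mul_zero]
  | cons b l' ih =>
    cases l with
    | nil => simp at hl
    | cons a l =>
      rw [← mul_assoc (evalWordRev y _), evalWordRev_cons_mul_cons hyx]
      split_ifs with hab
      · subst hab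
        rw [mul_assoc]
        exact ih (by simpa using hl) (fun h => hne (by rw [h])) (by simp at hk; omega)
      · rw [zero_mul, mul_zero]

/-- A two-sided ideal containing a non-zero noncommutative polynomial in the `x i`, with
coefficients in a central field, is the unit ideal. -/
theorem TwoSidedIdeal.eq_top_of_sum_mem (hn : 2 ≤ n) {K : Type v} [Field K] (κ : K →+* Q)
    (hκ : ∀ c i, κ c * x i = x i * κ c) (J : TwoSidedIdeal Q) {g : List (Fin n) →₀ K} (hg : g ≠ 0)
    (hJ : (g.sum fun l c => evalWord x l * κ c) ∈ J) : J = ⊤ := by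
  obtain ⟨l₀, hl₀, hmax⟩ := Finset.exists_max_image g.support List.length
    (Finsupp.support_nonempty_iff.2 hg)
  let i : Fin n := ⟨0, by omega⟩
  let j : Fin n := ⟨1, by omega⟩
  have hij : i ≠ j := by simp [i, j]
  have hcomm : ∀ c l, κ c * evalWord x l = evalWord x l * κ c := by
    intro c l
    induction l with
    | nil => simp [evalWord]
    | cons a l ih => rw [evalWord_cons, ← mul_assoc, hκ, mul_assoc, ih, mul_assoc]
  -- For a longest word `l₀` of `g`, multiplying by `y i` and the reversed `l₀` on the left and by
  -- `x i` and more than `l₀.length` copies of `x j` on the right kills every other term.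
  let r := List.replicate (l₀.length + 1) j
  have hsum : y i * (evalWordRev y l₀ * ((g.sum fun l c => evalWord x l * κ c) *
      evalWord x (i :: r))) = evalWord x r * κ (g l₀) := by
    rw [Finsupp.sum, Finset.sum_mul, Finset.mul_sum, Finset.mul_sum,
      Finset.sum_eq_single l₀]
    · rw [mul_assoc, hcomm, evalWord_cons, ← mul_assoc (evalWordRev y l₀),
        evalWordRev_mul_self hyx, one_mul, ← mul_assoc, ← mul_assoc, hyx, if_pos rfl, one_mul]
    · intro l hl hne
      rw [mul_assoc, hcomm, ← mul_assoc (evalWord x l), ← mul_assoc (evalWordRev y l₀),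
        ← mul_assoc (y i), mul_evalWordRev_mul_eq_zero hyx hij (hmax l hl) hne (Nat.lt_succ_self _),
        zero_mul]
    · intro h
      exact absurd hl₀ h
  have h1 : evalWord x r * κ (g l₀) ∈ J := by
    rw [← hsum]
    exact J.mul_mem_left _ _ (J.mul_mem_left _ _ (J.mul_mem_right _ _ hJ))
  have h2 := J.mul_mem_left (evalWordRev y r) _ h1
  rw [← mul_assoc, evalWordRev_mul_self hyx, one_mul] at h2
  have h3 := J.mul_mem_left (κ (g l₀)⁻¹) _ h2
  rw [← map_mul, inv_mul_cancel₀ (Finsupp.mem_support_iff.1 hl₀), map_one] at h3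
  exact (TwoSidedIdeal.one_mem_iff J).1 h3

end Leavitt

/-! ### Inverting an ideal of codimension one -/

section CodimOne

variable {K : Type u} [Field K] {n : ℕ}

namespace FreeAlgebra

/-- The substitution `a_i ↦ a_i + c_i`. -/
def translate (c : Fin n → K) : FreeAlgebra K (Fin n) →ₐ[K] FreeAlgebra K (Fin n) :=
  lift K fun i => ι K i + algebraMap K _ (c i)

theorem translate_ι (c : Fin n → K) (i : Fin n) :
    translate c (ι K i) = ι K i + algebraMap K _ (c i) := by
  simp [translate]

theorem translate_translate_neg (c : Fin n → K) (a : FreeAlgebra K (Fin n)) :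
    translate c (translate (-c) a) = a := by
  have : (translate c).comp (translate (-c)) = AlgHom.id K _ := by
    ext i
    simp [translate_ι]
  exact DFunLike.congr_fun this a

/-- Only the `i`-th summand has words starting with `i`, so the coordinate of the sum at `i :: l` is
that of `g i` at `l`. -/
theorem eq_zero_of_sum_ι_mul_eq_zero {g : Fin n → FreeAlgebra K (Fin n)}
    (h : ∑ i, ι K i * g i = 0) (i : Fin n) : g i = 0 := by
  classical
  refine (wordBasis K n).repr.map_eq_zero_iff.1 (Finsupp.ext fun l => ?_)
  have h1 := DFunLike.congr_fun (congrArg (wordBasis K n).repr h) (i :: l)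
  rw [map_sum, Finsupp.finsetSum_apply, Finset.sum_eq_single i] at h1
  · have h2 : ι K i = word K [i] := by simp [word]
    rw [h2, repr_word_mul] at h1
    have h3 := Finsupp.mapDomain_apply (List.append_right_injective [i])
      ((wordBasis K n).repr (g i)) l
    simp only [List.singleton_append] at h3 h1
    rw [h3] at h1
    simpa using h1
  · intro j _ hji
    have h2 : ι K j = word K [j] := by simp [word]
    rw [h2, repr_word_mul]
    refine Finsupp.mapDomain_of_notMem_range _ _ ?_
    rintro ⟨l', hl'⟩
    exact hji (by simpa using congrArg List.head? hl')
  · simp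

/-- The elements `a_i + c_i` are right linearly independent. -/
theorem linearIndependent_translate (c : Fin n → K) :
    LinearIndependent (FreeAlgebra K (Fin n))ᵐᵒᵖ fun i => ι K i + algebraMap K _ (c i) := by
  rw [Fintype.linearIndependent_iff]
  intro g hg i
  -- Substituting `a_i - c_i` for `a_i` turns this into a relation among the free generators.
  have h1 := congrArg (translate (-c)) hg
  rw [map_sum, map_zero] at h1
  have h2 := eq_zero_of_sum_ι_mul_eq_zero (K := K)
    (g := fun i => translate (-c) (g i).unop) (by
      rw [← h1]
      refine Finset.sum_congr rfl fun i _ => ?_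
      change _ = translate (-c) ((ι K i + algebraMap K _ (c i)) * (g i).unop)
      rw [map_mul, map_add, translate_ι, AlgHom.commutes]
      simp) i
  have h3 := translate_translate_neg c (g i).unop
  rw [h2, map_zero] at h3
  exact unop_injective h3.symm

/-- Modulo the right ideal generated by the `a_i + c_i` every element is a scalar. -/
theorem exists_sub_algebraMap_mem_span (c : Fin n → K) (a : FreeAlgebra K (Fin n)) :
    ∃ k : K, a - algebraMap K _ k ∈ Submodule.span (FreeAlgebra K (Fin n))ᵐᵒᵖ
      (Set.range fun i => ι K i + algebraMap K _ (c i)) := by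
  set R := Submodule.span (FreeAlgebra K (Fin n))ᵐᵒᵖ
    (Set.range fun i => ι K i + algebraMap K (FreeAlgebra K (Fin n)) (c i))
  induction a using FreeAlgebra.induction with
  | grade0 r => exact ⟨r, by rw [sub_self]; exact R.zero_mem⟩
  | grade1 i => exact ⟨-c i, Submodule.subset_span ⟨i, by simp⟩⟩
  | mul a b ha hb =>
    obtain ⟨k, hk⟩ := ha
    obtain ⟨l, hl⟩ := hb
    refine ⟨k * l, ?_⟩
    have : a * b - algebraMap K _ (k * l) =
        (a - algebraMap K _ k) * b + (b - algebraMap K _ l) * algebraMap K _ k := by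
      rw [sub_mul, sub_mul, map_mul, Algebra.commutes k b, Algebra.commutes k]
      abel
    rw [this]
    exact R.add_mem (R.mul_mem_of_mem hk _) (R.mul_mem_of_mem hl _)
  | add a b ha hb =>
    obtain ⟨k, hk⟩ := ha
    obtain ⟨l, hl⟩ := hb
    refine ⟨k + l, ?_⟩
    rw [map_add, add_sub_add_comm]
    exact R.add_mem hk hl

/-- Each `a_i` is congruent to a scalar modulo `I`. Modulo the right ideal of the differences every
element is a scalar, and a non-zero scalar in `I` would make `I` the unit ideal. -/
theorem exists_span_eq_of_codim_eq_one {I : TwoSidedIdeal (FreeAlgebra K (Fin n))} (hI : I ≠ ⊤)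
    (h : codim K I.toRightIdeal = 1) : ∃ c : Fin n → K,
      Submodule.span (FreeAlgebra K (Fin n))ᵐᵒᵖ
        (Set.range fun i => ι K i + algebraMap K _ (c i)) = I.toRightIdeal := by
  have h1 : (1 : FreeAlgebra K (Fin n)) ∉ I := fun h => hI ((TwoSidedIdeal.one_mem_iff I).1 h)
  let R := I.toRightIdeal.restrictScalars K
  have hv : R.mkQ 1 ≠ 0 := fun h0 => h1 ((Submodule.Quotient.mk_eq_zero R).1 h0)
  have h2 := (finrank_eq_one_iff_of_nonzero' _ hv).1 h
  choose c hc using fun i => h2 (R.mkQ (ι K i))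
  have hmem : ∀ i, ι K i + algebraMap K _ (-c i) ∈ I := by
    intro i
    have h3 : R.mkQ (ι K i + algebraMap K _ (-c i)) = 0 := by
      rw [map_add, ← hc, Algebra.algebraMap_eq_smul_one, map_smul, neg_smul, add_neg_cancel]
    exact (Submodule.Quotient.mk_eq_zero R).1 h3
  refine ⟨fun i => -c i, le_antisymm (Submodule.span_le.2 ?_) fun z hz => ?_⟩
  · rintro _ ⟨i, rfl⟩
    exact hmem i
  · obtain ⟨k, hk⟩ := exists_sub_algebraMap_mem_span (fun i => -c i) z
    have hspan : Submodule.span (FreeAlgebra K (Fin n))ᵐᵒᵖ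
        (Set.range fun i => ι K i + algebraMap K _ (-c i)) ≤ I.toRightIdeal :=
      Submodule.span_le.2 (by rintro _ ⟨i, rfl⟩; exact hmem i)
    have hk0 : k = 0 := by
      by_contra hk0
      have h3 : algebraMap K _ k ∈ I := by
        have := I.sub_mem hz (hspan hk)
        rwa [sub_sub_cancel] at this
      have h4 := I.mul_mem_left (algebraMap K _ k⁻¹) _ h3
      rw [← map_mul, inv_mul_cancel₀ hk0, map_one] at h4
      exact h1 h4
    rw [hk0, map_zero, sub_zero] at hk
    exact hk

end FreeAlgebra

open FreeAlgebra in
/-- Over a flat bimorphism inverting an ideal of codimension one, the row of the generators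
`a_i + c_i` of this ideal is invertible. -/
theorem FlatBimorphism.exists_inverse_row (F : FlatBimorphism (FreeAlgebra K (Fin n)))
    (h : ∃ I ∈ F.maxIdeals, codim K I.toRightIdeal = 1) : ∃ (c : Fin n → K) (y : Fin n → F.Q),
      (∀ i j, y i * F.φ (ι K j + algebraMap K _ (c j)) = if i = j then 1 else 0) ∧
      ∑ i, F.φ (ι K i + algebraMap K _ (c i)) * y i = 1 := by
  obtain ⟨I, hI, hcodim⟩ := h
  have hF := F.isPerfectLocalization
  obtain ⟨c, hc⟩ := exists_span_eq_of_codim_eq_one hI.1.1 hcodim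
  let e := (Basis.span (linearIndependent_translate c)).map (LinearEquiv.ofEq _ _ hc)
  have he : ∀ i, (e i : FreeAlgebra K (Fin n)) = ι K i + algebraMap K _ (c i) := fun i => by
    simp [e, Basis.span_apply]
  have hIF : I.toRightIdeal ∈ F.opens := hI.2
  let E : (FreeAlgebra K (Fin n))ᵐᵒᵖ →ₗ[(FreeAlgebra K (Fin n))ᵐᵒᵖ] FreeAlgebra K (Fin n) :=
    { (opAddEquiv (α := FreeAlgebra K (Fin n))).symm with
      map_smul' := fun a b => rfl }
  -- The coordinate functionals of the basis `a_i + c_i` of the open ideal are left multiplications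
  -- by elements `y i` of `Q`; the two relations are the dual basis identities.
  choose y hy using fun i => hF.exists_mul_eq hIF (E ∘ₗ e.coord i)
  have hy' : ∀ i (r : I.toRightIdeal), y i * F.φ r = F.φ (e.repr r i).unop := hy
  refine ⟨c, y, fun i j => ?_, hF.eq_of_mul hIF fun r hr => ?_⟩
  · classical
    rw [← he, hy', e.repr_self, Finsupp.single_apply]
    rcases eq_or_ne i j with rfl | hij
    · simp
    · simp [hij, hij.symm]
  · rw [one_mul, Finset.sum_mul]
    have h1 := congrArg (fun z : I.toRightIdeal => F.φ z) (e.sum_repr ⟨r, hr⟩)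
    simp only [Submodule.coe_sum, map_sum] at h1
    refine Eq.trans (Finset.sum_congr rfl fun i _ => ?_) h1
    have h2 : y i * F.φ r = F.φ (e.repr ⟨r, hr⟩ i).unop := hy' i ⟨r, hr⟩
    rw [mul_assoc, h2, ← he, ← map_mul]
    rfl

open FreeAlgebra in
-- Clearing denominators, a non-zero ideal of `Q` contains the image of some `f ≠ 0`. Translation
-- rewrites `f` as a non-zero polynomial in the `a_i + c_i`, to which the Leavitt relations apply.
theorem FlatBimorphism.isSimpleRing (hn : 2 ≤ n) (F : FlatBimorphism (FreeAlgebra K (Fin n)))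
    (h : ∃ I ∈ F.maxIdeals, codim K I.toRightIdeal = 1) : IsSimpleRing F.Q := by
  obtain ⟨c, y, hyx, -⟩ := F.exists_inverse_row h
  have hF := F.isPerfectLocalization
  have := F.nontrivial
  refine ⟨⟨fun J => or_iff_not_imp_left.2 fun hJ => ?_⟩⟩
  obtain ⟨q, hqJ, hq⟩ : ∃ q ∈ J, q ≠ 0 := by
    by_contra! h0
    exact hJ (le_bot_iff.1 fun q hq => (TwoSidedIdeal.mem_bot _).2 (h0 q hq))
  obtain ⟨D, hD, hDq⟩ := hF.exists_denom q
  obtain ⟨d, hd, hqd⟩ : ∃ d ∈ D, q * F.φ d ≠ 0 := by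
    by_contra! h0
    exact hq (hF.eq_zero_of_mul hD h0)
  obtain ⟨f, hf⟩ := hDq d hd
  have hfJ : F.φ f ∈ J := hf ▸ J.mul_mem_right q _ hqJ
  let g := (wordBasis K n).repr (translate (-c) f)
  have hfg : F.φ f = g.sum fun l k =>
      evalWord (fun i => F.φ (ι K i + algebraMap K _ (c i))) l *
        (F.φ.comp (algebraMap K _)) k := by
    have h1 : f = translate c (Finsupp.linearCombination K (wordBasis K n) g) := by
      rw [Basis.linearCombination_repr, translate_translate_neg]
    conv_lhs => rw [h1]
    rw [Finsupp.linearCombination_apply, Finsupp.sum, Finsupp.sum, map_sum, map_sum]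
    refine Finset.sum_congr rfl fun l _ => ?_
    rw [map_smul, Algebra.smul_def, Algebra.commutes, map_mul, wordBasis_apply, word,
      map_list_prod, map_list_prod, List.map_map, List.map_map]
    congr 3
    funext i
    simp [translate_ι]
  refine TwoSidedIdeal.eq_top_of_sum_mem hyx hn (F.φ.comp (algebraMap K _)) ?_ J (g := g) ?_
    (hfg ▸ hfJ)
  · intro k i
    rw [RingHom.comp_apply, ← map_mul, ← map_mul, Algebra.commutes]
  · intro h0
    have h1 : translate (-c) f = 0 := (wordBasis K n).repr.map_eq_zero_iff.1 h0
    have h2 := translate_translate_neg c f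
    rw [h1, map_zero] at h2
    rw [hf, ← h2, map_zero] at hqd
    exact hqd rfl

open FreeAlgebra in
theorem FlatBimorphism.hasModuleType (hn : 2 ≤ n) (F : FlatBimorphism (FreeAlgebra K (Fin n)))
    (h : ∃ I ∈ F.maxIdeals, codim K I.toRightIdeal = 1) : HasModuleType F.Q 1 n := by
  refine ⟨le_rfl, by omega, ?_, fun i j hi hij hiso => ⟨hi, F.le_of_freeRanksIso hn hi hij hiso⟩⟩
  obtain ⟨c, y, hyx, hxy⟩ := F.exists_inverse_row h
  exact ⟨{
    toFun := fun q i => y i * q 0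
    invFun := fun q _ => ∑ i, F.φ (ι K i + algebraMap K _ (c i)) * q i
    left_inv := fun q => by
      ext k
      obtain rfl := Subsingleton.elim k 0
      simp only [← mul_assoc, ← Finset.sum_mul, hxy, one_mul]
    right_inv := fun q => by
      ext k
      simp only [Finset.mul_sum, ← mul_assoc, hyx]
      simp
    map_add' := fun q q' => by ext; simp [mul_add]
    map_smul' := fun a q => by
      ext i
      exact (mul_assoc (y i) (q 0) a.unop).symm }⟩

end CodimOne

theorem proposition3p8 (K : Type u) [Field K] (n : ℕ) (hn : 1 ≤ n) :
    -- the fc-topology is a Hausdorff Gabriel topology with a basis of two-sided ideals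
    (IsGabrielTopology {R : Submodule (FreeAlgebra K (Fin n))ᵐᵒᵖ (FreeAlgebra K (Fin n)) |
        FiniteCodim K R} ∧
      @T2Space (FreeAlgebra K (Fin n)) (fcTopology K (FreeAlgebra K (Fin n))) ∧
      (@nhds (FreeAlgebra K (Fin n)) (fcTopology K (FreeAlgebra K (Fin n))) 0).HasBasis
        (fun I : TwoSidedIdeal (FreeAlgebra K (Fin n)) => FiniteCodim K I.toRightIdeal)
        (fun I => (I : Set (FreeAlgebra K (Fin n))))) ∧
    -- `F ↦ F.maxIdeals` is a bijection from isomorphism classes of flat bimorphisms onto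
    -- sets of maximal two-sided ideals of finite codimension
    ((∀ F : FlatBimorphism (FreeAlgebra K (Fin n)), ∀ I ∈ F.maxIdeals,
        IsCoatom I ∧ FiniteCodim K I.toRightIdeal) ∧
      (∀ F G : FlatBimorphism (FreeAlgebra K (Fin n)),
        F.maxIdeals = G.maxIdeals ↔ F.Iso G) ∧
      (∀ Φ : Set (TwoSidedIdeal (FreeAlgebra K (Fin n))),
        (∀ I ∈ Φ, IsCoatom I ∧ FiniteCodim K I.toRightIdeal) →
        ∃ F : FlatBimorphism (FreeAlgebra K (Fin n)), F.maxIdeals = Φ)) ∧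
    -- properties of an arbitrary flat bimorphism
    (∀ F : FlatBimorphism (FreeAlgebra K (Fin n)),
      IsGabrielTopology F.opens ∧
      (∀ R : Submodule (FreeAlgebra K (Fin n))ᵐᵒᵖ (FreeAlgebra K (Fin n)),
        R ∈ F.opens ↔ ∃ l : List (TwoSidedIdeal (FreeAlgebra K (Fin n))),
          (∀ I ∈ l, I ∈ F.maxIdeals) ∧ (twoSidedProd l).toRightIdeal ≤ R) ∧
      IsRightHereditary F.Q ∧
      IsRightProjectiveFree.{u, w} F.Q ∧
      (2 ≤ n → (∃ I ∈ F.maxIdeals, codim K I.toRightIdeal = 1) →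
        IsSimpleRing F.Q ∧ HasModuleType F.Q 1 n)) := by
  refine ⟨⟨FreeAlgebra.isGabrielTopology_fc,
    t2Space_fcTopology fun _ => FreeAlgebra.exists_finiteCodim_notMem,
    nhds_zero_fcTopology_hasBasis FreeAlgebra.isGabrielTopology_fc⟩,
    ⟨fun F I hI => ⟨hI.1, F.finiteCodim_of_mem_opens hI.2⟩, fun F G => ⟨fun h => ?_, fun h => ?_⟩,
      fun Φ hΦ => exists_flatBimorphism_maxIdeals_eq hn hΦ⟩,
    fun F => ⟨F.isPerfectLocalization.gabriel, fun R => ?_, F.isRightHereditary,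
      isRightProjectiveFree_of_basis F.exists_basis_rightIdeal,
      fun hn2 h => ⟨F.isSimpleRing hn2 h, F.hasModuleType hn2 h⟩⟩⟩
  · refine FlatBimorphism.iso_of_opens_eq ?_
    rw [F.opens_eq_productTopology, G.opens_eq_productTopology, h]
  · ext I
    exact and_congr_right fun _ => Set.ext_iff.1 h.opens_eq I.toRightIdeal
  · rw [F.opens_eq_productTopology]
    rfl
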